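/- Let $d(n)$ be the number of positive divisors of $n$. Let $\gamma$ be Euler's constant and, for $n\ge 1$, let $\gamma_n=\lim_{N\to\infty}\bigl(\sum_{k\le N}\frac{(\log k)^n}{k}-\frac{(\log N)^{n+1}}{n+1}\bigr)$ be the Stieltjes constants. Put $$C_1=\tfrac16,\quad C_2=2\gamma-\tfrac12,\quad C_3=6\gamma^2-4\gamma-4\gamma_1+1,\quad C_4=4\gamma^3-6\gamma^2+4\gamma-12\gamma\gamma_1+4\gamma_1+2\gamma_2-1,$$ let $H(s)=1/\zeta(2s)$, where $\zeta$ is the Riemann zeta function, and put $$D_1=C_1H(1),\quad D_2=C_2H(1)+3C_1H'(1),\quad D_3=C_3H(1)+2C_2H'(1)+3C_1H''(1),\quad D_4=C_4H(1)+C_3H'(1)+C_2H''(1)+C_1H'''(1).$$ Then for every real $x\ge 2$, $$\Bigl|\sum_{n\le x} d(n)^2-\bigl(D_1x\log^3x+D_2x\log^2x+D_3x\log x+D_4x\bigr)\Bigr|\le 9.73\,x^{3/4}\log x+0.73\,x^{1/2}.$$ Moreover $D_1=1/\pi^2$, $\;0.744<D_2<0.745$, $\;0.823<D_3<0.824$ and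 $\;0.460<D_4<0.461$. Furthermore, $$\sum_{n\le x} d(n)^2\le \tfrac14\,x\log^3x\quad\text{for all real }x\ge 433,\qquad \sum_{n\le x} d(n)^2\le x\log^3x\quad\text{for all real }x\ge 7.$$ -/

import Mathlib

open Filter

namespace DivisorSquare

/-- The Stieltjes constant `γ_n`, the limit as `N → ∞` of
`∑_{k ≤ N} (log k)^n / k - (log N)^(n+1) / (n+1)`. In the Laurent expansion of `ζ` at `1`
the coefficient of `(s - 1)^n` is `(-1)^n γ_n / n!`. -/
noncomputable def stieltjes (n : ℕ) : ℝ :=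
  limUnder atTop (fun N : ℕ =>
    (∑ k ∈ Finset.Icc 1 N, (Real.log (k : ℝ)) ^ n / (k : ℝ)) -
      (Real.log (N : ℝ)) ^ (n + 1) / ((n : ℝ) + 1))

/-- Coefficient of `x log³ x` in the main term of `∑_{n ≤ x} d₄(n)`. -/
noncomputable def C1 : ℝ := 1 / 6

/-- Coefficient of `x log² x` in the main term of `∑_{n ≤ x} d₄(n)`. -/
noncomputable def C2 : ℝ := 2 * Real.eulerMascheroniConstant - 1 / 2

/-- Coefficient of `x log x` in the main term of `∑_{n ≤ x} d₄(n)`. -/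
noncomputable def C3 : ℝ :=
  6 * Real.eulerMascheroniConstant ^ 2 - 4 * Real.eulerMascheroniConstant
    - 4 * stieltjes 1 + 1

/-- Coefficient of `x` in the main term of `∑_{n ≤ x} d₄(n)`. -/
noncomputable def C4 : ℝ :=
  4 * Real.eulerMascheroniConstant ^ 3 - 6 * Real.eulerMascheroniConstant ^ 2
    + 4 * Real.eulerMascheroniConstant
    - 12 * Real.eulerMascheroniConstant * stieltjes 1
    + 4 * stieltjes 1 + 2 * stieltjes 2 - 1

/-- The function `H(s) = 1 / ζ(2s)`. -/
noncomputable def H (s : ℂ) : ℂ := 1 / riemannZeta (2 * s)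

/-- The `k`-th derivative of `H` at `s = 1`. Since `H` is real on the real axis near `1`, this
complex derivative is a real number, and taking the real part only changes its type. -/
noncomputable def Hder (k : ℕ) : ℝ := (iteratedDeriv k H 1).re

noncomputable def D1 : ℝ := C1 * Hder 0

noncomputable def D2 : ℝ := C2 * Hder 0 + 3 * C1 * Hder 1

noncomputable def D3 : ℝ := C3 * Hder 0 + 2 * C2 * Hder 1 + 3 * C1 * Hder 2

noncomputable def D4 : ℝ := C4 * Hder 0 + C3 * Hder 1 + C2 * Hder 2 + C1 * Hder 3

/-- `∑_{n ≤ x} d(n)²`, where `d(n)` is the number of positive divisors of `n`. -/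
noncomputable def sumSqDivisors (x : ℝ) : ℝ :=
  ∑ n ∈ Finset.Icc 1 ⌊x⌋₊, ((n.divisors.card : ℝ)) ^ 2

end DivisorSquare

/-! Write `S(x)` for the sum of `d(n)²` up to `x`. The Dirichlet series of `d²` is `ζ(s)⁴/ζ(2s)`, so
convolving `d²` with the indicator of the squares gives `d * d` (`squareInd_mul_sigma_sq`).
Summation and Möbius inversion turn this into `S(x) = ∑ μ(l) T4(x/l²)`
(`sumSqDivisors_eq_sum_moebius`), and the problem splits into an explicit estimate for `T4` and a
sum over `l`.

For `T4`, the hyperbola method is applied to `d * d`, with Dirichlet's divisor theorem in the form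
`|Δ(t)| ≤ √t + 1/4` (`abs_Δ_le`) for the inner sums. There remains a weighted sum of `d(n)(B - log
n)/n`. Partial summation controls how its remainder varies up to infinity, where the remainder tends
to `0`; this limit is what brings in the Stieltjes constants (`tendsto_weightedErr`,
`abs_weightedErr_le`). The result is `abs_T4_sub_le`: `T4(x) = x P4(log x)` with an error of about
`4 x^(3/4) log x`.

In the sum over `l`, the main terms are completed to an infinite series. Since `∑ μ(l) (-2 log l)^k
/ l²` is the `k`-th derivative of `H` at `1`, the series sums exactly to the main term with
coefficients `D1`, ..., `D4` (`hasSum_main_term`). The errors cost a factor `∑ |μ(l)| l^(-3/2) ≤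
2.383`, and `4 * 2.383 = 9.532` is below `9.73`; for `x ≥ 1600` the lower-order terms are absorbed
as well (`large_bound_le`). For `x < 1600` everything is checked in integer arithmetic by the kernel
(`bounds_of_lt`). The bound obtained does not need the term `0.73 x^(1/2)`.

The numerical values come from Euler-Maclaurin summation at `N = 21`, applied to `γ`, `γ₁`, `γ₂` and
the derivatives of `ζ` at `2`. The derivatives of `H` follow by differentiating `ζ(s) · (1/ζ(s)) =
1`. -/

namespace DivisorSquare

/-! ### Dirichlet's hyperbola method -/

section Hyperbola

theorem sum_divisorsAntidiagonal_eq (F : ℕ → ℕ → ℝ) (N : ℕ) :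
    ∑ n ∈ Finset.Icc 1 N, ∑ p ∈ n.divisorsAntidiagonal, F p.1 p.2 =
      ∑ a ∈ Finset.Icc 1 N, ∑ b ∈ Finset.Icc 1 (N / a), F a b := by
  rw [Finset.sum_sigma', Finset.sum_sigma']
  refine Finset.sum_bij' (fun x _ => ⟨x.2.1, x.2.2⟩) (fun y _ => ⟨y.1 * y.2, (y.1, y.2)⟩)
    ?_ ?_ ?_ ?_ ?_
  · rintro ⟨n, a, b⟩ h
    simp only [Finset.mem_sigma, Finset.mem_Icc, Nat.mem_divisorsAntidiagonal] at h ⊢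
    obtain ⟨⟨h1, h2⟩, rfl, h4⟩ := h
    have ha : 0 < a := Nat.pos_of_ne_zero (by rintro rfl; simp at h4)
    have hb : 0 < b := Nat.pos_of_ne_zero (by rintro rfl; simp at h4)
    refine ⟨⟨ha, ?_⟩, hb, ?_⟩
    · nlinarith
    · rw [Nat.le_div_iff_mul_le ha]; linarith
  · rintro ⟨a, b⟩ h
    simp only [Finset.mem_sigma, Finset.mem_Icc, Nat.mem_divisorsAntidiagonal] at h ⊢
    obtain ⟨⟨h1, h2⟩, h3, h4⟩ := h
    rw [Nat.le_div_iff_mul_le h1] at h4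
    exact ⟨⟨Nat.mul_pos h1 h3, by linarith⟩, by simp, (Nat.mul_pos h1 h3).ne'⟩
  · rintro ⟨n, a, b⟩ h
    simp only [Finset.mem_sigma, Nat.mem_divisorsAntidiagonal] at h
    obtain ⟨_, rfl, _⟩ := h
    rfl
  · rintro ⟨a, b⟩ _; rfl
  · rintro ⟨n, a, b⟩ _; rfl

/-- Dirichlet's hyperbola method. -/
theorem hyperbola_nat (f g : ℕ → ℝ) (N : ℕ) :
    ∑ a ∈ Finset.Icc 1 N, f a * ∑ b ∈ Finset.Icc 1 (N / a), g b =
      (∑ a ∈ Finset.Icc 1 (Nat.sqrt N), f a * ∑ b ∈ Finset.Icc 1 (N / a), g b)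
      + (∑ b ∈ Finset.Icc 1 (Nat.sqrt N), g b * ∑ a ∈ Finset.Icc 1 (N / b), f a)
      - (∑ a ∈ Finset.Icc 1 (Nat.sqrt N), f a) * ∑ b ∈ Finset.Icc 1 (Nat.sqrt N), g b := by
  set s := Nat.sqrt N with hs
  have hsN : s ≤ N := Nat.sqrt_le_self N
  have key : ∀ (f g : ℕ → ℝ), ∀ a ∈ Finset.Icc 1 N, f a * ∑ b ∈ Finset.Icc 1 (N / a), g b =
      ∑ b ∈ Finset.Icc 1 N, if a * b ≤ N then f a * g b else 0 := by
    intro f g a ha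
    rw [Finset.mem_Icc] at ha
    rw [Finset.mul_sum, ← Finset.sum_filter]
    refine Finset.sum_congr ?_ fun _ _ => rfl
    ext b
    simp only [Finset.mem_Icc, Finset.mem_filter, Nat.le_div_iff_mul_le ha.1]
    constructor
    · rintro ⟨h1, h2⟩
      exact ⟨⟨h1, by nlinarith⟩, by linarith⟩
    · rintro ⟨⟨h1, h2⟩, h3⟩
      exact ⟨h1, by linarith⟩
  have sub : ∀ h : ℕ → ℝ, ∑ a ∈ Finset.Icc 1 s, h a =
      ∑ a ∈ Finset.Icc 1 N, if a ≤ s then h a else 0 := by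
    intro h
    rw [← Finset.sum_filter]
    refine Finset.sum_congr ?_ fun _ _ => rfl
    ext a
    simp only [Finset.mem_Icc, Finset.mem_filter]
    omega
  rw [sub, sub, sub, sub, Finset.sum_mul_sum, Finset.sum_congr rfl (key f g)]
  have e2 : ∑ b ∈ Finset.Icc 1 N, (if b ≤ s then g b * ∑ a ∈ Finset.Icc 1 (N / b), f a else 0) =
      ∑ a ∈ Finset.Icc 1 N, ∑ b ∈ Finset.Icc 1 N,
        if b ≤ s then (if a * b ≤ N then f a * g b else 0) else 0 := by
    rw [Finset.sum_comm]
    refine Finset.sum_congr rfl fun b hb => ?_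
    rw [key g f b hb]
    split_ifs with h
    · refine Finset.sum_congr rfl fun a _ => ?_
      rw [mul_comm b a, mul_comm (g b)]
    · simp
  have e1 : ∑ a ∈ Finset.Icc 1 N, (if a ≤ s then f a * ∑ b ∈ Finset.Icc 1 (N / a), g b else 0) =
      ∑ a ∈ Finset.Icc 1 N, ∑ b ∈ Finset.Icc 1 N,
        if a ≤ s then (if a * b ≤ N then f a * g b else 0) else 0 := by
    refine Finset.sum_congr rfl fun a ha => ?_
    rw [key f g a ha]
    split_ifs with h
    · rfl
    · simp
  rw [e1, e2, ← Finset.sum_add_distrib, ← Finset.sum_sub_distrib]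
  refine Finset.sum_congr rfl fun a _ => ?_
  rw [← Finset.sum_add_distrib, ← Finset.sum_sub_distrib]
  refine Finset.sum_congr rfl fun b _ => ?_
  -- The identity is inclusion-exclusion, checked for each pair `(a, b)`: the product of two numbers
  -- `≤ ⌊√N⌋` is at most `N`, and that of two numbers `> ⌊√N⌋` exceeds `N`.
  by_cases h1 : a ≤ s <;> by_cases h2 : b ≤ s
  · have : a * b ≤ N := (Nat.mul_le_mul h1 h2).trans (Nat.sqrt_le N)
    simp [h1, h2, this]
  · simp [h1, h2]
  · simp [h1, h2]
  · have : ¬ a * b ≤ N := by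
      have h3 := Nat.lt_succ_sqrt N
      have h4 : (s + 1) * (s + 1) ≤ a * b := Nat.mul_le_mul (by omega) (by omega)
      rw [← hs, Nat.succ_eq_add_one] at h3
      linarith
    simp [h1, h2, this]

theorem floor_sqrt_eq (x : ℝ) : ⌊√x⌋₊ = Nat.sqrt ⌊x⌋₊ := by
  rcases lt_or_ge x 0 with hx | hx
  · rw [Real.sqrt_eq_zero_of_nonpos hx.le, Nat.floor_of_nonpos hx.le]; simp
  refine (Nat.floor_eq_iff (Real.sqrt_nonneg x)).2 ⟨?_, ?_⟩
  · refine Real.le_sqrt_of_sq_le ?_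
    calc ((Nat.sqrt ⌊x⌋₊ : ℕ) : ℝ) ^ 2 ≤ (⌊x⌋₊ : ℝ) := by exact_mod_cast Nat.sqrt_le' _
      _ ≤ x := Nat.floor_le hx
  · rw [Real.sqrt_lt' (by positivity)]
    have h := Nat.lt_succ_sqrt' ⌊x⌋₊
    have := (Nat.floor_lt hx).1 h
    push_cast at this
    exact this

/-- Dirichlet's hyperbola method over real bounds. -/
theorem hyperbola (f g : ℕ → ℝ) (x : ℝ) :
    ∑ a ∈ Finset.Icc 1 ⌊x⌋₊, f a * ∑ b ∈ Finset.Icc 1 ⌊x / a⌋₊, g b =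
      (∑ a ∈ Finset.Icc 1 ⌊√x⌋₊, f a * ∑ b ∈ Finset.Icc 1 ⌊x / a⌋₊, g b)
      + (∑ b ∈ Finset.Icc 1 ⌊√x⌋₊, g b * ∑ a ∈ Finset.Icc 1 ⌊x / b⌋₊, f a)
      - (∑ a ∈ Finset.Icc 1 ⌊√x⌋₊, f a) * ∑ b ∈ Finset.Icc 1 ⌊√x⌋₊, g b := by
  simp_rw [Nat.floor_div_natCast, floor_sqrt_eq]
  exact hyperbola_nat f g _

theorem sum_conv_eq (f g : ℕ → ℝ) (x : ℝ) :
    ∑ n ∈ Finset.Icc 1 ⌊x⌋₊, ∑ p ∈ n.divisorsAntidiagonal, f p.1 * g p.2 =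
      ∑ a ∈ Finset.Icc 1 ⌊x⌋₊, f a * ∑ b ∈ Finset.Icc 1 ⌊x / a⌋₊, g b := by
  simp_rw [Nat.floor_div_natCast, Finset.mul_sum]
  exact sum_divisorsAntidiagonal_eq (fun a b => f a * g b) _

end Hyperbola

/-! ### An explicit Dirichlet divisor theorem -/

section DivisorSum

/-- `∑_{n ≤ t} d(n)`. -/
noncomputable def T2 (t : ℝ) : ℝ := ∑ n ∈ Finset.Icc 1 ⌊t⌋₊, (n.divisors.card : ℝ)

/-- The constant `2γ - 1` of Dirichlet's divisor theorem. -/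
noncomputable def kap : ℝ := 2 * Real.eulerMascheroniConstant - 1

/-- The main term of `∑_{n ≤ t} d(n)`. -/
noncomputable def M2 (t : ℝ) : ℝ := t * (Real.log t + kap)

/-- The remainder in Dirichlet's divisor theorem. -/
noncomputable def Δ (t : ℝ) : ℝ := T2 t - M2 t

theorem T2_eq_conv (x : ℝ) :
    T2 x = 2 * ∑ a ∈ Finset.Icc 1 ⌊√x⌋₊, (⌊x / a⌋₊ : ℝ) - (⌊√x⌋₊ : ℝ) ^ 2 := by
  have h := sum_conv_eq (fun _ => 1) (fun _ => 1) x
  rw [hyperbola] at h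
  have : T2 x = ∑ n ∈ Finset.Icc 1 ⌊x⌋₊, ∑ p ∈ n.divisorsAntidiagonal, (1 : ℝ) * 1 := by
    refine Finset.sum_congr rfl fun n _ => ?_
    simp [← Nat.map_div_right_divisors]
  rw [this, h]
  simp
  ring

theorem log_le_half_sub_inv {z : ℝ} (hz : 1 ≤ z) : Real.log z ≤ (z - z⁻¹) / 2 := by
  have h := Real.self_le_sinh_iff.2 (Real.log_nonneg hz)
  rwa [Real.sinh_log (by linarith)] at h

/-- Trapezoid rule for the convex function `1/t`. Together with the midpoint bound `le_log_sub_log`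
it yields the harmonic sums, the table of logarithms and the logarithms of the finite check. -/
theorem log_sub_log_le {a b : ℝ} (ha : 0 < a) (hab : a ≤ b) :
    Real.log b - Real.log a ≤ (b - a) / 2 * (1 / a + 1 / b) := by
  have hb : 0 < b := ha.trans_le hab
  rw [← Real.log_div hb.ne' ha.ne']
  refine (log_le_half_sub_inv ((one_le_div ha).2 hab)).trans_eq ?_
  field_simp
  ring

theorem le_log_sub_log {a b : ℝ} (ha : 0 < a) (hab : a ≤ b) :
    2 * (b - a) / (a + b) ≤ Real.log b - Real.log a := by
  have hb : 0 < b := ha.trans_le hab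
  rw [← Real.log_div hb.ne' ha.ne']
  have h := Real.le_log_one_add_of_nonneg (x := (b - a) / a) (div_nonneg (by linarith) ha.le)
  have e : 1 + (b - a) / a = b / a := by field_simp; ring
  rw [e] at h
  refine le_trans (le_of_eq ?_) h
  have h2 : (b - a) / a + 2 = (a + b) / a := by field_simp; ring
  have : (0:ℝ) < a + b := by positivity
  rw [h2, mul_div_assoc', div_div_div_cancel_right₀ ha.ne']

/-- Partial sums of the harmonic series. -/
noncomputable def harm (N : ℕ) : ℝ := ∑ k ∈ Finset.Icc 1 N, 1 / (k : ℝ)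

theorem harm_eq (N : ℕ) : harm N = ((harmonic N : ℚ) : ℝ) := by
  rw [harmonic_eq_sum_Icc, harm]
  push_cast
  simp

theorem harm_succ (N : ℕ) : harm (N + 1) = harm N + 1 / ((N : ℝ) + 1) := by
  rw [harm, Finset.sum_Icc_succ_top (by omega), ← harm]
  push_cast
  rfl

theorem tendsto_one_div_nat_succ : Tendsto (fun n : ℕ => 1 / ((n : ℝ) + 1)) atTop (nhds 0) :=
  tendsto_one_div_add_atTop_nhds_zero_nat

theorem tendsto_harm_sub : Tendsto (fun n : ℕ => harm (n + 1) - Real.log ((n : ℝ) + 1)) atTop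
    (nhds Real.eulerMascheroniConstant) := by
  have h := (tendsto_add_atTop_iff_nat 1).2 Real.tendsto_harmonic_sub_log
  refine h.congr fun n => ?_
  rw [harm_eq]
  push_cast
  rfl

theorem harm_le {N : ℕ} (hN : 1 ≤ N) :
    harm N ≤ Real.log N + Real.eulerMascheroniConstant + 1 / (2 * N) := by
  -- By the trapezoid bound this sequence increases; its limit is `γ`. The lower bound on `harm` is
  -- dual: the midpoint bound makes the sequence with `1/(8n²)` added decrease to `γ`.
  have hm : Monotone fun n : ℕ =>
      harm (n + 1) - Real.log ((n : ℝ) + 1) - 1 / 2 * (1 / ((n : ℝ) + 1)) := by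
    refine monotone_nat_of_le_succ fun n => ?_
    have h := log_sub_log_le (a := (n : ℝ) + 1) (b := (n : ℝ) + 1 + 1) (by positivity) (by linarith)
    rw [harm_succ (n + 1)]
    push_cast
    nlinarith
  have ht := tendsto_harm_sub.sub (tendsto_one_div_nat_succ.const_mul (1 / 2))
  have := hm.ge_of_tendsto ht (N - 1)
  simp only [Nat.sub_add_cancel hN, Nat.cast_sub hN] at this
  push_cast at this
  rw [sub_add_cancel] at this
  have e : 1 / (2 * (N : ℝ)) = 1 / 2 * (1 / N) := by ring
  rw [e]; linarith

theorem le_harm {N : ℕ} (hN : 1 ≤ N) :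
    Real.log N + Real.eulerMascheroniConstant + 1 / (2 * N) - 1 / (8 * N ^ 2) ≤ harm N := by
  have hm : Antitone fun n : ℕ =>
      harm (n + 1) - Real.log ((n : ℝ) + 1) - 1 / 2 * (1 / ((n : ℝ) + 1))
        + 1 / 8 * (1 / ((n : ℝ) + 1)) * (1 / ((n : ℝ) + 1)) := by
    refine antitone_nat_of_succ_le fun n => ?_
    have h := le_log_sub_log (a := (n : ℝ) + 1) (b := (n : ℝ) + 1 + 1) (by positivity) (by linarith)
    rw [harm_succ (n + 1)]
    push_cast
    have hn : (0:ℝ) ≤ n := n.cast_nonneg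
    have key : 1 / 2 * (1 / ((n : ℝ) + 1 + 1)) + 1 / 2 * (1 / ((n : ℝ) + 1))
        + 1 / 8 * (1 / ((n : ℝ) + 1 + 1)) * (1 / ((n : ℝ) + 1 + 1))
        - 1 / 8 * (1 / ((n : ℝ) + 1)) * (1 / ((n : ℝ) + 1))
        ≤ 2 * ((n : ℝ) + 1 + 1 - (n + 1)) / (n + 1 + (n + 1 + 1)) := by
      rw [← sub_nonneg]
      have : 2 * ((n : ℝ) + 1 + 1 - (n + 1)) / (n + 1 + (n + 1 + 1)) -
        (1 / 2 * (1 / ((n : ℝ) + 1 + 1)) + 1 / 2 * (1 / ((n : ℝ) + 1))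
        + 1 / 8 * (1 / ((n : ℝ) + 1 + 1)) * (1 / ((n : ℝ) + 1 + 1))
        - 1 / 8 * (1 / ((n : ℝ) + 1)) * (1 / ((n : ℝ) + 1))) =
          1 / (8 * (n + 1 + (n + 1 + 1)) * (n + 1) ^ 2 * (n + 1 + 1) ^ 2) := by
        field_simp
        ring
      rw [this]
      positivity
    linarith
  have ht := (tendsto_harm_sub.sub (tendsto_one_div_nat_succ.const_mul (1 / 2))).add
    ((tendsto_one_div_nat_succ.const_mul (1 / 8)).mul tendsto_one_div_nat_succ)
  have := hm.le_of_tendsto ht (N - 1)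
  simp only [Nat.sub_add_cancel hN, Nat.cast_sub hN] at this
  push_cast at this
  rw [sub_add_cancel] at this
  have e : 1 / (2 * (N : ℝ)) = 1 / 2 * (1 / N) := by ring
  have e2 : 1 / (8 * (N : ℝ) ^ 2) = 1 / 8 * (1 / N) * (1 / N) := by ring
  rw [e, e2]; linarith

theorem sum_div_eq (x : ℝ) (N : ℕ) : ∑ a ∈ Finset.Icc 1 N, x / (a : ℝ) = x * harm N := by
  rw [harm, Finset.mul_sum]
  exact Finset.sum_congr rfl fun a _ => by ring

/-- The expression is what remains of `Δ(t)`, for `√t = N + f` with `N = ⌊√t⌋`, after the bounds for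
`harm N` and `log √t - log N` are inserted. The term `-2N` is the largest possible loss from the
floors. -/
theorem remainder_lower_aux {N f : ℝ} (hN : 1 ≤ N) (hf : 0 ≤ f) (hf1 : f ≤ 1) :
    -(N + f + 1 / 4) ≤ 2 * (N + f) ^ 2 * (-(f / 2 * (1 / N + 1 / (N + f))) + 1 / (2 * N)
      - 1 / (8 * N ^ 2)) - 2 * N - N ^ 2 + (N + f) ^ 2 := by
  have e : 2 * (N + f) ^ 2 * (-(f / 2 * (1 / N + 1 / (N + f))) + 1 / (2 * N)
      - 1 / (8 * N ^ 2)) - 2 * N - N ^ 2 + (N + f) ^ 2 =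
      -(N + f + 1 / 4) + (3 * f - 2 * f ^ 2 + f * (1 - f) * (f / N) - (f / N) / 2
        - (f / N) ^ 2 / 4) := by
    have : N + f ≠ 0 := by positivity
    field_simp
    ring
  have h1 : f / N ≤ f := div_le_self hf hN
  have h2 : 0 ≤ f / N := by positivity
  have h3 : 0 ≤ f * (1 - f) * (f / N) := mul_nonneg (mul_nonneg hf (by linarith)) h2
  rw [e]
  nlinarith

theorem remainder_upper_aux {N f : ℝ} (hN : 1 ≤ N) (hf : 0 ≤ f) :
    2 * (N + f) ^ 2 * (1 / (2 * N) - 2 * f / (N + (N + f))) - N ^ 2 + (N + f) ^ 2 ≤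
      N + f + 1 / 4 := by
  have e : 2 * (N + f) ^ 2 * (1 / (2 * N) - 2 * f / (N + (N + f))) - N ^ 2 + (N + f) ^ 2 =
      N + 2 * f + f * (f / N) - 2 * f ^ 2 - f ^ 3 / (N + (N + f)) := by
    have : N + (N + f) ≠ 0 := by positivity
    field_simp
    ring
  have h1 : f / N ≤ f := div_le_self hf hN
  have h3 : 0 ≤ f ^ 3 / (N + (N + f)) := by positivity
  rw [e]
  -- Since `f/N ≤ f`, the left side is at most `N + 2f - f²`; the `1/4` is the maximum of `f(1 -
  -- f)`.
  nlinarith [sq_nonneg (f - 1 / 2)]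

/-- Without the floors, `2 ∑ t/a - N²` exceeds the main term by about `√t`. The floors take away
between `0` and `2√t`, so the remainder lies in an interval essentially symmetric about `0`. -/
theorem abs_Δ_le {t : ℝ} (ht : 1 ≤ t) : |Δ t| ≤ √t + 1 / 4 := by
  set u := √t with hu
  have ht' : t = u ^ 2 := (Real.sq_sqrt (by linarith)).symm
  have hu1 : 1 ≤ u := Real.one_le_sqrt.2 ht
  set N := ⌊u⌋₊ with hN
  have hN1 : 1 ≤ N := Nat.one_le_floor_iff _ |>.2 hu1
  have hNr : (1:ℝ) ≤ N := by exact_mod_cast hN1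
  have hNu : (N : ℝ) ≤ u := Nat.floor_le (by linarith)
  have huN : u < N + 1 := Nat.lt_floor_add_one u
  have hT := T2_eq_conv t
  rw [← hu, ← hN] at hT
  have hs1 : ∑ a ∈ Finset.Icc 1 N, (⌊t / a⌋₊ : ℝ) ≤ t * harm N := by
    rw [← sum_div_eq]
    exact Finset.sum_le_sum fun a _ => Nat.floor_le (by positivity)
  have hs2 : t * harm N - N ≤ ∑ a ∈ Finset.Icc 1 N, (⌊t / a⌋₊ : ℝ) := by
    rw [← sum_div_eq]
    have : (N : ℝ) = ∑ a ∈ Finset.Icc 1 N, (1:ℝ) := by simp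
    rw [this, ← Finset.sum_sub_distrib]
    exact Finset.sum_le_sum fun a _ => by linarith [Nat.lt_floor_add_one (t / a)]
  have hlog : Real.log t = 2 * Real.log u := by rw [ht', Real.log_pow]; norm_num
  have hΔ : Δ t = T2 t - t * (2 * Real.log u + (2 * Real.eulerMascheroniConstant - 1)) := by
    rw [Δ, M2, kap, hlog]
  have h1 := log_sub_log_le (a := (N : ℝ)) (b := u) (by linarith) hNu
  have h2 := le_log_sub_log (a := (N : ℝ)) (b := u) (by linarith) hNu
  have h3 := harm_le hN1
  have h4 := le_harm hN1
  have hu0 : 0 < u := by linarith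
  have hN0 : (0:ℝ) < N := by linarith
  set f := u - N with hf
  have hfu : u = N + f := by rw [hf]; ring
  have hf0 : 0 ≤ f := by linarith
  have hf1 : f ≤ 1 := by linarith
  have hlow := remainder_lower_aux hNr hf0 hf1
  have hup := remainder_upper_aux hNr hf0
  rw [← hfu] at hlow hup
  rw [hΔ, hT, abs_le]
  rw [ht'] at hs1 hs2 ⊢
  have hu2 : 0 ≤ 2 * u ^ 2 := by positivity
  constructor
  · have h5 := mul_le_mul_of_nonneg_left h4 hu2
    have h6 := mul_le_mul_of_nonneg_left h1 hu2
    linarith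
  · have h5 := mul_le_mul_of_nonneg_left h3 hu2
    have h6 := mul_le_mul_of_nonneg_left h2 hu2
    linarith

end DivisorSum

/-! ### Euler-Maclaurin summation with explicit remainder -/

section EulerMaclaurin

/-- One step of Euler-Maclaurin summation, with a remainder controlled by a signed third
derivative. -/
theorem euler_maclaurin_step {F f f1 f2 f3 : ℝ → ℝ} {a : ℝ}
    (hF : ∀ t ∈ Set.Icc a (a + 1), HasDerivAt F (f t) t)
    (hf : ∀ t ∈ Set.Icc a (a + 1), HasDerivAt f (f1 t) t)
    (hf1 : ∀ t ∈ Set.Icc a (a + 1), HasDerivAt f1 (f2 t) t)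
    (hf2 : ∀ t ∈ Set.Icc a (a + 1), HasDerivAt f2 (f3 t) t)
    (h3 : ∀ t ∈ Set.Icc a (a + 1), f3 t ≤ 0) :
    |F (a + 1) - F a - (f a + f (a + 1)) / 2 + (f1 (a + 1) - f1 a) / 12| ≤
      (f2 a - f2 (a + 1)) / 120 := by
  -- Repeated integration by parts with the Bernoulli polynomials `B₁, B₂, B₃` at `t - a`:
  -- everything cancels in `G'` except `-B₃ f3 / 6`. As `B₃` vanishes at `0` and `1`, `f2` does not
  -- enter the endpoint values of `G`.
  set G : ℝ → ℝ := fun t => F t - (t - a - 1 / 2) * f t + ((t - a) ^ 2 - (t - a) + 1 / 6) / 2 * f1 t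
    - ((t - a) * (t - a - 1 / 2) * (t - a - 1)) / 6 * f2 t with hG
  have hGd : ∀ t ∈ Set.Icc a (a + 1),
      HasDerivAt G (-(((t - a) * (t - a - 1 / 2) * (t - a - 1)) / 6 * f3 t)) t := by
    intro t ht
    have h0 : HasDerivAt (fun t : ℝ => t - a) 1 t := (hasDerivAt_id t).sub_const a
    have hb1 : HasDerivAt (fun t : ℝ => t - a - 1 / 2) 1 t := h0.sub_const _
    have hb1' : HasDerivAt (fun t : ℝ => t - a - 1) 1 t := h0.sub_const _
    have hb2 := (((h0.pow 2).sub h0).add_const (1 / 6 : ℝ)).div_const 2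
    have hb3 := ((h0.mul hb1).mul hb1').div_const 6
    have := (((hF t ht).sub (hb1.mul (hf t ht))).add (hb2.mul (hf1 t ht))).sub
      (hb3.mul (hf2 t ht))
    refine HasDerivAt.congr_deriv this ?_
    simp
    ring
  -- The true maximum is `√3/216 ≈ 0.00802`, attained at `1/2 ± √3/6`; the hints `1/5` and `4/5`
  -- approximate these points. Since `f3 ≤ 0`, the bound makes `G ± f2/120` monotone.
  have hB : ∀ t ∈ Set.Icc a (a + 1), |(t - a) * (t - a - 1 / 2) * (t - a - 1) / 6| ≤ 1 / 120 := by
    intro t ht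
    obtain ⟨s, hs⟩ : ∃ s, s = t - a := ⟨_, rfl⟩
    have hs0 : 0 ≤ s := by rw [hs]; linarith [ht.1]
    have hs1 : s ≤ 1 := by rw [hs]; linarith [ht.2]
    rw [← hs, abs_le]
    constructor
    · nlinarith [mul_nonneg hs0 (sq_nonneg (s - 4 / 5)), mul_nonneg (sub_nonneg.2 hs1) (sq_nonneg (s - 4 / 5)), mul_nonneg (sub_nonneg.2 hs1) (sq_nonneg s)]
    · nlinarith [mul_nonneg hs0 (sq_nonneg (s - 1 / 5)), mul_nonneg (sub_nonneg.2 hs1) (sq_nonneg (s - 1 / 5)), mul_nonneg (sub_nonneg.2 hs1) (sq_nonneg s)]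
  have ha : a ∈ Set.Icc a (a + 1) := ⟨le_rfl, by linarith⟩
  have hb : a + 1 ∈ Set.Icc a (a + 1) := ⟨by linarith, le_rfl⟩
  have hanti : AntitoneOn (fun t => G t + 1 / 120 * f2 t) (Set.Icc a (a + 1)) := by
    have hd : ∀ t ∈ Set.Icc a (a + 1), HasDerivAt (fun t => G t + 1 / 120 * f2 t) _ t :=
      fun t ht => (hGd t ht).add ((hf2 t ht).const_mul (1 / 120))
    refine antitoneOn_of_hasDerivWithinAt_nonpos (convex_Icc _ _)
      (fun t ht => (hd t ht).continuousAt.continuousWithinAt)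
      (fun t ht => (hd t (interior_subset ht)).hasDerivWithinAt) ?_
    intro t ht
    have := abs_le.1 (hB t (interior_subset ht))
    nlinarith [h3 t (interior_subset ht)]
  have hmono : MonotoneOn (fun t => G t - 1 / 120 * f2 t) (Set.Icc a (a + 1)) := by
    have hd : ∀ t ∈ Set.Icc a (a + 1), HasDerivAt (fun t => G t - 1 / 120 * f2 t) _ t :=
      fun t ht => (hGd t ht).sub ((hf2 t ht).const_mul (1 / 120))
    refine monotoneOn_of_hasDerivWithinAt_nonneg (convex_Icc _ _)
      (fun t ht => (hd t ht).continuousAt.continuousWithinAt)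
      (fun t ht => (hd t (interior_subset ht)).hasDerivWithinAt) ?_
    intro t ht
    have := abs_le.1 (hB t (interior_subset ht))
    nlinarith [h3 t (interior_subset ht)]
  have h1 := hanti ha hb (by linarith)
  have h2 := hmono ha hb (by linarith)
  have hGa : G a = F a + 1 / 2 * f a + 1 / 12 * f1 a := by simp only [hG]; ring_nf
  have hGb : G (a + 1) = F (a + 1) - 1 / 2 * f (a + 1) + 1 / 12 * f1 (a + 1) := by
    simp only [hG]; ring_nf
  simp only [hGa, hGb] at h1 h2
  rw [abs_le]
  constructor <;> linarith

/-- Euler-Maclaurin summation to infinity. -/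
theorem euler_maclaurin_limit {F f f1 f2 f3 : ℝ → ℝ} {N₀ : ℕ}
    (hF : ∀ t : ℝ, N₀ ≤ t → HasDerivAt F (f t) t)
    (hf : ∀ t : ℝ, N₀ ≤ t → HasDerivAt f (f1 t) t)
    (hf1 : ∀ t : ℝ, N₀ ≤ t → HasDerivAt f1 (f2 t) t)
    (hf2 : ∀ t : ℝ, N₀ ≤ t → HasDerivAt f2 (f3 t) t)
    (h3 : ∀ t : ℝ, N₀ ≤ t → f3 t ≤ 0)
    (hlim : Tendsto f2 atTop (nhds 0)) :
    ∃ c : ℝ, ∀ N : ℕ, N₀ ≤ N →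
      |(∑ k ∈ Finset.Icc 1 N, f k) - F N - f N / 2 - f1 N / 12 - c| ≤ f2 N / 120 := by
  set b : ℕ → ℝ := fun N => (∑ k ∈ Finset.Icc 1 N, f k) - F N - f N / 2 - f1 N / 12 with hb
  have hstep : ∀ N : ℕ, N₀ ≤ N → |b (N + 1) - b N| ≤ (f2 N - f2 ((N + 1 : ℕ) : ℝ)) / 120 := by
    intro N hN
    have hN' : (N₀ : ℝ) ≤ N := by exact_mod_cast hN
    have h := euler_maclaurin_step (a := N) (fun t ht => hF t (hN'.trans ht.1))
      (fun t ht => hf t (hN'.trans ht.1)) (fun t ht => hf1 t (hN'.trans ht.1))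
      (fun t ht => hf2 t (hN'.trans ht.1)) (fun t ht => h3 t (hN'.trans ht.1))
    rw [← abs_neg] at h
    push_cast
    refine le_trans (le_of_eq ?_) h
    simp only [hb]
    rw [Finset.sum_Icc_succ_top (by omega)]
    push_cast
    ring_nf
  have hlimN : Tendsto (fun n : ℕ => f2 ((n + N₀ : ℕ) : ℝ)) atTop (nhds 0) :=
    hlim.comp (tendsto_natCast_atTop_atTop.comp (tendsto_add_atTop_nat N₀))
  -- The one-step bounds telescope: `b + f2/120` decreases and `b - f2/120` increases. Their common
  -- limit `c` therefore lies within `f2(N)/120` of `b(N)` for every `N ≥ N₀`.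
  have hanti : Antitone fun n : ℕ => b (n + N₀) + f2 ((n + N₀ : ℕ) : ℝ) / 120 := by
    refine antitone_nat_of_succ_le fun n => ?_
    have := abs_le.1 (hstep (n + N₀) (by omega))
    rw [show n + 1 + N₀ = n + N₀ + 1 by ring]
    linarith
  have hmono : Monotone fun n : ℕ => b (n + N₀) - f2 ((n + N₀ : ℕ) : ℝ) / 120 := by
    refine monotone_nat_of_le_succ fun n => ?_
    have := abs_le.1 (hstep (n + N₀) (by omega))
    rw [show n + 1 + N₀ = n + N₀ + 1 by ring]
    linarith
  have hf2anti : Antitone fun n : ℕ => f2 ((n + N₀ : ℕ) : ℝ) := by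
    refine antitone_nat_of_succ_le fun n => ?_
    have := (abs_nonneg _).trans (hstep (n + N₀) (by omega))
    rw [show n + 1 + N₀ = n + N₀ + 1 by ring]
    linarith
  have hf2pos : ∀ n : ℕ, 0 ≤ f2 ((n + N₀ : ℕ) : ℝ) := fun n => hf2anti.le_of_tendsto hlimN n
  have hbdd : BddBelow (Set.range fun n : ℕ => b (n + N₀) + f2 ((n + N₀ : ℕ) : ℝ) / 120) := by
    refine ⟨b (0 + N₀) - f2 ((0 + N₀ : ℕ) : ℝ) / 120, ?_⟩
    rintro _ ⟨n, rfl⟩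
    have := hmono (Nat.zero_le n)
    have := hf2pos n
    simp only at *
    linarith
  have ht := tendsto_atTop_ciInf hanti hbdd
  set c := ⨅ n : ℕ, (b (n + N₀) + f2 ((n + N₀ : ℕ) : ℝ) / 120) with hc
  have ht2 : Tendsto (fun n : ℕ => b (n + N₀) - f2 ((n + N₀ : ℕ) : ℝ) / 120) atTop (nhds c) := by
    have := ht.sub ((hlimN.div_const 120).const_mul 2)
    simp only [zero_div, mul_zero, sub_zero] at this
    refine this.congr fun n => ?_
    ring
  refine ⟨c, fun N hN => ?_⟩
  have h1 := hanti.le_of_tendsto ht (N - N₀)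
  have h2 := hmono.ge_of_tendsto ht2 (N - N₀)
  simp only [Nat.sub_add_cancel hN] at h1 h2
  change |b N - c| ≤ _
  rw [abs_le]
  constructor <;> linarith

/-- `(a₀ + a₁ log t + a₂ log² t + a₃ log³ t) / t ^ p`. -/
noncomputable def logQuot (a₀ a₁ a₂ a₃ : ℝ) (p : ℕ) (t : ℝ) : ℝ :=
  (a₀ + a₁ * Real.log t + a₂ * Real.log t ^ 2 + a₃ * Real.log t ^ 3) / t ^ p

/-- The family `logQuot` is closed under differentiation, so the derivatives needed for
Euler-Maclaurin summation reduce to arithmetic on coefficients. -/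
theorem hasDerivAt_logQuot (a₀ a₁ a₂ a₃ : ℝ) (p : ℕ) {t : ℝ} (ht : 0 < t) :
    HasDerivAt (logQuot a₀ a₁ a₂ a₃ p)
      (logQuot (a₁ - p * a₀) (2 * a₂ - p * a₁) (3 * a₃ - p * a₂) (-(p * a₃)) (p + 1) t) t := by
  have hl := Real.hasDerivAt_log ht.ne'
  have h := ((((hasDerivAt_const t a₀).add (hl.const_mul a₁)).add ((hl.pow 2).const_mul a₂)).add
    ((hl.pow 3).const_mul a₃)).div (hasDerivAt_pow p t) (pow_pos ht p).ne'
  refine HasDerivAt.congr_deriv h ?_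
  rcases p with _ | p
  · simp [logQuot]
    field_simp
  · simp [logQuot]
    field_simp
    ring

theorem tendsto_log_pow_div (j : ℕ) {p : ℕ} (hp : 1 ≤ p) :
    Tendsto (fun t : ℝ => Real.log t ^ j / t ^ p) atTop (nhds 0) := by
  have h := (isLittleO_log_rpow_rpow_atTop (j : ℝ) (s := (p : ℝ))
    (by exact_mod_cast hp)).tendsto_div_nhds_zero
  refine h.congr fun t => ?_
  rw [Real.rpow_natCast, Real.rpow_natCast]

theorem tendsto_logQuot (a₀ a₁ a₂ a₃ : ℝ) {p : ℕ} (hp : 1 ≤ p) :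
    Tendsto (logQuot a₀ a₁ a₂ a₃ p) atTop (nhds 0) := by
  have h := ((((tendsto_log_pow_div 0 hp).const_mul a₀).add
    ((tendsto_log_pow_div 1 hp).const_mul a₁)).add
    ((tendsto_log_pow_div 2 hp).const_mul a₂)).add ((tendsto_log_pow_div 3 hp).const_mul a₃)
  simp only [mul_zero, add_zero] at h
  refine h.congr fun t => ?_
  simp only [logQuot]
  ring

end EulerMaclaurin

/-! ### Logarithms of the integers up to 21 -/

section LogTable

/-- Lower bounds for `10 ^ 7 * log k`. -/
def logLo (k : ℕ) : ℚ :=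
  ([0, 0, 6931469, 10986120, 13862941, 16094377, 17917592, 19459099,
    20794413, 21972243, 23025848, 23978950, 24849064, 25649491, 26390571, 27080500,
    27725885, 28332131, 28903715, 29444387, 29957320, 30445222] : List ℚ).getD k 0 / 10 ^ 7

/-- Upper bounds for `10 ^ 7 * log k`. -/
def logHi (k : ℕ) : ℚ :=
  ([0, 0, 6931474, 10986125, 13862946, 16094382, 17917597, 19459104,
    20794418, 21972248, 23025853, 23978955, 24849069, 25649496, 26390576, 27080505,
    27725890, 28332136, 28903720, 29444392, 29957325, 30445227] : List ℚ).getD k 0 / 10 ^ 7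

theorem log_table {k : ℕ} (hk : k ∈ Finset.Icc 1 21) :
    (logLo k : ℝ) ≤ Real.log k ∧ Real.log k ≤ (logHi k : ℝ) := by
  have l2 := Real.log_two_gt_d9
  have u2 := Real.log_two_lt_d9
  have l3 := Real.log_three_gt_d9
  have u3 := Real.log_three_lt_d9
  have l5 := Real.log_five_gt_d9
  have u5 := Real.log_five_lt_d9
  -- Each new prime is reached through consecutive integers `a, a + 1`, where `a` has only smaller
  -- prime factors and `a + 1` is a power of the new prime: `7⁴ = 2401`, `11² = 121`, `13² = 169`,
  -- `17² = 289`, `19² = 361`.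
  have l7 := le_log_sub_log (a := 2400) (b := 2401) (by norm_num) (by norm_num)
  have u7 := log_sub_log_le (a := 2400) (b := 2401) (by norm_num) (by norm_num)
  have l11 := le_log_sub_log (a := 120) (b := 121) (by norm_num) (by norm_num)
  have u11 := log_sub_log_le (a := 120) (b := 121) (by norm_num) (by norm_num)
  have l13 := le_log_sub_log (a := 168) (b := 169) (by norm_num) (by norm_num)
  have u13 := log_sub_log_le (a := 168) (b := 169) (by norm_num) (by norm_num)
  have l17 := le_log_sub_log (a := 288) (b := 289) (by norm_num) (by norm_num)
  have u17 := log_sub_log_le (a := 288) (b := 289) (by norm_num) (by norm_num)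
  have l19 := le_log_sub_log (a := 360) (b := 361) (by norm_num) (by norm_num)
  have u19 := log_sub_log_le (a := 360) (b := 361) (by norm_num) (by norm_num)
  have e4 : Real.log 4 = 2 * Real.log 2 := by
    rw [show (4 : ℝ) = 2 ^ 2 by norm_num, Real.log_pow]
    norm_num
  have e6 : Real.log 6 = 1 * Real.log 2 + 1 * Real.log 3 := by
    rw [show (6 : ℝ) = 2 ^ 1 * 3 ^ 1 by norm_num, Real.log_mul (by norm_num) (by norm_num),
      Real.log_pow, Real.log_pow]
    norm_num
  have e8 : Real.log 8 = 3 * Real.log 2 := by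
    rw [show (8 : ℝ) = 2 ^ 3 by norm_num, Real.log_pow]
    norm_num
  have e9 : Real.log 9 = 2 * Real.log 3 := by
    rw [show (9 : ℝ) = 3 ^ 2 by norm_num, Real.log_pow]
    norm_num
  have e10 : Real.log 10 = 1 * Real.log 2 + 1 * Real.log 5 := by
    rw [show (10 : ℝ) = 2 ^ 1 * 5 ^ 1 by norm_num, Real.log_mul (by norm_num) (by norm_num),
      Real.log_pow, Real.log_pow]
    norm_num
  have e12 : Real.log 12 = 2 * Real.log 2 + 1 * Real.log 3 := by
    rw [show (12 : ℝ) = 2 ^ 2 * 3 ^ 1 by norm_num, Real.log_mul (by norm_num) (by norm_num),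
      Real.log_pow, Real.log_pow]
    norm_num
  have e14 : Real.log 14 = 1 * Real.log 2 + 1 * Real.log 7 := by
    rw [show (14 : ℝ) = 2 ^ 1 * 7 ^ 1 by norm_num, Real.log_mul (by norm_num) (by norm_num),
      Real.log_pow, Real.log_pow]
    norm_num
  have e15 : Real.log 15 = 1 * Real.log 3 + 1 * Real.log 5 := by
    rw [show (15 : ℝ) = 3 ^ 1 * 5 ^ 1 by norm_num, Real.log_mul (by norm_num) (by norm_num),
      Real.log_pow, Real.log_pow]
    norm_num
  have e16 : Real.log 16 = 4 * Real.log 2 := by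
    rw [show (16 : ℝ) = 2 ^ 4 by norm_num, Real.log_pow]
    norm_num
  have e18 : Real.log 18 = 1 * Real.log 2 + 2 * Real.log 3 := by
    rw [show (18 : ℝ) = 2 ^ 1 * 3 ^ 2 by norm_num, Real.log_mul (by norm_num) (by norm_num),
      Real.log_pow, Real.log_pow]
    norm_num
  have e20 : Real.log 20 = 2 * Real.log 2 + 1 * Real.log 5 := by
    rw [show (20 : ℝ) = 2 ^ 2 * 5 ^ 1 by norm_num, Real.log_mul (by norm_num) (by norm_num),
      Real.log_pow, Real.log_pow]
    norm_num
  have e21 : Real.log 21 = 1 * Real.log 3 + 1 * Real.log 7 := by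
    rw [show (21 : ℝ) = 3 ^ 1 * 7 ^ 1 by norm_num, Real.log_mul (by norm_num) (by norm_num),
      Real.log_pow, Real.log_pow]
    norm_num
  have e2400 : Real.log 2400 = 5 * Real.log 2 + Real.log 3 + 2 * Real.log 5 := by
    rw [show (2400 : ℝ) = 2 ^ 5 * 3 * 5 ^ 2 by norm_num, Real.log_mul (by norm_num) (by norm_num), Real.log_mul (by norm_num) (by norm_num),
      Real.log_pow, Real.log_pow]
    norm_num
  have e2401 : Real.log 2401 = 4 * Real.log 7 := by
    rw [show (2401 : ℝ) = 7 ^ 4 by norm_num, Real.log_pow]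
    norm_num
  have e120 : Real.log 120 = 3 * Real.log 2 + 1 * Real.log 3 + 1 * Real.log 5 := by
    rw [show (120 : ℝ) = 2 ^ 3 * 3 ^ 1 * 5 ^ 1 by norm_num, Real.log_mul (by norm_num) (by norm_num), Real.log_mul (by norm_num) (by norm_num),
      Real.log_pow, Real.log_pow, Real.log_pow]
    norm_num
  have e121 : Real.log 121 = 2 * Real.log 11 := by
    rw [show (121 : ℝ) = 11 ^ 2 by norm_num, Real.log_pow]
    norm_num
  have e168 : Real.log 168 = 3 * Real.log 2 + 1 * Real.log 3 + 1 * Real.log 7 := by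
    rw [show (168 : ℝ) = 2 ^ 3 * 3 ^ 1 * 7 ^ 1 by norm_num, Real.log_mul (by norm_num) (by norm_num), Real.log_mul (by norm_num) (by norm_num),
      Real.log_pow, Real.log_pow, Real.log_pow]
    norm_num
  have e169 : Real.log 169 = 2 * Real.log 13 := by
    rw [show (169 : ℝ) = 13 ^ 2 by norm_num, Real.log_pow]
    norm_num
  have e288 : Real.log 288 = 5 * Real.log 2 + 2 * Real.log 3 := by
    rw [show (288 : ℝ) = 2 ^ 5 * 3 ^ 2 by norm_num, Real.log_mul (by norm_num) (by norm_num),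
      Real.log_pow, Real.log_pow]
    norm_num
  have e289 : Real.log 289 = 2 * Real.log 17 := by
    rw [show (289 : ℝ) = 17 ^ 2 by norm_num, Real.log_pow]
    norm_num
  have e360 : Real.log 360 = 3 * Real.log 2 + 2 * Real.log 3 + 1 * Real.log 5 := by
    rw [show (360 : ℝ) = 2 ^ 3 * 3 ^ 2 * 5 ^ 1 by norm_num, Real.log_mul (by norm_num) (by norm_num), Real.log_mul (by norm_num) (by norm_num),
      Real.log_pow, Real.log_pow, Real.log_pow]
    norm_num
  have e361 : Real.log 361 = 2 * Real.log 19 := by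
    rw [show (361 : ℝ) = 19 ^ 2 by norm_num, Real.log_pow]
    norm_num
  rw [e2400, e2401] at l7 u7
  rw [e120, e121] at l11 u11
  rw [e168, e169] at l13 u13
  rw [e288, e289] at l17 u17
  rw [e360, e361] at l19 u19
  simp only [Finset.mem_Icc] at hk
  obtain ⟨h1, h2⟩ := hk
  norm_num at l7 u7 l11 u11 l13 u13 l17 u17 l19 u19
  interval_cases k <;> simp [logLo, logHi, e4, e6, e8, e9, e10, e12, e14, e15, e16, e18, e20, e21] <;>
    constructor <;> linarith

theorem sum_log_pow_div_le (j p : ℕ) :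
    ∑ k ∈ Finset.Icc (1 : ℕ) 21, Real.log k ^ j / (k : ℝ) ^ p ≤
      ((∑ k ∈ Finset.Icc (1 : ℕ) 21, logHi k ^ j / (k : ℚ) ^ p : ℚ) : ℝ) := by
  push_cast
  refine Finset.sum_le_sum fun k hk => ?_
  have hk0 : 0 ≤ Real.log k := Real.log_natCast_nonneg k
  gcongr
  exact (log_table hk).2

theorem logLo_nonneg {k : ℕ} (hk : k ∈ Finset.Icc 1 21) : 0 ≤ logLo k := by
  revert k
  decide +kernel

theorem le_sum_log_pow_div (j p : ℕ) :
    ((∑ k ∈ Finset.Icc (1 : ℕ) 21, logLo k ^ j / (k : ℚ) ^ p : ℚ) : ℝ) ≤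
      ∑ k ∈ Finset.Icc (1 : ℕ) 21, Real.log k ^ j / (k : ℝ) ^ p := by
  push_cast
  refine Finset.sum_le_sum fun k hk => ?_
  have hk0 : (0 : ℝ) ≤ logLo k := by exact_mod_cast logLo_nonneg hk
  gcongr
  exact (log_table hk).1

end LogTable

/-! ### Euler-Maclaurin for Stieltjes constants and derivatives of `ζ` at 2 -/

section Constants

/-- This fixes the cutoff `21`, the first integer with logarithm at least `3`. With `L = log t`, the
third derivative of `log² t / t` is `-2(3L - 2)(L - 3)/t⁴`, so its sign condition starts exactly at
`L = 3`; the other functions summed below satisfy theirs there too. -/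
theorem three_le_log {t : ℝ} (ht : ((21 : ℕ) : ℝ) ≤ t) : 3 ≤ Real.log t := by
  have h := (log_table (k := 21) (by simp)).1
  have h2 : (3 : ℝ) ≤ (logLo 21 : ℝ) := by
    have : (3 : ℚ) ≤ logLo 21 := by decide +kernel
    exact_mod_cast this
  have := Real.log_le_log (by norm_num) ht
  linarith

theorem euler_maclaurin_logQuot {F : ℝ → ℝ} {a₀ a₁ a₂ a₃ : ℝ} {p : ℕ} {b₀ b₁ b₂ b₃ c₀ c₁ c₂ c₃ : ℝ}
    (hF : ∀ t : ℝ, 0 < t → HasDerivAt F (logQuot a₀ a₁ a₂ a₃ p t) t)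
    (hb : b₀ = a₁ - p * a₀ ∧ b₁ = 2 * a₂ - p * a₁ ∧ b₂ = 3 * a₃ - p * a₂ ∧ b₃ = -(p * a₃))
    (hc : c₀ = b₁ - (p + 1) * b₀ ∧ c₁ = 2 * b₂ - (p + 1) * b₁ ∧ c₂ = 3 * b₃ - (p + 1) * b₂ ∧
      c₃ = -((p + 1) * b₃))
    (hs : ∀ L : ℝ, 3 ≤ L → (c₁ - (p + 2) * c₀) + (2 * c₂ - (p + 2) * c₁) * L
      + (3 * c₃ - (p + 2) * c₂) * L ^ 2 + -((p + 2) * c₃) * L ^ 3 ≤ 0) :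
    ∃ c : ℝ, ∀ N : ℕ, 21 ≤ N →
      |(∑ k ∈ Finset.Icc 1 N, logQuot a₀ a₁ a₂ a₃ p k) - F N - logQuot a₀ a₁ a₂ a₃ p N / 2
        - logQuot b₀ b₁ b₂ b₃ (p + 1) N / 12 - c| ≤ logQuot c₀ c₁ c₂ c₃ (p + 2) N / 120 := by
  obtain ⟨rfl, rfl, rfl, rfl⟩ := hb
  obtain ⟨rfl, rfl, rfl, rfl⟩ := hc
  have pos : ∀ t : ℝ, ((21 : ℕ) : ℝ) ≤ t → 0 < t := fun t ht => by
    push_cast at ht; linarith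
  refine euler_maclaurin_limit (fun t ht => hF t (pos t ht))
    (fun t ht => hasDerivAt_logQuot _ _ _ _ _ (pos t ht))
    (fun t ht => ?_) (fun t ht => hasDerivAt_logQuot _ _ _ _ _ (pos t ht)) ?_
    (tendsto_logQuot _ _ _ _ (by omega))
  · have := hasDerivAt_logQuot (a₁ - p * a₀) (2 * a₂ - p * a₁) (3 * a₃ - p * a₂) (-(p * a₃)) (p + 1)
      (pos t ht)
    push_cast at this
    exact this
  · intro t ht
    have := hs (Real.log t) (three_le_log ht)
    have hp := pos t ht
    refine div_nonpos_of_nonpos_of_nonneg ?_ (by positivity)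
    push_cast
    exact this

theorem tendsto_of_abs_sub_le {u e : ℕ → ℝ} {c : ℝ} {N₀ : ℕ} (h : ∀ N, N₀ ≤ N → |u N - c| ≤ e N)
    (he : Tendsto e atTop (nhds 0)) : Tendsto u atTop (nhds c) := by
  rw [tendsto_iff_dist_tendsto_zero]
  refine squeeze_zero' (Eventually.of_forall fun _ => dist_nonneg) ?_ he
  filter_upwards [eventually_ge_atTop N₀] with N hN
  rw [Real.dist_eq]
  exact h N hN

theorem tendsto_sum_of_euler_maclaurin {F : ℝ → ℝ} {a₀ a₁ a₂ a₃ : ℝ} {p : ℕ} (hp : 1 ≤ p)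
    {b₀ b₁ b₂ b₃ c₀ c₁ c₂ c₃ c : ℝ} (h : ∀ N : ℕ, 21 ≤ N →
      |(∑ k ∈ Finset.Icc 1 N, logQuot a₀ a₁ a₂ a₃ p k) - F N - logQuot a₀ a₁ a₂ a₃ p N / 2
        - logQuot b₀ b₁ b₂ b₃ (p + 1) N / 12 - c| ≤ logQuot c₀ c₁ c₂ c₃ (p + 2) N / 120) :
    Tendsto (fun N : ℕ => (∑ k ∈ Finset.Icc 1 N, logQuot a₀ a₁ a₂ a₃ p k) - F N) atTop (nhds c) := by
  have t0 := ((tendsto_logQuot a₀ a₁ a₂ a₃ hp).comp tendsto_natCast_atTop_atTop).div_const 2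
  have t1 := ((tendsto_logQuot b₀ b₁ b₂ b₃ (p := p + 1) (by omega)).comp
    tendsto_natCast_atTop_atTop).div_const 12
  have t2 := ((tendsto_logQuot c₀ c₁ c₂ c₃ (p := p + 2) (by omega)).comp
    tendsto_natCast_atTop_atTop).div_const 120
  rw [zero_div] at t2
  have := ((tendsto_of_abs_sub_le h t2).add t0).add t1
  simp only [zero_div, add_zero] at this
  refine this.congr fun N => ?_
  simp only [Function.comp]
  ring

theorem stieltjes_zero_euler_maclaurin (N : ℕ) (hN : 21 ≤ N) :
    |(∑ k ∈ Finset.Icc 1 N, logQuot 1 0 0 0 1 k) - logQuot 0 1 0 0 0 N - logQuot 1 0 0 0 1 N / 2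
        - logQuot (-1) 0 0 0 2 N / 12 - Real.eulerMascheroniConstant| ≤
      logQuot 2 0 0 0 3 N / 120 := by
  obtain ⟨c, hc⟩ := euler_maclaurin_logQuot (F := logQuot 0 1 0 0 0) (a₀ := 1) (a₁ := 0) (a₂ := 0)
    (a₃ := 0) (p := 1) (b₀ := -1) (b₁ := 0) (b₂ := 0) (b₃ := 0) (c₀ := 2) (c₁ := 0) (c₂ := 0)
    (c₃ := 0) (fun t ht => by simpa using hasDerivAt_logQuot 0 1 0 0 0 ht) (by norm_num)
    (by norm_num) (fun L hL => by norm_num)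
  have h := tendsto_sum_of_euler_maclaurin (F := logQuot 0 1 0 0 0) le_rfl hc
  have h2 : Tendsto (fun N : ℕ => (∑ k ∈ Finset.Icc 1 N, logQuot 1 0 0 0 1 (k : ℝ)) -
      logQuot 0 1 0 0 0 N) atTop (nhds Real.eulerMascheroniConstant) := by
    refine Real.tendsto_harmonic_sub_log.congr fun n => ?_
    rw [← harm_eq, harm]
    simp [logQuot]
  rw [tendsto_nhds_unique h2 h]
  exact hc N hN

theorem stieltjes_eq_of_tendsto {n : ℕ} {c : ℝ} (h : Tendsto (fun N : ℕ =>
    (∑ k ∈ Finset.Icc 1 N, (Real.log (k : ℝ)) ^ n / (k : ℝ)) -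
      (Real.log (N : ℝ)) ^ (n + 1) / ((n : ℝ) + 1)) atTop (nhds c)) : stieltjes n = c :=
  h.limUnder_eq

theorem stieltjes_one_euler_maclaurin (N : ℕ) (hN : 21 ≤ N) :
    |(∑ k ∈ Finset.Icc 1 N, logQuot 0 1 0 0 1 k) - logQuot 0 0 (1 / 2) 0 0 N
        - logQuot 0 1 0 0 1 N / 2 - logQuot 1 (-1) 0 0 2 N / 12 - stieltjes 1| ≤
      logQuot (-3) 2 0 0 3 N / 120 := by
  obtain ⟨c, hc⟩ := euler_maclaurin_logQuot (F := logQuot 0 0 (1 / 2) 0 0) (a₀ := 0) (a₁ := 1)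
    (a₂ := 0) (a₃ := 0) (p := 1) (b₀ := 1) (b₁ := -1) (b₂ := 0) (b₃ := 0) (c₀ := -3) (c₁ := 2)
    (c₂ := 0) (c₃ := 0) (fun t ht => by simpa using hasDerivAt_logQuot 0 0 (1 / 2) 0 0 ht)
    (by norm_num) (by norm_num) (fun L hL => by norm_num; linarith)
  have h := tendsto_sum_of_euler_maclaurin (F := logQuot 0 0 (1 / 2) 0 0) le_rfl hc
  rw [stieltjes_eq_of_tendsto (n := 1) (h.congr fun N => by simp [logQuot]; ring)]
  exact hc N hN

theorem stieltjes_two_euler_maclaurin (N : ℕ) (hN : 21 ≤ N) :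
    |(∑ k ∈ Finset.Icc 1 N, logQuot 0 0 1 0 1 k) - logQuot 0 0 0 (1 / 3) 0 N
        - logQuot 0 0 1 0 1 N / 2 - logQuot 0 2 (-1) 0 2 N / 12 - stieltjes 2| ≤
      logQuot 2 (-6) 2 0 3 N / 120 := by
  obtain ⟨c, hc⟩ := euler_maclaurin_logQuot (F := logQuot 0 0 0 (1 / 3) 0) (a₀ := 0) (a₁ := 0)
    (a₂ := 1) (a₃ := 0) (p := 1) (b₀ := 0) (b₁ := 2) (b₂ := -1) (b₃ := 0) (c₀ := 2) (c₁ := -6)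
    (c₂ := 2) (c₃ := 0) (fun t ht => by simpa using hasDerivAt_logQuot 0 0 0 (1 / 3) 0 ht)
    (by norm_num) (by norm_num) (fun L hL => by norm_num; nlinarith)
  have h := tendsto_sum_of_euler_maclaurin (F := logQuot 0 0 0 (1 / 3) 0) le_rfl hc
  rw [stieltjes_eq_of_tendsto (n := 2) (h.congr fun N => by simp [logQuot]; norm_num; ring)]
  exact hc N hN

/-- `∑ log^j n / n^2`, the absolute value of the `j`-th derivative of `ζ` at `2`. -/
noncomputable def zetaLog (j : ℕ) : ℝ := ∑' n : ℕ, Real.log n ^ j / (n : ℝ) ^ 2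

theorem summable_log_pow_div_sq (j : ℕ) : Summable fun n : ℕ => Real.log n ^ j / (n : ℝ) ^ 2 := by
  have h0 : Summable fun n : ℕ => 1 / (n : ℝ) ^ (3 / 2 : ℝ) :=
    Real.summable_one_div_nat_rpow.2 (by norm_num)
  refine summable_of_isBigO_nat h0 ?_
  have h := (isLittleO_log_rpow_rpow_atTop (j : ℝ) (s := (1 / 2 : ℝ)) (by norm_num)).isBigO.comp_tendsto
    tendsto_natCast_atTop_atTop
  have h2 := h.mul (Asymptotics.isBigO_refl (fun n : ℕ => 1 / (n : ℝ) ^ 2) atTop)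
  refine (h2.congr' ?_ ?_)
  · filter_upwards with n
    simp [Function.comp]
    ring
  · filter_upwards [eventually_gt_atTop 0] with n hn
    have hn' : (0 : ℝ) < n := by exact_mod_cast hn
    simp only [Function.comp]
    rw [mul_one_div, ← Real.rpow_natCast, ← Real.rpow_sub hn', one_div ((n : ℝ) ^ (3 / 2 : ℝ)), ← Real.rpow_neg hn'.le]
    norm_num

theorem zetaLog_eq_of_tendsto {j : ℕ} {F : ℝ → ℝ} {c : ℝ} (hF : Tendsto F atTop (nhds 0))
    (h : Tendsto (fun N : ℕ => (∑ k ∈ Finset.Icc 1 N, Real.log (k : ℝ) ^ j / (k : ℝ) ^ 2) - F N)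
      atTop (nhds c)) : zetaLog j = c := by
  have h1 := (summable_log_pow_div_sq j).hasSum.tendsto_sum_nat
  have h2 := h.add (hF.comp tendsto_natCast_atTop_atTop)
  rw [add_zero] at h2
  have h3 := (tendsto_add_atTop_iff_nat 1).2 h1
  refine tendsto_nhds_unique h3 (h2.congr fun N => ?_)
  -- The term `n = 0` of the series is `0`, because division by zero gives `0`.
  rw [Finset.range_eq_Ico, Finset.sum_eq_sum_Ico_succ_bot (by omega)]
  simp
  rfl

theorem zetaLog_one_euler_maclaurin (N : ℕ) (hN : 21 ≤ N) :
    |(∑ k ∈ Finset.Icc 1 N, logQuot 0 1 0 0 2 k) - logQuot (-1) (-1) 0 0 1 N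
        - logQuot 0 1 0 0 2 N / 2 - logQuot 1 (-2) 0 0 3 N / 12 - zetaLog 1| ≤
      logQuot (-5) 6 0 0 4 N / 120 := by
  obtain ⟨c, hc⟩ := euler_maclaurin_logQuot (F := logQuot (-1) (-1) 0 0 1) (a₀ := 0) (a₁ := 1)
    (a₂ := 0) (a₃ := 0) (p := 2) (b₀ := 1) (b₁ := -2) (b₂ := 0) (b₃ := 0) (c₀ := -5) (c₁ := 6)
    (c₂ := 0) (c₃ := 0) (fun t ht => by simpa using hasDerivAt_logQuot (-1) (-1) 0 0 1 ht)
    (by norm_num) (by norm_num) (fun L hL => by norm_num; linarith)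
  have h := tendsto_sum_of_euler_maclaurin (F := logQuot (-1) (-1) 0 0 1) (by norm_num) hc
  rw [zetaLog_eq_of_tendsto (j := 1) (tendsto_logQuot (-1) (-1) 0 0 le_rfl)
    (h.congr fun N => by simp [logQuot])]
  exact hc N hN

theorem zetaLog_two_euler_maclaurin (N : ℕ) (hN : 21 ≤ N) :
    |(∑ k ∈ Finset.Icc 1 N, logQuot 0 0 1 0 2 k) - logQuot (-2) (-2) (-1) 0 1 N
        - logQuot 0 0 1 0 2 N / 2 - logQuot 0 2 (-2) 0 3 N / 12 - zetaLog 2| ≤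
      logQuot 2 (-10) 6 0 4 N / 120 := by
  obtain ⟨c, hc⟩ := euler_maclaurin_logQuot (F := logQuot (-2) (-2) (-1) 0 1) (a₀ := 0) (a₁ := 0)
    (a₂ := 1) (a₃ := 0) (p := 2) (b₀ := 0) (b₁ := 2) (b₂ := -2) (b₃ := 0) (c₀ := 2) (c₁ := -10)
    (c₂ := 6) (c₃ := 0) (fun t ht => by simpa using hasDerivAt_logQuot (-2) (-2) (-1) 0 1 ht)
    (by norm_num) (by norm_num) (fun L hL => by norm_num; nlinarith)
  have h := tendsto_sum_of_euler_maclaurin (F := logQuot (-2) (-2) (-1) 0 1) (by norm_num) hc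
  rw [zetaLog_eq_of_tendsto (j := 2) (tendsto_logQuot (-2) (-2) (-1) 0 le_rfl)
    (h.congr fun N => by simp [logQuot])]
  exact hc N hN

theorem zetaLog_three_euler_maclaurin (N : ℕ) (hN : 21 ≤ N) :
    |(∑ k ∈ Finset.Icc 1 N, logQuot 0 0 0 1 2 k) - logQuot (-6) (-6) (-3) (-1) 1 N
        - logQuot 0 0 0 1 2 N / 2 - logQuot 0 0 3 (-2) 3 N / 12 - zetaLog 3| ≤
      logQuot 0 6 (-15) 6 4 N / 120 := by
  obtain ⟨c, hc⟩ := euler_maclaurin_logQuot (F := logQuot (-6) (-6) (-3) (-1) 1) (a₀ := 0) (a₁ := 0)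
    (a₂ := 0) (a₃ := 1) (p := 2) (b₀ := 0) (b₁ := 0) (b₂ := 3) (b₃ := -2) (c₀ := 0) (c₁ := 6)
    (c₂ := -15) (c₃ := 6) (fun t ht => by
      have h := hasDerivAt_logQuot (-6) (-6) (-3) (-1) 1 ht
      norm_num at h
      exact h)
    (by norm_num) (by norm_num) (fun L hL => by
      norm_num; nlinarith [mul_nonneg (sub_nonneg.2 hL) (sq_nonneg L), mul_nonneg (sub_nonneg.2 hL) (sub_nonneg.2 hL)])
  have h := tendsto_sum_of_euler_maclaurin (F := logQuot (-6) (-6) (-3) (-1) 1) (by norm_num) hc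
  rw [zetaLog_eq_of_tendsto (j := 3) (tendsto_logQuot (-6) (-6) (-3) (-1) le_rfl)
    (h.congr fun N => by simp [logQuot])]
  exact hc N hN

end Constants

/-! ### Numerical values of the constants -/

section Numerics

theorem log_twentyone_bounds : 3.0445221 < Real.log 21 ∧ Real.log 21 < 3.0445228 := by
  have h := log_table (k := 21) (by simp)
  have h1 : ((3.0445221 : ℚ) : ℝ) < (logLo 21 : ℝ) := by
    have : (3.0445221 : ℚ) < logLo 21 := by decide +kernel
    exact_mod_cast this
  have h2 : (logHi 21 : ℝ) < ((3.0445228 : ℚ) : ℝ) := by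
    have : logHi 21 < (3.0445228 : ℚ) := by decide +kernel
    exact_mod_cast this
  push_cast at h h1 h2
  constructor <;> linarith [h.1, h.2]

theorem eulerMascheroni_bounds :
    0.577212 < Real.eulerMascheroniConstant ∧ Real.eulerMascheroniConstant < 0.577219 := by
  have h := stieltjes_zero_euler_maclaurin 21 le_rfl
  have h1 := sum_log_pow_div_le 0 1
  have h2 := le_sum_log_pow_div 0 1
  have h3 : ((∑ k ∈ Finset.Icc (1 : ℕ) 21, logHi k ^ 0 / (k : ℚ) ^ 1 : ℚ) : ℝ) ≤ ((3.64535871 : ℚ) : ℝ) := by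
    have : (∑ k ∈ Finset.Icc (1 : ℕ) 21, logHi k ^ 0 / (k : ℚ) ^ 1 : ℚ) ≤ 3.64535871 := by decide +kernel
    exact_mod_cast this
  have h4 : ((3.64535870 : ℚ) : ℝ) ≤ ((∑ k ∈ Finset.Icc (1 : ℕ) 21, logLo k ^ 0 / (k : ℚ) ^ 1 : ℚ) : ℝ) := by
    have : (3.64535870 : ℚ) ≤ (∑ k ∈ Finset.Icc (1 : ℕ) 21, logLo k ^ 0 / (k : ℚ) ^ 1 : ℚ) := by decide +kernel
    exact_mod_cast this
  have h5 := h1.trans h3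
  have h6 := h4.trans h2
  have e : ∑ k ∈ Finset.Icc (1 : ℕ) 21, Real.log k ^ 0 / (k : ℝ) ^ 1 =
      ∑ k ∈ Finset.Icc (1 : ℕ) 21, logQuot 1 0 0 0 1 k := by
    simp only [logQuot]
    exact Finset.sum_congr rfl fun k _ => by ring
  rw [e] at h5 h6
  obtain ⟨a1, a2⟩ := log_twentyone_bounds
  -- The same scheme serves all six constants: `linarith` treats the finite sum and the powers of
  -- `log 21` as separate unknowns, hence bounds for each power.
  have b1 : 3.0445221 ^ 2 < Real.log 21 ^ 2 := by gcongr
  have b2 : Real.log 21 ^ 2 < 3.0445228 ^ 2 := by gcongr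
  have c1 : 3.0445221 ^ 3 < Real.log 21 ^ 3 := by gcongr
  have c2 : Real.log 21 ^ 3 < 3.0445228 ^ 3 := by gcongr
  set S := ∑ k ∈ Finset.Icc (1 : ℕ) 21, logQuot 1 0 0 0 1 k
  simp only [logQuot] at h
  push_cast at h h5 h6
  rw [abs_le] at h
  obtain ⟨g1, g2⟩ := h
  constructor <;> linarith

theorem stieltjes_one_bounds : -0.072824 < stieltjes 1 ∧ stieltjes 1 < -0.072808 := by
  have h := stieltjes_one_euler_maclaurin 21 le_rfl
  have h1 := sum_log_pow_div_le 1 1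
  have h2 := le_sum_log_pow_div 1 1
  have h3 : ((∑ k ∈ Finset.Icc (1 : ℕ) 21, logHi k ^ 1 / (k : ℚ) ^ 1 : ℚ) : ℝ) ≤ ((4.63384557 : ℚ) : ℝ) := by
    have : (∑ k ∈ Finset.Icc (1 : ℕ) 21, logHi k ^ 1 / (k : ℚ) ^ 1 : ℚ) ≤ 4.63384557 := by decide +kernel
    exact_mod_cast this
  have h4 : ((4.63384423 : ℚ) : ℝ) ≤ ((∑ k ∈ Finset.Icc (1 : ℕ) 21, logLo k ^ 1 / (k : ℚ) ^ 1 : ℚ) : ℝ) := by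
    have : (4.63384423 : ℚ) ≤ (∑ k ∈ Finset.Icc (1 : ℕ) 21, logLo k ^ 1 / (k : ℚ) ^ 1 : ℚ) := by decide +kernel
    exact_mod_cast this
  have h5 := h1.trans h3
  have h6 := h4.trans h2
  have e : ∑ k ∈ Finset.Icc (1 : ℕ) 21, Real.log k ^ 1 / (k : ℝ) ^ 1 =
      ∑ k ∈ Finset.Icc (1 : ℕ) 21, logQuot 0 1 0 0 1 k := by
    simp only [logQuot]
    exact Finset.sum_congr rfl fun k _ => by ring
  rw [e] at h5 h6
  obtain ⟨a1, a2⟩ := log_twentyone_bounds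
  have b1 : 3.0445221 ^ 2 < Real.log 21 ^ 2 := by gcongr
  have b2 : Real.log 21 ^ 2 < 3.0445228 ^ 2 := by gcongr
  have c1 : 3.0445221 ^ 3 < Real.log 21 ^ 3 := by gcongr
  have c2 : Real.log 21 ^ 3 < 3.0445228 ^ 3 := by gcongr
  set S := ∑ k ∈ Finset.Icc (1 : ℕ) 21, logQuot 0 1 0 0 1 k
  simp only [logQuot] at h
  push_cast at h h5 h6
  rw [abs_le] at h
  obtain ⟨g1, g2⟩ := h
  constructor <;> linarith

theorem stieltjes_two_bounds : -0.009704 < stieltjes 2 ∧ stieltjes 2 < -0.009677 := by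
  have h := stieltjes_two_euler_maclaurin 21 le_rfl
  have h1 := sum_log_pow_div_le 2 1
  have h2 := le_sum_log_pow_div 2 1
  have h3 : ((∑ k ∈ Finset.Icc (1 : ℕ) 21, logHi k ^ 2 / (k : ℚ) ^ 1 : ℚ) : ℝ) ≤ ((9.61708234 : ℚ) : ℝ) := by
    have : (∑ k ∈ Finset.Icc (1 : ℕ) 21, logHi k ^ 2 / (k : ℚ) ^ 1 : ℚ) ≤ 9.61708234 := by decide +kernel
    exact_mod_cast this
  have h4 : ((9.61707769 : ℚ) : ℝ) ≤ ((∑ k ∈ Finset.Icc (1 : ℕ) 21, logLo k ^ 2 / (k : ℚ) ^ 1 : ℚ) : ℝ) := by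
    have : (9.61707769 : ℚ) ≤ (∑ k ∈ Finset.Icc (1 : ℕ) 21, logLo k ^ 2 / (k : ℚ) ^ 1 : ℚ) := by decide +kernel
    exact_mod_cast this
  have h5 := h1.trans h3
  have h6 := h4.trans h2
  have e : ∑ k ∈ Finset.Icc (1 : ℕ) 21, Real.log k ^ 2 / (k : ℝ) ^ 1 =
      ∑ k ∈ Finset.Icc (1 : ℕ) 21, logQuot 0 0 1 0 1 k := by
    simp only [logQuot]
    exact Finset.sum_congr rfl fun k _ => by ring
  rw [e] at h5 h6
  obtain ⟨a1, a2⟩ := log_twentyone_bounds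
  have b1 : 3.0445221 ^ 2 < Real.log 21 ^ 2 := by gcongr
  have b2 : Real.log 21 ^ 2 < 3.0445228 ^ 2 := by gcongr
  have c1 : 3.0445221 ^ 3 < Real.log 21 ^ 3 := by gcongr
  have c2 : Real.log 21 ^ 3 < 3.0445228 ^ 3 := by gcongr
  set S := ∑ k ∈ Finset.Icc (1 : ℕ) 21, logQuot 0 0 1 0 1 k
  simp only [logQuot] at h
  push_cast at h h5 h6
  rw [abs_le] at h
  obtain ⟨g1, g2⟩ := h
  constructor <;> linarith

theorem zetaLog_one_bounds : 0.937544 < zetaLog 1 ∧ zetaLog 1 < 0.937552 := by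
  have h := zetaLog_one_euler_maclaurin 21 le_rfl
  have h1 := sum_log_pow_div_le 1 2
  have h2 := le_sum_log_pow_div 1 2
  have h3 : ((∑ k ∈ Finset.Icc (1 : ℕ) 21, logHi k ^ 1 / (k : ℚ) ^ 2 : ℚ) : ℝ) ≤ ((0.74835815 : ℚ) : ℝ) := by
    have : (∑ k ∈ Finset.Icc (1 : ℕ) 21, logHi k ^ 1 / (k : ℚ) ^ 2 : ℚ) ≤ 0.74835815 := by decide +kernel
    exact_mod_cast this
  have h4 : ((0.74835784 : ℚ) : ℝ) ≤ ((∑ k ∈ Finset.Icc (1 : ℕ) 21, logLo k ^ 1 / (k : ℚ) ^ 2 : ℚ) : ℝ) := by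
    have : (0.74835784 : ℚ) ≤ (∑ k ∈ Finset.Icc (1 : ℕ) 21, logLo k ^ 1 / (k : ℚ) ^ 2 : ℚ) := by decide +kernel
    exact_mod_cast this
  have h5 := h1.trans h3
  have h6 := h4.trans h2
  have e : ∑ k ∈ Finset.Icc (1 : ℕ) 21, Real.log k ^ 1 / (k : ℝ) ^ 2 =
      ∑ k ∈ Finset.Icc (1 : ℕ) 21, logQuot 0 1 0 0 2 k := by
    simp only [logQuot]
    exact Finset.sum_congr rfl fun k _ => by ring
  rw [e] at h5 h6
  obtain ⟨a1, a2⟩ := log_twentyone_bounds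
  have b1 : 3.0445221 ^ 2 < Real.log 21 ^ 2 := by gcongr
  have b2 : Real.log 21 ^ 2 < 3.0445228 ^ 2 := by gcongr
  have c1 : 3.0445221 ^ 3 < Real.log 21 ^ 3 := by gcongr
  have c2 : Real.log 21 ^ 3 < 3.0445228 ^ 3 := by gcongr
  set S := ∑ k ∈ Finset.Icc (1 : ℕ) 21, logQuot 0 1 0 0 2 k
  simp only [logQuot] at h
  push_cast at h h5 h6
  rw [abs_le] at h
  obtain ⟨g1, g2⟩ := h
  constructor <;> linarith

theorem zetaLog_two_bounds : 1.989274 < zetaLog 2 ∧ zetaLog 2 < 1.989287 := by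
  have h := zetaLog_two_euler_maclaurin 21 le_rfl
  have h1 := sum_log_pow_div_le 2 2
  have h2 := le_sum_log_pow_div 2 2
  have h3 : ((∑ k ∈ Finset.Icc (1 : ℕ) 21, logHi k ^ 2 / (k : ℚ) ^ 2 : ℚ) : ℝ) ≤ ((1.17309867 : ℚ) : ℝ) := by
    have : (∑ k ∈ Finset.Icc (1 : ℕ) 21, logHi k ^ 2 / (k : ℚ) ^ 2 : ℚ) ≤ 1.17309867 := by decide +kernel
    exact_mod_cast this
  have h4 : ((1.17309791 : ℚ) : ℝ) ≤ ((∑ k ∈ Finset.Icc (1 : ℕ) 21, logLo k ^ 2 / (k : ℚ) ^ 2 : ℚ) : ℝ) := by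
    have : (1.17309791 : ℚ) ≤ (∑ k ∈ Finset.Icc (1 : ℕ) 21, logLo k ^ 2 / (k : ℚ) ^ 2 : ℚ) := by decide +kernel
    exact_mod_cast this
  have h5 := h1.trans h3
  have h6 := h4.trans h2
  have e : ∑ k ∈ Finset.Icc (1 : ℕ) 21, Real.log k ^ 2 / (k : ℝ) ^ 2 =
      ∑ k ∈ Finset.Icc (1 : ℕ) 21, logQuot 0 0 1 0 2 k := by
    simp only [logQuot]
    exact Finset.sum_congr rfl fun k _ => by ring
  rw [e] at h5 h6
  obtain ⟨a1, a2⟩ := log_twentyone_bounds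
  have b1 : 3.0445221 ^ 2 < Real.log 21 ^ 2 := by gcongr
  have b2 : Real.log 21 ^ 2 < 3.0445228 ^ 2 := by gcongr
  have c1 : 3.0445221 ^ 3 < Real.log 21 ^ 3 := by gcongr
  have c2 : Real.log 21 ^ 3 < 3.0445228 ^ 3 := by gcongr
  set S := ∑ k ∈ Finset.Icc (1 : ℕ) 21, logQuot 0 0 1 0 2 k
  simp only [logQuot] at h
  push_cast at h h5 h6
  rw [abs_le] at h
  obtain ⟨g1, g2⟩ := h
  constructor <;> linarith

theorem zetaLog_three_bounds : 6.000139 < zetaLog 3 ∧ zetaLog 3 < 6.000154 := by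
  have h := zetaLog_three_euler_maclaurin 21 le_rfl
  have h1 := sum_log_pow_div_le 3 2
  have h2 := le_sum_log_pow_div 3 2
  have h3 : ((∑ k ∈ Finset.Icc (1 : ℕ) 21, logHi k ^ 3 / (k : ℚ) ^ 2 : ℚ) : ℝ) ≤ ((2.20833600 : ℚ) : ℝ) := by
    have : (∑ k ∈ Finset.Icc (1 : ℕ) 21, logHi k ^ 3 / (k : ℚ) ^ 2 : ℚ) ≤ 2.20833600 := by decide +kernel
    exact_mod_cast this
  have h4 : ((2.20833423 : ℚ) : ℝ) ≤ ((∑ k ∈ Finset.Icc (1 : ℕ) 21, logLo k ^ 3 / (k : ℚ) ^ 2 : ℚ) : ℝ) := by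
    have : (2.20833423 : ℚ) ≤ (∑ k ∈ Finset.Icc (1 : ℕ) 21, logLo k ^ 3 / (k : ℚ) ^ 2 : ℚ) := by decide +kernel
    exact_mod_cast this
  have h5 := h1.trans h3
  have h6 := h4.trans h2
  have e : ∑ k ∈ Finset.Icc (1 : ℕ) 21, Real.log k ^ 3 / (k : ℝ) ^ 2 =
      ∑ k ∈ Finset.Icc (1 : ℕ) 21, logQuot 0 0 0 1 2 k := by
    simp only [logQuot]
    exact Finset.sum_congr rfl fun k _ => by ring
  rw [e] at h5 h6
  obtain ⟨a1, a2⟩ := log_twentyone_bounds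
  have b1 : 3.0445221 ^ 2 < Real.log 21 ^ 2 := by gcongr
  have b2 : Real.log 21 ^ 2 < 3.0445228 ^ 2 := by gcongr
  have c1 : 3.0445221 ^ 3 < Real.log 21 ^ 3 := by gcongr
  have c2 : Real.log 21 ^ 3 < 3.0445228 ^ 3 := by gcongr
  set S := ∑ k ∈ Finset.Icc (1 : ℕ) 21, logQuot 0 0 0 1 2 k
  simp only [logQuot] at h
  push_cast at h h5 h6
  rw [abs_le] at h
  obtain ⟨g1, g2⟩ := h
  constructor <;> linarith

end Numerics

/-! ### Asymptotics of `∑ d(n)/n` and `∑ d(n) log n / n` -/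

section WeightedDivisorSums

/-- From `log t ≤ 6 t^(1/6)`, and `216 = 6³`. The constant is crude on purpose: these estimates
serve only to identify limits, never to bound the final error. -/
theorem log_pow_le_sqrt {t : ℝ} (ht : 1 ≤ t) {i : ℕ} (hi : i ≤ 3) :
    Real.log t ^ i ≤ 216 * √t := by
  have h0 := Real.log_nonneg ht
  have h1 : Real.log t ≤ 6 * t ^ (1 / 6 : ℝ) := by
    have := Real.log_le_rpow_div (x := t) (by linarith) (ε := 1 / 6) (by norm_num)
    linarith
  have h2 : (1 : ℝ) ≤ t ^ (1 / 6 : ℝ) := Real.one_le_rpow ht (by norm_num)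
  have h3 : √t = (t ^ (1 / 6 : ℝ)) ^ 3 := by
    rw [Real.sqrt_eq_rpow, ← Real.rpow_natCast, ← Real.rpow_mul (by linarith)]
    norm_num
  calc Real.log t ^ i ≤ (6 * t ^ (1 / 6 : ℝ)) ^ i := by gcongr
    _ ≤ (6 * t ^ (1 / 6 : ℝ)) ^ 3 := pow_le_pow_right₀ (by linarith) hi
    _ = 216 * √t := by rw [h3]; ring

theorem abs_logQuot_le (a₀ a₁ a₂ a₃ : ℝ) {p : ℕ} (hp : 1 ≤ p) {t : ℝ} (ht : 1 ≤ t) :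
    |logQuot a₀ a₁ a₂ a₃ p t| ≤ 216 * (|a₀| + |a₁| + |a₂| + |a₃|) / √t := by
  have h0 := log_pow_le_sqrt ht (i := 0) (by norm_num)
  have h1 := log_pow_le_sqrt ht (i := 1) (by norm_num)
  have h2 := log_pow_le_sqrt ht (i := 2) (by norm_num)
  have h3 := log_pow_le_sqrt ht (i := 3) (by norm_num)
  rw [pow_zero] at h0
  rw [pow_one] at h1
  have hl := Real.log_nonneg ht
  have hs : 0 < √t := Real.sqrt_pos.2 (by linarith)
  have hp' : √t * √t ≤ t ^ p := by
    rw [Real.mul_self_sqrt (by linarith)]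
    exact le_self_pow₀ ht (by omega)
  rw [logQuot, abs_div, abs_of_pos (a := t ^ p) (by positivity)]
  have hnum : |a₀ + a₁ * Real.log t + a₂ * Real.log t ^ 2 + a₃ * Real.log t ^ 3| ≤
      216 * (|a₀| + |a₁| + |a₂| + |a₃|) * √t := by
    calc _ ≤ |a₀| + |a₁ * Real.log t| + |a₂ * Real.log t ^ 2| + |a₃ * Real.log t ^ 3| := by
          refine (abs_add_le _ _).trans ?_
          gcongr
          refine (abs_add_le _ _).trans ?_
          gcongr
          exact abs_add_le _ _
      _ = |a₀| * 1 + |a₁| * Real.log t + |a₂| * Real.log t ^ 2 + |a₃| * Real.log t ^ 3 := by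
          rw [abs_mul, abs_mul, abs_mul, abs_of_nonneg hl, abs_of_nonneg (pow_nonneg hl 2),
            abs_of_nonneg (pow_nonneg hl 3), mul_one]
      _ ≤ |a₀| * (216 * √t) + |a₁| * (216 * √t) + |a₂| * (216 * √t) + |a₃| * (216 * √t) := by
          gcongr
      _ = _ := by ring
  rw [div_le_div_iff₀ (by positivity) hs]
  calc _ ≤ 216 * (|a₀| + |a₁| + |a₂| + |a₃|) * √t * √t := by gcongr
    _ = 216 * (|a₀| + |a₁| + |a₂| + |a₃|) * (√t * √t) := by ring
    _ ≤ _ := by gcongr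

theorem abs_sum_floor_sub_le {F : ℝ → ℝ} {a₀ a₁ a₂ a₃ c : ℝ} {b₀ b₁ b₂ b₃ c₀ c₁ c₂ c₃ : ℝ}
    (hF : ∀ t : ℝ, 0 < t → HasDerivAt F (logQuot a₀ a₁ a₂ a₃ 1 t) t)
    (h : ∀ N : ℕ, 21 ≤ N →
      |(∑ k ∈ Finset.Icc 1 N, logQuot a₀ a₁ a₂ a₃ 1 k) - F N - logQuot a₀ a₁ a₂ a₃ 1 N / 2
        - logQuot b₀ b₁ b₂ b₃ 2 N / 12 - c| ≤ logQuot c₀ c₁ c₂ c₃ 3 N / 120) :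
    ∃ K : ℝ, 0 ≤ K ∧ ∀ z : ℝ, 21 ≤ z →
      |(∑ k ∈ Finset.Icc 1 ⌊z⌋₊, logQuot a₀ a₁ a₂ a₃ 1 k) - F z - c| ≤ K / √z := by
  set A := 216 * (|a₀| + |a₁| + |a₂| + |a₃|)
  set B := 216 * (|b₀| + |b₁| + |b₂| + |b₃|)
  set C := 216 * (|c₀| + |c₁| + |c₂| + |c₃|)
  have hA : 0 ≤ A := by positivity
  have hB : 0 ≤ B := by positivity
  have hC : 0 ≤ C := by positivity
  refine ⟨2 * (2 * A + B + C), by positivity, fun z hz => ?_⟩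
  set N := ⌊z⌋₊ with hN
  have hN21 : 21 ≤ N := Nat.le_floor (by exact_mod_cast hz)
  have hNr : (21 : ℝ) ≤ N := by exact_mod_cast hN21
  have hNz : (N : ℝ) ≤ z := Nat.floor_le (by linarith)
  have hzN : z < N + 1 := Nat.lt_floor_add_one z
  have hs : 0 < √(N : ℝ) := Real.sqrt_pos.2 (by linarith)
  have hsz : 0 < √z := Real.sqrt_pos.2 (by linarith)
  have h1 := abs_logQuot_le a₀ a₁ a₂ a₃ le_rfl (t := N) (by linarith)
  have h2 := abs_logQuot_le b₀ b₁ b₂ b₃ (p := 2) (by norm_num) (t := N) (by linarith)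
  have h3 := abs_logQuot_le c₀ c₁ c₂ c₃ (p := 3) (by norm_num) (t := N) (by linarith)
  -- Passing from the integer `N = ⌊z⌋` to real `z` moves `F` by at most the supremum of its
  -- derivative, as `z - N ≤ 1`.
  have hFz : |F z - F N| ≤ A / √(N : ℝ) := by
    have := (convex_Icc (N : ℝ) z).norm_image_sub_le_of_norm_hasDerivWithin_le
      (f := F) (f' := logQuot a₀ a₁ a₂ a₃ 1) (C := A / √(N : ℝ))
      (fun t ht => (hF t (by linarith [ht.1])).hasDerivWithinAt)
      (fun t ht => (abs_logQuot_le a₀ a₁ a₂ a₃ le_rfl (t := t) (by linarith [ht.1])).trans (by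
        have := Real.sqrt_le_sqrt ht.1
        gcongr))
      (⟨le_rfl, hNz⟩ : (N : ℝ) ∈ Set.Icc (N : ℝ) z) (⟨hNz, le_rfl⟩ : z ∈ Set.Icc (N : ℝ) z)
    rw [Real.norm_eq_abs, Real.norm_eq_abs, abs_of_nonneg (a := z - N) (by linarith)] at this
    refine this.trans ?_
    have h0 : 0 ≤ A / √(N : ℝ) := by positivity
    nlinarith
  have h4 := h N hN21
  have hfin : |(∑ k ∈ Finset.Icc 1 N, logQuot a₀ a₁ a₂ a₃ 1 k) - F z - c| ≤
      (2 * A + B + C) / √(N : ℝ) := by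
    have e : (2 * A + B + C) / √(N : ℝ) = A / √N + A / √N + B / √N + C / √N := by ring
    rw [e]
    have h0A : 0 ≤ A / √(N : ℝ) := by positivity
    have h0B : 0 ≤ B / √(N : ℝ) := by positivity
    have h0C : 0 ≤ C / √(N : ℝ) := by positivity
    rw [abs_le] at *
    constructor <;> linarith [h1.1, h1.2, h2.1, h2.2, h3.1, h3.2, h4.1, h4.2, hFz.1, hFz.2]
  refine hfin.trans ?_
  have hsq : √z ≤ 2 * √(N : ℝ) := by
    rw [show (2 : ℝ) * √(N : ℝ) = √(4 * N) by
      rw [Real.sqrt_mul (by norm_num), show (4 : ℝ) = 2 ^ 2 by norm_num,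
        Real.sqrt_sq (by norm_num)]]
    exact Real.sqrt_le_sqrt (by linarith)
  rw [div_le_div_iff₀ hs hsz]
  have : 0 ≤ 2 * A + B + C := by positivity
  nlinarith

/-- `∑_{k ≤ z} log^j k / k`. -/
noncomputable def logSum (j : ℕ) (z : ℝ) : ℝ :=
  ∑ k ∈ Finset.Icc 1 ⌊z⌋₊, Real.log k ^ j / (k : ℝ)

/-- The constants `γ`, `γ₁`, `γ₂`. -/
noncomputable def stieltjesConst (j : ℕ) : ℝ :=
  if j = 0 then Real.eulerMascheroniConstant else stieltjes j

/-- The remainder in the asymptotic expansion of `logSum`. -/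
noncomputable def logErr (j : ℕ) (z : ℝ) : ℝ :=
  logSum j z - Real.log z ^ (j + 1) / (j + 1) - stieltjesConst j

theorem abs_logErr_le (j : ℕ) (hj : j < 3) : ∃ K : ℝ, 0 ≤ K ∧ ∀ z : ℝ, 21 ≤ z →
    |logErr j z| ≤ K / √z := by
  interval_cases j
  · obtain ⟨K, hK, h⟩ := abs_sum_floor_sub_le
      (fun t ht => by simpa using hasDerivAt_logQuot 0 1 0 0 0 ht) stieltjes_zero_euler_maclaurin
    refine ⟨K, hK, fun z hz => le_trans (le_of_eq ?_) (h z hz)⟩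
    simp [logErr, logSum, stieltjesConst, logQuot]
  · obtain ⟨K, hK, h⟩ := abs_sum_floor_sub_le
      (fun t ht => by simpa using hasDerivAt_logQuot 0 0 (1 / 2) 0 0 ht)
      stieltjes_one_euler_maclaurin
    refine ⟨K, hK, fun z hz => le_trans (le_of_eq ?_) (h z hz)⟩
    simp [logErr, logSum, stieltjesConst, logQuot]
    ring_nf
  · obtain ⟨K, hK, h⟩ := abs_sum_floor_sub_le
      (fun t ht => by simpa using hasDerivAt_logQuot 0 0 0 (1 / 3) 0 ht)
      stieltjes_two_euler_maclaurin
    refine ⟨K, hK, fun z hz => le_trans (le_of_eq ?_) (h z hz)⟩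
    simp [logErr, logSum, stieltjesConst, logQuot]
    ring_nf

theorem logSum_eq (j : ℕ) (z : ℝ) :
    logSum j z = Real.log z ^ (j + 1) / (j + 1) + stieltjesConst j + logErr j z := by
  rw [logErr]; ring

theorem tendsto_log_pow_div_sqrt (i : ℕ) :
    Tendsto (fun w : ℝ => Real.log w ^ i / √w) atTop (nhds 0) := by
  have h := (isLittleO_log_rpow_rpow_atTop (i : ℝ) (s := (1 / 2 : ℝ))
    (by norm_num)).tendsto_div_nhds_zero
  refine h.congr fun t => ?_
  rw [Real.rpow_natCast, Real.sqrt_eq_rpow]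

theorem tendsto_log_pow_mul_logErr (i j : ℕ) (hj : j < 3) :
    Tendsto (fun w : ℝ => Real.log w ^ i * logErr j w) atTop (nhds 0) := by
  obtain ⟨K, hK, h⟩ := abs_logErr_le j hj
  have ht := (tendsto_log_pow_div_sqrt i).const_mul K
  rw [mul_zero] at ht
  refine squeeze_zero_norm' ?_ ht
  filter_upwards [eventually_ge_atTop 21] with w hw
  have h0 : 0 ≤ Real.log w := Real.log_nonneg (by linarith)
  rw [Real.norm_eq_abs, abs_mul, abs_of_nonneg (pow_nonneg h0 i)]
  calc _ ≤ Real.log w ^ i * (K / √w) := by gcongr; exact h w hw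
    _ = _ := by ring

theorem tendsto_logErr (j : ℕ) (hj : j < 3) : Tendsto (logErr j) atTop (nhds 0) := by
  simpa using tendsto_log_pow_mul_logErr 0 j hj

theorem tendsto_logSum_div_sqrt (j : ℕ) (hj : j < 3) :
    Tendsto (fun w => logSum j w / √w) atTop (nhds 0) := by
  have h0 := (tendsto_log_pow_div_sqrt (j + 1)).div_const ((j : ℝ) + 1)
  have h1 := (tendsto_log_pow_div_sqrt 0).const_mul (stieltjesConst j)
  have h2 := (tendsto_logErr j hj).mul (tendsto_log_pow_div_sqrt 0)
  have := (h0.add h1).add h2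
  simp only [zero_div, mul_zero, add_zero] at this
  refine this.congr fun w => ?_
  rw [logSum_eq j w]
  ring

/-- Replacing `logSum j (w² / a)` by its main term inside a weighted sum over `a ≤ w`. -/
theorem tendsto_sum_mul_logErr (i j : ℕ) (hi : i < 3) (hj : j < 3) :
    Tendsto (fun w : ℝ => ∑ a ∈ Finset.Icc 1 ⌊w⌋₊, Real.log a ^ i / (a : ℝ) * logErr j (w ^ 2 / a))
      atTop (nhds 0) := by
  obtain ⟨K, hK, h⟩ := abs_logErr_le j hj
  have ht := (tendsto_logSum_div_sqrt i hi).const_mul K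
  rw [mul_zero] at ht
  refine squeeze_zero_norm' ?_ ht
  filter_upwards [eventually_ge_atTop 21] with w hw
  have e : K * (logSum i w / √w) =
      ∑ a ∈ Finset.Icc 1 ⌊w⌋₊, Real.log a ^ i / (a : ℝ) * (K / √w) := by
    rw [logSum, ← Finset.sum_mul]; ring
  rw [e]
  refine norm_sum_le_of_le _ fun a ha => ?_
  rw [Finset.mem_Icc] at ha
  have ha1 : (1 : ℝ) ≤ a := by exact_mod_cast ha.1
  have haw : (a : ℝ) ≤ w := (Nat.le_floor_iff (by linarith)).1 ha.2
  have hwa : w ≤ w ^ 2 / a := by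
    rw [le_div_iff₀ (by linarith)]; nlinarith
  have hl : 0 ≤ Real.log a := Real.log_nonneg ha1
  rw [Real.norm_eq_abs, abs_mul, abs_of_nonneg (by positivity)]
  gcongr
  refine (h _ (by linarith)).trans ?_
  have := Real.sqrt_le_sqrt hwa
  have h2 : 0 < √w := Real.sqrt_pos.2 (by linarith)
  gcongr

theorem log_sq_div {w : ℝ} (hw : 0 < w) {a : ℕ} (ha : 1 ≤ a) :
    Real.log (w ^ 2 / a) = 2 * Real.log w - Real.log a := by
  have : (a : ℝ) ≠ 0 := by positivity
  rw [Real.log_div (by positivity) this, Real.log_pow]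
  norm_num

/-- `∑_{n ≤ y} d(n) / n`. -/
noncomputable def divSum (y : ℝ) : ℝ :=
  ∑ n ∈ Finset.Icc 1 ⌊y⌋₊, (n.divisors.card : ℝ) * (1 / (n : ℝ))

/-- `∑_{n ≤ y} d(n) log n / n`. -/
noncomputable def divLogSum (y : ℝ) : ℝ :=
  ∑ n ∈ Finset.Icc 1 ⌊y⌋₊, (n.divisors.card : ℝ) * (Real.log n / (n : ℝ))

theorem card_divisors_eq_sum (n : ℕ) :
    (n.divisors.card : ℝ) = ∑ _p ∈ n.divisorsAntidiagonal, (1 : ℝ) := by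
  simp [← Nat.map_div_right_divisors]

theorem divSum_sq_eq {w : ℝ} (hw : 0 ≤ w) :
    divSum (w ^ 2) = 2 * ∑ a ∈ Finset.Icc 1 ⌊w⌋₊, Real.log a ^ 0 / (a : ℝ) * logSum 0 (w ^ 2 / a)
      - logSum 0 w * logSum 0 w := by
  have h := sum_conv_eq (fun k => 1 / (k : ℝ)) (fun k => 1 / (k : ℝ)) (w ^ 2)
  rw [hyperbola, Real.sqrt_sq hw] at h
  simp only [divSum, logSum, pow_zero]
  rw [two_mul, ← h]
  refine Finset.sum_congr rfl fun n hn => ?_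
  rw [card_divisors_eq_sum, Finset.sum_mul]
  refine Finset.sum_congr rfl fun p hp => ?_
  rw [← (Nat.mem_divisorsAntidiagonal.1 hp).1]
  push_cast
  rw [one_mul, one_div_mul_one_div]

theorem divLogSum_sq_eq {w : ℝ} (hw : 0 ≤ w) :
    divLogSum (w ^ 2) = 2 * (∑ a ∈ Finset.Icc 1 ⌊w⌋₊, Real.log a ^ 1 / (a : ℝ) * logSum 0 (w ^ 2 / a)
      + ∑ a ∈ Finset.Icc 1 ⌊w⌋₊, Real.log a ^ 0 / (a : ℝ) * logSum 1 (w ^ 2 / a)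
      - logSum 1 w * logSum 0 w) := by
  -- Splitting `log(ab) = log a + log b` gives two convolutions, equal by symmetry. The argument
  -- `w²` makes the hyperbola cut at `w`.
  have h := sum_conv_eq (fun k => Real.log k ^ 1 / (k : ℝ)) (fun k => Real.log k ^ 0 / (k : ℝ)) (w ^ 2)
  have h' := sum_conv_eq (fun k => Real.log k ^ 0 / (k : ℝ)) (fun k => Real.log k ^ 1 / (k : ℝ)) (w ^ 2)
  rw [hyperbola, Real.sqrt_sq hw] at h h'
  simp only [logSum, divLogSum]
  rw [two_mul]
  nth_rw 1 [← h]
  rw [mul_comm (∑ k ∈ Finset.Icc 1 ⌊w⌋₊, Real.log k ^ 1 / (k : ℝ)), add_comm (∑ a ∈ Finset.Icc 1 ⌊w⌋₊, Real.log a ^ 1 / (a : ℝ) * _), ← h', ← Finset.sum_add_distrib]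
  refine Finset.sum_congr rfl fun n hn => ?_
  rw [card_divisors_eq_sum, Finset.sum_mul, ← Finset.sum_add_distrib]
  refine Finset.sum_congr rfl fun p hp => ?_
  obtain ⟨hp1, hp2⟩ := Nat.mem_divisorsAntidiagonal.1 hp
  rw [← hp1] at hp2
  have ha : (p.1 : ℝ) ≠ 0 := by exact_mod_cast left_ne_zero_of_mul hp2
  have hb : (p.2 : ℝ) ≠ 0 := by exact_mod_cast right_ne_zero_of_mul hp2
  rw [← hp1]
  push_cast
  rw [Real.log_mul ha hb]
  field_simp

theorem tendsto_divSum : Tendsto (fun w : ℝ => divSum (w ^ 2) -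
    (2 * Real.log w ^ 2 + 4 * Real.eulerMascheroniConstant * Real.log w +
      (Real.eulerMascheroniConstant ^ 2 - 2 * stieltjes 1))) atTop (nhds 0) := by
  have hR := (tendsto_sum_mul_logErr 0 0 (by norm_num) (by norm_num)).const_mul 2
  have e0 := tendsto_logErr 0 (by norm_num)
  have e1 := tendsto_logErr 1 (by norm_num)
  have e10 := tendsto_log_pow_mul_logErr 1 0 (by norm_num)
  have := (((hR.add (e10.const_mul 2)).sub (e1.const_mul 2)).sub (e0.mul e0))
  simp only [mul_zero, add_zero, sub_zero] at this
  refine this.congr' ?_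
  filter_upwards [eventually_ge_atTop 1] with w hw
  -- Expanding `log(w²/a) = 2 log w - log a` turns the main part into sums `logSum j w` again, and
  -- `logSum_eq` then applies a second time.
  have hS : ∑ a ∈ Finset.Icc 1 ⌊w⌋₊, Real.log a ^ 0 / (a : ℝ) * logSum 0 (w ^ 2 / a) =
      (2 * Real.log w + Real.eulerMascheroniConstant) * logSum 0 w - logSum 1 w +
      ∑ a ∈ Finset.Icc 1 ⌊w⌋₊, Real.log a ^ 0 / (a : ℝ) * logErr 0 (w ^ 2 / a) := by
    simp only [logSum, Finset.mul_sum, ← Finset.sum_add_distrib, ← Finset.sum_sub_distrib]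
    refine Finset.sum_congr rfl fun a ha => ?_
    have h := logSum_eq 0 (w ^ 2 / a)
    rw [log_sq_div (by linarith) (Finset.mem_Icc.1 ha).1] at h
    simp only [logSum] at h
    rw [← Finset.mul_sum, h]
    simp [stieltjesConst]
    ring
  rw [divSum_sq_eq (by linarith), hS, logSum_eq 0 w, logSum_eq 1 w]
  simp [stieltjesConst]
  ring

theorem tendsto_divLogSum : Tendsto (fun w : ℝ => divLogSum (w ^ 2) -
    (8 / 3 * Real.log w ^ 3 + 4 * Real.eulerMascheroniConstant * Real.log w ^ 2 +
      (2 * Real.eulerMascheroniConstant * stieltjes 1 - stieltjes 2))) atTop (nhds 0) := by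
  have hR := (tendsto_sum_mul_logErr 1 0 (by norm_num) (by norm_num)).const_mul 2
  have hR' := (tendsto_sum_mul_logErr 0 1 (by norm_num) (by norm_num)).const_mul 2
  have e0 := tendsto_logErr 0 (by norm_num)
  have e1 := tendsto_logErr 1 (by norm_num)
  have e2 := tendsto_logErr 2 (by norm_num)
  have e20 := tendsto_log_pow_mul_logErr 2 0 (by norm_num)
  have e11 := tendsto_log_pow_mul_logErr 1 1 (by norm_num)
  have := (((((hR.add hR').sub e2).add (e20.const_mul 3)).sub (e11.const_mul 2))).sub
    ((e0.mul e1).const_mul 2)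
  simp only [mul_zero, add_zero, sub_zero] at this
  refine this.congr' ?_
  filter_upwards [eventually_ge_atTop 1] with w hw
  have hS : ∑ a ∈ Finset.Icc 1 ⌊w⌋₊, Real.log a ^ 1 / (a : ℝ) * logSum 0 (w ^ 2 / a) =
      (2 * Real.log w + Real.eulerMascheroniConstant) * logSum 1 w - logSum 2 w +
      ∑ a ∈ Finset.Icc 1 ⌊w⌋₊, Real.log a ^ 1 / (a : ℝ) * logErr 0 (w ^ 2 / a) := by
    simp only [logSum, Finset.mul_sum, ← Finset.sum_add_distrib, ← Finset.sum_sub_distrib]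
    refine Finset.sum_congr rfl fun a ha => ?_
    have h := logSum_eq 0 (w ^ 2 / a)
    rw [log_sq_div (by linarith) (Finset.mem_Icc.1 ha).1] at h
    simp only [logSum] at h
    rw [← Finset.mul_sum, h]
    simp [stieltjesConst]
    ring
  have hS' : ∑ a ∈ Finset.Icc 1 ⌊w⌋₊, Real.log a ^ 0 / (a : ℝ) * logSum 1 (w ^ 2 / a) =
      (2 * Real.log w ^ 2 + stieltjes 1) * logSum 0 w - 2 * Real.log w * logSum 1 w + 1 / 2 * logSum 2 w +
      ∑ a ∈ Finset.Icc 1 ⌊w⌋₊, Real.log a ^ 0 / (a : ℝ) * logErr 1 (w ^ 2 / a) := by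
    simp only [logSum, Finset.mul_sum, ← Finset.sum_add_distrib, ← Finset.sum_sub_distrib]
    refine Finset.sum_congr rfl fun a ha => ?_
    have h := logSum_eq 1 (w ^ 2 / a)
    rw [log_sq_div (by linarith) (Finset.mem_Icc.1 ha).1] at h
    simp only [logSum] at h
    rw [← Finset.mul_sum, h]
    simp [stieltjesConst]
    ring
  rw [divLogSum_sq_eq (by linarith), hS, hS', logSum_eq 0 w, logSum_eq 1 w, logSum_eq 2 w]
  simp [stieltjesConst]
  ring

end WeightedDivisorSums

/-! ### Partial summation against the divisor problem remainder -/

section FourFold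

theorem T2_eq_sum_Icc_zero (t : ℝ) :
    ∑ k ∈ Finset.Icc 0 ⌊t⌋₊, (k.divisors.card : ℝ) = T2 t := by
  rw [T2, ← Finset.add_sum_Ioc_eq_sum_Icc (Nat.zero_le _)]
  simp
  rfl

theorem hasDerivAt_M2 {t : ℝ} (ht : 0 < t) :
    HasDerivAt M2 (Real.log t + 2 * Real.eulerMascheroniConstant) t := by
  have h := (hasDerivAt_id t).mul ((Real.hasDerivAt_log ht.ne').add_const kap)
  refine HasDerivAt.congr_deriv h ?_
  simp [kap]
  field_simp
  ring

theorem continuousOn_M2 {a b : ℝ} (ha : 0 < a) : ContinuousOn M2 (Set.Icc a b) :=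
  fun _ ht => (hasDerivAt_M2 (ha.trans_le ht.1)).continuousAt.continuousWithinAt

/-- Partial summation against the remainder in Dirichlet's divisor theorem. -/
theorem abs_sum_divisors_sub_le {f f' P K k : ℝ → ℝ} {a b : ℝ} (ha : 1 ≤ a) (hab : a ≤ b)
    (hf : ∀ t ∈ Set.Icc a b, HasDerivAt f (f' t) t) (hf' : ContinuousOn f' (Set.Icc a b))
    (hP : ∀ t ∈ Set.Icc a b,
      HasDerivAt P (f t * (Real.log t + 2 * Real.eulerMascheroniConstant)) t)
    (hK : ∀ t ∈ Set.Icc a b, HasDerivAt K (k t) t) (hk : ContinuousOn k (Set.Icc a b))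
    (hb : ∀ t ∈ Set.Icc a b, |f' t| * (√t + 1 / 4) ≤ k t) :
    |∑ n ∈ Finset.Ioc ⌊a⌋₊ ⌊b⌋₊, f n * (n.divisors.card : ℝ) - (P b - P a)
      - (f b * Δ b - f a * Δ a)| ≤ K b - K a := by
  have hderiv : ∀ t ∈ Set.Icc a b, deriv f t = f' t := fun t ht => (hf t ht).deriv
  have hint : MeasureTheory.IntegrableOn (deriv f) (Set.Icc a b) := by
    refine (hf'.integrableOn_Icc).congr_fun (fun t ht => (hderiv t ht).symm) measurableSet_Icc
  have habel := sum_mul_eq_sub_sub_integral_mul (fun n : ℕ => (n.divisors.card : ℝ)) (f := f)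
    (by linarith) hab (fun t ht => (hf t ht).differentiableAt) hint
  simp only [T2_eq_sum_Icc_zero] at habel
  have hI : MeasureTheory.IntegrableOn (fun t => deriv f t * T2 t) (Set.Icc a b) := by
    have := integrableOn_mul_sum_Icc (fun n : ℕ => (n.divisors.card : ℝ)) (m := 0) (a := a) (b := b)
      (by linarith) hint
    simpa only [T2_eq_sum_Icc_zero] using this
  have hI' : IntervalIntegrable (fun t => f' t * T2 t) MeasureTheory.volume a b := by
    rw [intervalIntegrable_iff_integrableOn_Icc_of_le hab]
    exact hI.congr_fun (fun t ht => by simp only [hderiv t ht]) measurableSet_Icc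
  have hM : IntervalIntegrable (fun t => f' t * M2 t) MeasureTheory.volume a b := by
    refine ContinuousOn.intervalIntegrable_of_Icc hab ?_
    exact hf'.mul (continuousOn_M2 (by linarith))
  have e1 : ∫ t in Set.Ioc a b, deriv f t * T2 t = ∫ t in a..b, f' t * T2 t := by
    rw [intervalIntegral.integral_of_le hab]
    exact MeasureTheory.setIntegral_congr_fun measurableSet_Ioc
      (fun t ht => by simp only [hderiv t (Set.Ioc_subset_Icc_self ht)])
  -- Integration by parts for the smooth part: `P' = f M2'`, so `f M2 - P` is an antiderivative of
  -- `f' M2`.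
  have e2 : ∫ t in a..b, f' t * M2 t = (f b * M2 b - P b) - (f a * M2 a - P a) := by
    refine intervalIntegral.integral_eq_sub_of_hasDerivAt (f := fun t => f t * M2 t - P t)
      (fun t ht => ?_) hM
    rw [Set.uIcc_of_le hab] at ht
    have := ((hf t ht).mul (hasDerivAt_M2 (by linarith [ht.1]))).sub (hP t ht)
    refine HasDerivAt.congr_deriv this ?_
    ring
  have e3 : ∫ t in a..b, f' t * Δ t = (∫ t in a..b, f' t * T2 t) - ∫ t in a..b, f' t * M2 t := by
    rw [← intervalIntegral.integral_sub hI' hM]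
    refine intervalIntegral.integral_congr fun t _ => ?_
    simp only [Δ]
    ring
  have e4 : ∫ t in a..b, k t = K b - K a := by
    refine intervalIntegral.integral_eq_sub_of_hasDerivAt (fun t ht => ?_)
      (hk.intervalIntegrable_of_Icc hab)
    rw [Set.uIcc_of_le hab] at ht
    exact hK t ht
  have e5 : |∫ t in a..b, f' t * Δ t| ≤ ∫ t in a..b, k t := by
    have := intervalIntegral.norm_integral_le_of_norm_le (μ := MeasureTheory.volume)
      (f := fun t => f' t * Δ t) (g := k) hab ?_ (hk.intervalIntegrable_of_Icc hab)
    · exact this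
    · refine Eventually.of_forall fun t ht => ?_
      have ht' := Set.Ioc_subset_Icc_self ht
      rw [Real.norm_eq_abs, abs_mul]
      refine le_trans ?_ (hb t ht')
      gcongr
      exact abs_Δ_le (ha.trans ht'.1)
  rw [habel, e1, ← e4]
  refine le_trans (le_of_eq ?_) e5
  rw [← abs_neg, e3, e2]
  simp only [Δ]
  congr 1
  ring

/-- This weights the errors `√(x/a)` in the estimate of `T4`. The constant `17/4 - 2γ` collects the
term `n = 1`, the values of `P`, `K` and `Δ` at `1`, and the leading `1` of `Δ(u)/√u`; the
contributions `1/(4√u)` cancel. -/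
theorem sum_divisors_div_sqrt_le {u : ℝ} (hu : 1 ≤ u) :
    ∑ n ∈ Finset.Icc 1 ⌊u⌋₊, (n.divisors.card : ℝ) * (1 / √(n : ℝ)) ≤
      √u * (2 * Real.log u + 4 * Real.eulerMascheroniConstant - 4) + 17 / 4
        - 2 * Real.eulerMascheroniConstant + Real.log u / 2 := by
  have pos : ∀ t ∈ Set.Icc 1 u, 0 < t := fun t ht => by linarith [ht.1]
  have hds : ∀ t : ℝ, 0 < t → HasDerivAt (fun t => 1 / √t) (-(1 / (2 * t * √t))) t := by
    intro t ht
    have h := (Real.hasDerivAt_sqrt ht.ne').inv (Real.sqrt_pos.2 ht).ne'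
    simp only [one_div]
    refine HasDerivAt.congr_deriv h ?_
    have h2 : √t ^ 2 = t := Real.sq_sqrt ht.le
    have h3 := Real.sqrt_pos.2 ht
    rw [h2]
    field_simp
  have hcs : ContinuousOn (fun t : ℝ => √t) (Set.Icc 1 u) := Real.continuous_sqrt.continuousOn
  have h := abs_sum_divisors_sub_le (f := fun t => 1 / √t) (f' := fun t => -(1 / (2 * t * √t)))
    (P := fun t => √t * (2 * Real.log t + 4 * Real.eulerMascheroniConstant - 4))
    (K := fun t => Real.log t / 2 - 1 / 4 * (1 / √t))
    (k := fun t => 1 / 2 * (1 / t) + 1 / 4 * (1 / (2 * t * √t))) le_rfl hu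
    (fun t ht => hds t (pos t ht)) ?_ ?_ ?_ ?_ ?_
  · have hΔu := (abs_le.1 (abs_Δ_le hu)).2
    have hT1 : T2 1 = 1 := by simp [T2]
    have hΔ1 : Δ 1 = 2 - 2 * Real.eulerMascheroniConstant := by
      rw [Δ, M2, kap, hT1]; simp; ring
    have hle := (abs_le.1 h).2
    simp only [Real.sqrt_one, Real.log_one, hΔ1, Nat.floor_one] at hle
    have hsum : ∑ n ∈ Finset.Icc 1 ⌊u⌋₊, (n.divisors.card : ℝ) * (1 / √(n : ℝ)) =
        1 + ∑ n ∈ Finset.Ioc 1 ⌊u⌋₊, 1 / √(n : ℝ) * (n.divisors.card : ℝ) := by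
      rw [← Finset.add_sum_Ioc_eq_sum_Icc (Nat.one_le_floor_iff _ |>.2 hu)]
      simp [mul_comm]
    have hs : 0 < √u := Real.sqrt_pos.2 (by linarith)
    have h5 : 1 / √u * Δ u ≤ 1 / √u * (√u + 1 / 4) := by gcongr
    have h6 : 1 / √u * (√u + 1 / 4) = 1 + 1 / 4 * (1 / √u) := by field_simp
    rw [hsum]
    linarith
  · refine ContinuousOn.neg (ContinuousOn.div continuousOn_const ?_ ?_)
    · exact (continuousOn_const.mul continuousOn_id).mul hcs
    · intro t ht
      have := pos t ht
      have := Real.sqrt_pos.2 this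
      positivity
  · intro t ht
    have ht0 := pos t ht
    have hs := Real.sqrt_pos.2 ht0
    have h1 := (Real.hasDerivAt_sqrt ht0.ne').mul
      ((((Real.hasDerivAt_log ht0.ne').const_mul 2).add_const
        (4 * Real.eulerMascheroniConstant)).sub_const 4)
    refine HasDerivAt.congr_deriv h1 ?_
    have h2 : t = √t ^ 2 := (Real.sq_sqrt ht0.le).symm
    have h3 : t⁻¹ = 1 / (√t ^ 2) := by rw [← h2, one_div]
    rw [h3]
    field_simp
    ring
  · intro t ht
    have ht0 := pos t ht
    have h1 := ((Real.hasDerivAt_log ht0.ne').div_const 2).sub ((hds t ht0).const_mul (1 / 4))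
    refine HasDerivAt.congr_deriv h1 ?_
    ring
  · refine ContinuousOn.add (continuousOn_const.mul (ContinuousOn.div continuousOn_const
      continuousOn_id fun t ht => (pos t ht).ne')) (continuousOn_const.mul
      (ContinuousOn.div continuousOn_const ((continuousOn_const.mul continuousOn_id).mul hcs) ?_))
    intro t ht
    have := pos t ht
    have := Real.sqrt_pos.2 this
    positivity
  · intro t ht
    have ht0 := pos t ht
    have hs := Real.sqrt_pos.2 ht0
    simp only [abs_neg]
    rw [abs_of_pos (by positivity), mul_add]
    have : 1 / (2 * t * √t) * √t = 1 / 2 * (1 / t) := by field_simp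
    rw [this]
    linarith

end FourFold

/-! ### The fourfold divisor sum `T4` -/

section Tail

local notation "γ" => Real.eulerMascheroniConstant

/-- Main term of `∑_{n ≤ W} d(n) (B - log n) / n`. -/
noncomputable def weightedMain (B W : ℝ) : ℝ :=
  B * (Real.log W ^ 2 / 2 + 2 * γ * Real.log W + (γ ^ 2 - 2 * stieltjes 1))
    - (Real.log W ^ 3 / 3 + γ * Real.log W ^ 2 + (2 * γ * stieltjes 1 - stieltjes 2))

/-- Remainder of `∑_{n ≤ W} d(n) (B - log n) / n` after removal of the main term and of the
boundary term of partial summation. -/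
noncomputable def weightedErr (B W : ℝ) : ℝ :=
  (∑ n ∈ Finset.Icc 1 ⌊W⌋₊, (B - Real.log n) / n * (n.divisors.card : ℝ)) - weightedMain B W
    - (B - Real.log W) / W * Δ W

/-- Antiderivative bounding the variation of `weightedErr`. -/
noncomputable def tailBound (B t : ℝ) : ℝ :=
  (4 - 2 * (B + 1 - Real.log t)) * (1 / √t) + 1 / 4 * ((1 - (B + 1 - Real.log t)) * (1 / t))

theorem hasDerivAt_tailBound (B : ℝ) {t : ℝ} (ht : 0 < t) :
    HasDerivAt (tailBound B) ((B + 1 - Real.log t) / t ^ 2 * (√t + 1 / 4)) t := by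
  have hs := Real.sqrt_pos.2 ht
  have hl : HasDerivAt (fun t => B + 1 - Real.log t) (-t⁻¹) t := by
    simpa using (Real.hasDerivAt_log ht.ne').const_sub (B + 1)
  have h1 := ((hl.const_mul 2).const_sub 4).mul ((Real.hasDerivAt_sqrt ht.ne').inv hs.ne')
  have h2 := ((hl.const_sub 1).mul (hasDerivAt_inv ht.ne')).const_mul (1 / 4)
  have h3 := h1.add h2
  have e : tailBound B = fun t => (4 - 2 * (B + 1 - Real.log t)) * (√t)⁻¹
      + 1 / 4 * ((1 - (B + 1 - Real.log t)) * t⁻¹) := by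
    funext t; simp only [tailBound, one_div]
  rw [e]
  refine HasDerivAt.congr_deriv h3 ?_
  obtain ⟨s, hs'⟩ : ∃ s, s = √t := ⟨_, rfl⟩
  have h4 : t = s ^ 2 := by rw [hs', Real.sq_sqrt ht.le]
  simp only [Pi.inv_apply]
  rw [← hs'] at hs ⊢
  rw [h4]
  field_simp
  ring

/-- The weight `(B - log t)/t` has derivative `-(B + 1 - log t)/t²`. On an interval where this keeps
one sign, recorded by `ε`, the integral of its absolute value against `√t + 1/4` is explicit. -/
theorem abs_weightedErr_sub_le {B W W' ε : ℝ} (hW : 1 ≤ W) (hWW : W ≤ W') (hε : ε = 1 ∨ ε = -1)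
    (hsign : ∀ t ∈ Set.Icc W W', 0 ≤ ε * (B + 1 - Real.log t)) :
    |weightedErr B W' - weightedErr B W| ≤ ε * tailBound B W' - ε * tailBound B W := by
  have pos : ∀ t ∈ Set.Icc W W', 0 < t := fun t ht => by linarith [ht.1]
  have hcl : ContinuousOn Real.log (Set.Icc W W') := fun t ht =>
    (Real.continuousAt_log (pos t ht).ne').continuousWithinAt
  have hcq : ContinuousOn (fun t => (B + 1 - Real.log t) / t ^ 2) (Set.Icc W W') :=
    ContinuousOn.div (continuousOn_const.sub hcl) (continuousOn_id.pow 2)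
      fun t ht => (pow_pos (pos t ht) 2).ne'
  have h := abs_sum_divisors_sub_le (f := fun t => (B - Real.log t) / t)
    (f' := fun t => -((B + 1 - Real.log t) / t ^ 2))
    (P := weightedMain B) (K := fun t => ε * tailBound B t)
    (k := fun t => ε * ((B + 1 - Real.log t) / t ^ 2 * (√t + 1 / 4))) hW hWW ?_ hcq.neg ?_ ?_ ?_ ?_
  · refine le_trans (le_of_eq ?_) h
    congr 1
    have : ∑ n ∈ Finset.Icc 1 ⌊W'⌋₊, (B - Real.log n) / n * (n.divisors.card : ℝ) =
        (∑ n ∈ Finset.Icc 1 ⌊W⌋₊, (B - Real.log n) / n * (n.divisors.card : ℝ)) +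
        ∑ n ∈ Finset.Ioc ⌊W⌋₊ ⌊W'⌋₊, (B - Real.log n) / n * (n.divisors.card : ℝ) := by
      have e : ∀ N, Finset.Icc 1 N = Finset.Ioc 0 N := fun N => rfl
      rw [e, e, Finset.sum_Ioc_consecutive _ (Nat.zero_le _) (Nat.floor_mono hWW)]
    simp only [weightedErr]
    rw [this]
    ring
  · intro t ht
    have ht0 := pos t ht
    have h1 := ((Real.hasDerivAt_log ht0.ne').const_sub B).div (hasDerivAt_id t) ht0.ne'
    refine HasDerivAt.congr_deriv h1 ?_
    simp only [id]
    field_simp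
    ring
  · intro t ht
    have ht0 := pos t ht
    have hl := Real.hasDerivAt_log ht0.ne'
    have h1 := (((((hl.pow 2).div_const 2).add (hl.const_mul (2 * γ))).add_const
      (γ ^ 2 - 2 * stieltjes 1)).const_mul B).sub
      ((((hl.pow 3).div_const 3).add ((hl.pow 2).const_mul γ)).add_const
      (2 * γ * stieltjes 1 - stieltjes 2))
    refine HasDerivAt.congr_deriv h1 ?_
    simp
    field_simp
  · exact fun t ht => (hasDerivAt_tailBound B (pos t ht)).const_mul ε
  · exact continuousOn_const.mul (hcq.mul
      ((Real.continuous_sqrt.add continuous_const).continuousOn))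
  · intro t ht
    have ht0 := pos t ht
    have : |(-((B + 1 - Real.log t) / t ^ 2))| = ε * ((B + 1 - Real.log t) / t ^ 2) := by
      rw [abs_neg, abs_div, abs_of_pos (a := t ^ 2) (by positivity), mul_div_assoc']
      congr 1
      have := hsign t ht
      rcases hε with rfl | rfl
      · rw [one_mul] at this ⊢; exact abs_of_nonneg this
      · rw [abs_of_nonpos (by linarith)]; ring
    simp only [this]
    exact le_of_eq (by ring)

/-- Here the constants in `weightedMain` are seen to be the right ones. Partial summation alone
determines the sum only up to an additive constant. -/
theorem tendsto_weightedErr (B : ℝ) :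
    Tendsto (fun w : ℝ => weightedErr B (w ^ 2)) atTop (nhds 0) := by
  have h1 := (tendsto_divSum.const_mul B).sub tendsto_divLogSum
  have h2 : Tendsto (fun w : ℝ => (B - Real.log (w ^ 2)) / w ^ 2 * Δ (w ^ 2)) atTop (nhds 0) := by
    have g := ((tendsto_log_pow_div 0 (p := 1) le_rfl).const_mul (2 * |B|)).add
      ((tendsto_log_pow_div 1 (p := 1) le_rfl).const_mul 4)
    simp only [mul_zero, add_zero] at g
    refine squeeze_zero_norm' ?_ g
    filter_upwards [eventually_ge_atTop 1] with w hw
    have hw0 : 0 < w := by linarith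
    have hl := Real.log_nonneg hw
    have hΔ := abs_Δ_le (t := w ^ 2) (by nlinarith)
    rw [Real.sqrt_sq hw0.le] at hΔ
    rw [Real.norm_eq_abs, abs_mul, abs_div, abs_of_pos (a := w ^ 2) (by positivity), Real.log_pow]
    have hn : |B - (2 : ℕ) * Real.log w| ≤ |B| + 2 * Real.log w := by
      refine (abs_sub _ _).trans ?_
      rw [abs_of_nonneg (a := ((2 : ℕ) : ℝ) * Real.log w) (by positivity)]
      norm_num
    calc _ ≤ (|B| + 2 * Real.log w) / w ^ 2 * (2 * w) := by
            gcongr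
            linarith
      _ = _ := by field_simp; ring
  have h3 := h1.sub h2
  simp only [mul_zero, sub_zero] at h3
  refine h3.congr' ?_
  filter_upwards [eventually_ge_atTop 1] with w hw
  have e : ∑ n ∈ Finset.Icc 1 ⌊w ^ 2⌋₊, (B - Real.log n) / n * (n.divisors.card : ℝ) =
      B * divSum (w ^ 2) - divLogSum (w ^ 2) := by
    rw [divSum, divLogSum, Finset.mul_sum, ← Finset.sum_sub_distrib]
    exact Finset.sum_congr rfl fun n _ => by ring
  simp only [weightedErr, weightedMain]
  rw [e, Real.log_pow]
  push_cast
  ring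

theorem tendsto_tailBound (B : ℝ) :
    Tendsto (fun w : ℝ => tailBound B (w ^ 2)) atTop (nhds 0) := by
  have g0 := tendsto_log_pow_div 0 (p := 1) le_rfl
  have g1 := tendsto_log_pow_div 1 (p := 1) le_rfl
  have g2 := tendsto_log_pow_div 0 (p := 2) (by norm_num)
  have g3 := tendsto_log_pow_div 1 (p := 2) (by norm_num)
  have := ((g0.const_mul (2 - 2 * B)).add (g1.const_mul 4)).add
    ((g2.const_mul (-B / 4)).add (g3.const_mul (1 / 2)))
  simp only [mul_zero, add_zero] at this
  refine this.congr' ?_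
  filter_upwards [eventually_ge_atTop 1] with w hw
  rw [tailBound, Real.sqrt_sq (by linarith), Real.log_pow]
  push_cast
  ring

/-- The remainder vanishes at infinity, so it is bounded by its total variation on `[W, ∞)`. The
derivative of the weight changes sign at `V = exp(B + 1)`: up to `V` the variation is at most
`tailBound V - tailBound W`, beyond `V` at most `tailBound V`. -/
theorem abs_weightedErr_le {B W : ℝ} (hW : 1 ≤ W) (hWB : Real.log W ≤ B + 1) :
    |weightedErr B W| ≤ 2 * tailBound B (Real.exp (B + 1)) - tailBound B W := by
  set V := Real.exp (B + 1) with hV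
  have hWV : W ≤ V := by
    rw [hV, ← Real.exp_log (show 0 < W by linarith)]
    exact Real.exp_le_exp.2 hWB
  have h1 := abs_weightedErr_sub_le (B := B) hW hWV (Or.inl rfl) (fun t ht => by
    have : Real.log t ≤ B + 1 := (Real.log_le_iff_le_exp (by linarith [ht.1])).2 ht.2
    linarith)
  have h2 : ∀ᶠ w : ℝ in atTop, |weightedErr B W| ≤ |weightedErr B (w ^ 2)| +
      (2 * tailBound B V - tailBound B W - tailBound B (w ^ 2)) := by
    filter_upwards [eventually_ge_atTop (max 1 V)] with w hw
    have hw1 : 1 ≤ w := (le_max_left _ _).trans hw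
    have hwV : V ≤ w ^ 2 := ((le_max_right _ _).trans hw).trans (by nlinarith)
    have h3 := abs_weightedErr_sub_le (B := B) (hW.trans hWV) hwV (Or.inr rfl) (fun t ht => by
      have : B + 1 ≤ Real.log t := by
        rw [Real.le_log_iff_exp_le (by linarith [ht.1])]; exact ht.1
      linarith)
    have h4 : |weightedErr B W| ≤ |weightedErr B (w ^ 2)| + |weightedErr B (w ^ 2) - weightedErr B V|
        + |weightedErr B V - weightedErr B W| := by
      have := abs_sub_abs_le_abs_sub (weightedErr B W) (weightedErr B (w ^ 2))
      have h5 := abs_sub_le (weightedErr B W) (weightedErr B V) (weightedErr B (w ^ 2))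
      rw [abs_sub_comm (weightedErr B W) (weightedErr B V),
        abs_sub_comm (weightedErr B V) (weightedErr B (w ^ 2))] at h5
      linarith
    linarith
  have h3 := (tendsto_weightedErr B).abs.add
    ((tendsto_const_nhds (x := 2 * tailBound B V - tailBound B W)).sub (tendsto_tailBound B))
  rw [abs_zero, zero_add, sub_zero] at h3
  exact ge_of_tendsto h3 h2

/-- `∑_{ab ≤ x} d(a) d(b)`. -/
noncomputable def T4 (x : ℝ) : ℝ :=
  ∑ a ∈ Finset.Icc 1 ⌊x⌋₊, (a.divisors.card : ℝ) * T2 (x / a)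

/-- Main term of `T4 x`, divided by `x`, as a function of `log x`. -/
noncomputable def P4 (L : ℝ) : ℝ := C1 * L ^ 3 + C2 * L ^ 2 + C3 * L + C4

theorem T4_eq (x : ℝ) : T4 x =
    2 * ∑ a ∈ Finset.Icc 1 ⌊√x⌋₊, (a.divisors.card : ℝ) * T2 (x / a) - T2 √x ^ 2 := by
  have h := hyperbola (fun n => (n.divisors.card : ℝ)) (fun n => (n.divisors.card : ℝ)) x
  simp only [T4, T2] at h ⊢
  rw [h]
  ring

/-- With `x = w⁴`, the main term of `T2(x/a)` is `x (B - log a)/a` for `B = log x + kap`. The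
boundary term of the weighted sum cancels the cross term `2 M2 Δ` of `T2(√x)²` exactly, leaving only
`Δ²`; the remaining main terms assemble to `P4`, which explains the values of `C1`, ..., `C4`. -/
theorem T4_main_identity {w : ℝ} (hw : 1 ≤ w) :
    T4 (w ^ 4) - w ^ 4 * P4 (4 * Real.log w) =
      2 * w ^ 4 * weightedErr (4 * Real.log w + kap) (w ^ 2) - Δ (w ^ 2) ^ 2
      + 2 * ∑ a ∈ Finset.Icc 1 ⌊w ^ 2⌋₊, (a.divisors.card : ℝ) * Δ (w ^ 4 / a) := by
  have hw0 : 0 < w := by linarith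
  have hs : √(w ^ 4) = w ^ 2 := by
    rw [show w ^ 4 = (w ^ 2) ^ 2 by ring, Real.sqrt_sq (by positivity)]
  have hsum : ∑ a ∈ Finset.Icc 1 ⌊w ^ 2⌋₊, (a.divisors.card : ℝ) * T2 (w ^ 4 / a) =
      w ^ 4 * (∑ n ∈ Finset.Icc 1 ⌊w ^ 2⌋₊,
        (4 * Real.log w + kap - Real.log n) / n * (n.divisors.card : ℝ)) +
      ∑ a ∈ Finset.Icc 1 ⌊w ^ 2⌋₊, (a.divisors.card : ℝ) * Δ (w ^ 4 / a) := by
    rw [Finset.mul_sum, ← Finset.sum_add_distrib]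
    refine Finset.sum_congr rfl fun a ha => ?_
    have ha1 : (a : ℝ) ≠ 0 := by
      have := (Finset.mem_Icc.1 ha).1
      positivity
    rw [Δ, M2, Real.log_div (by positivity) ha1, Real.log_pow]
    push_cast
    ring
  rw [T4_eq, hs, hsum]
  have e : ∑ n ∈ Finset.Icc 1 ⌊w ^ 2⌋₊,
        (4 * Real.log w + kap - Real.log n) / n * (n.divisors.card : ℝ) =
      weightedErr (4 * Real.log w + kap) (w ^ 2) + weightedMain (4 * Real.log w + kap) (w ^ 2)
        + (4 * Real.log w + kap - Real.log (w ^ 2)) / w ^ 2 * Δ (w ^ 2) := by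
    rw [weightedErr]; ring
  have eT : T2 (w ^ 2) = M2 (w ^ 2) + Δ (w ^ 2) := by rw [Δ]; ring
  rw [e, eT, weightedMain, M2, Real.log_pow, P4, C1, C2, C3, C4, kap]
  push_cast
  field_simp
  ring

theorem exp_neg_gamma_le : Real.exp (-γ) ≤ 0.574 := by
  obtain ⟨h1, h2⟩ := eulerMascheroni_bounds
  have h3 := Real.quadratic_le_exp_of_nonneg (x := γ) (by linarith)
  rw [Real.exp_neg, inv_le_comm₀ (Real.exp_pos _) (by norm_num)]
  nlinarith

/-- The weighted remainder and the sum of the `Δ(x/a)` each contribute `2w³(4 log w + 4γ - 4)`, and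
`4 - 4γ > 1.691`. At order `w²` the constants add up to `7.5 - 2γ + 16 exp(-γ)`, plus `1` from
`Δ(w²)²`, which is below `16.6`. -/
theorem abs_T4_sub_le {w : ℝ} (hw : 1 ≤ w) :
    |T4 (w ^ 4) - w ^ 4 * P4 (4 * Real.log w)| ≤
      4 * w ^ 3 * (4 * Real.log w - 1.691) + w ^ 2 * (4 * Real.log w + 16.6) + w + 0.52 := by
  have hw0 : 0 < w := by linarith
  have hl := Real.log_nonneg hw
  obtain ⟨g1, g2⟩ := eulerMascheroni_bounds
  have hg := exp_neg_gamma_le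
  have hg0 := Real.exp_pos (-γ)
  have hs2 : √(w ^ 2) = w := Real.sqrt_sq hw0.le
  have hw2 : 1 ≤ w ^ 2 := one_le_pow₀ hw
  have hΔ := abs_Δ_le hw2
  rw [hs2] at hΔ
  have hΔsq : Δ (w ^ 2) ^ 2 ≤ (w + 1 / 4) ^ 2 := sq_le_sq' (abs_le.1 hΔ).1 (abs_le.1 hΔ).2
  have hE := abs_weightedErr_le (B := 4 * Real.log w + kap) hw2 (by
    rw [Real.log_pow, kap]; push_cast; linarith)
  -- At the sign change the factor `B + 1 - log t` vanishes and `√t = w² exp γ`.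
  have hV : tailBound (4 * Real.log w + kap) (Real.exp (4 * Real.log w + kap + 1)) =
      4 * (Real.exp (-γ) / w ^ 2) + 1 / 4 * (Real.exp (-γ) ^ 2 / w ^ 4) := by
    have e1 : Real.exp (4 * Real.log w + kap + 1) = (w ^ 2 * Real.exp γ) ^ 2 := by
      rw [kap, show 4 * Real.log w + (2 * γ - 1) + 1 = ((4 : ℕ) : ℝ) * Real.log w + ((2 : ℕ) : ℝ) * γ by
        push_cast; ring, Real.exp_add, Real.exp_nat_mul, Real.exp_nat_mul, Real.exp_log hw0]
      ring
    have e2 : Real.log ((w ^ 2 * Real.exp γ) ^ 2) = 4 * Real.log w + kap + 1 := by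
      rw [← e1, Real.log_exp]
    rw [tailBound, e1, Real.sqrt_sq (by positivity), e2, Real.exp_neg]
    have := Real.exp_pos γ
    field_simp
    ring
  rw [hV, tailBound, hs2, Real.log_pow, kap] at hE
  rw [← kap] at hE
  have hE2 : 2 * w ^ 4 * |weightedErr (4 * Real.log w + kap) (w ^ 2)| ≤
      2 * w ^ 3 * (4 * Real.log w + 4 * γ - 4) + w ^ 2 / 2 * (2 * Real.log w + 2 * γ - 1)
      + 16 * w ^ 2 * Real.exp (-γ) + Real.exp (-γ) ^ 2 := by
    have h5 := mul_le_mul_of_nonneg_left hE (show 0 ≤ 2 * w ^ 4 by positivity)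
    refine h5.trans (le_of_eq ?_)
    rw [kap]
    push_cast
    field_simp
    ring
  have hQ := sum_divisors_div_sqrt_le hw2
  rw [hs2, Real.log_pow] at hQ
  push_cast at hQ
  have hT : T2 (w ^ 2) ≤ w ^ 2 * (2 * Real.log w + kap) + w + 1 / 4 := by
    have h6 : T2 (w ^ 2) = M2 (w ^ 2) + Δ (w ^ 2) := by rw [Δ]; ring
    have h7 := (abs_le.1 hΔ).2
    rw [h6, M2, Real.log_pow]
    push_cast
    linarith
  have hS : |∑ a ∈ Finset.Icc 1 ⌊w ^ 2⌋₊, (a.divisors.card : ℝ) * Δ (w ^ 4 / a)| ≤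
      w ^ 2 * (∑ n ∈ Finset.Icc 1 ⌊w ^ 2⌋₊, (n.divisors.card : ℝ) * (1 / √(n : ℝ)))
        + 1 / 4 * T2 (w ^ 2) := by
    rw [T2, Finset.mul_sum, Finset.mul_sum, ← Finset.sum_add_distrib]
    refine (Finset.abs_sum_le_sum_abs _ _).trans (Finset.sum_le_sum fun a ha => ?_)
    rw [Finset.mem_Icc] at ha
    have ha1 : (1 : ℝ) ≤ a := by exact_mod_cast ha.1
    have haw : (a : ℝ) ≤ w ^ 2 := (Nat.le_floor_iff (by positivity)).1 ha.2
    have h8 : 1 ≤ w ^ 4 / a := by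
      rw [le_div_iff₀ (by linarith)]; nlinarith
    have h9 := abs_Δ_le h8
    have h10 : √(w ^ 4 / a) = w ^ 2 * (1 / √(a : ℝ)) := by
      rw [Real.sqrt_div (by positivity), show w ^ 4 = (w ^ 2) ^ 2 by ring,
        Real.sqrt_sq (by positivity)]
      ring
    rw [h10] at h9
    rw [abs_mul, abs_of_nonneg (Nat.cast_nonneg (α := ℝ) _)]
    calc _ ≤ (a.divisors.card : ℝ) * (w ^ 2 * (1 / √(a : ℝ)) + 1 / 4) := by gcongr
      _ = _ := by ring
  have hQ' := mul_le_mul_of_nonneg_left hQ (show 0 ≤ w ^ 2 by positivity)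
  rw [T4_main_identity hw]
  have htri : ∀ A B C : ℝ, |A - B + C| ≤ |A| + |B| + |C| := fun A B C =>
    (abs_add_le _ _).trans (by gcongr; exact abs_sub _ _)
  refine (htri _ _ _).trans ?_
  rw [abs_mul, abs_of_pos (a := 2 * w ^ 4) (by positivity), abs_of_nonneg (sq_nonneg (Δ (w ^ 2))),
    abs_mul 2, abs_two]
  have hexp2 : Real.exp (-γ) ^ 2 ≤ 0.574 ^ 2 := by gcongr
  have hexp1 : w ^ 2 * Real.exp (-γ) ≤ w ^ 2 * 0.574 := by gcongr
  have hw3 : 0 < w ^ 3 := by positivity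
  have hgw3 : w ^ 3 * γ ≤ w ^ 3 * 0.577219 := by gcongr
  have hgw2 : w ^ 2 * 0.577212 ≤ w ^ 2 * γ := by gcongr
  rw [kap] at hT
  rw [kap] at hE2 ⊢
  nlinarith

end Tail

/-! ### From `d * d` to `d²` by Möbius inversion -/

section Convolution

open ArithmeticFunction ArithmeticFunction.sigma ArithmeticFunction.Moebius

/-- Indicator function of the positive squares. -/
noncomputable def squareInd : ArithmeticFunction ℕ :=
  ⟨fun n => if IsSquare n ∧ n ≠ 0 then 1 else 0, by simp⟩

theorem squareInd_apply {n : ℕ} (hn : n ≠ 0) : squareInd n = if IsSquare n then 1 else 0 := by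
  simp [squareInd, hn]

theorem isSquare_of_coprime_mul {m n : ℕ} (h : m.Coprime n) (hs : IsSquare (m * n)) :
    IsSquare m := by
  obtain ⟨c, hc⟩ := hs
  obtain ⟨d, hd⟩ := exists_eq_pow_of_mul_eq_pow (a := m) (b := n) (c := c) (k := 2)
    (by rw [show GCDMonoid.gcd m n = 1 from h]; exact isUnit_one) (by rw [hc, sq])
  exact ⟨d, by rw [hd, sq]⟩

theorem isMultiplicative_squareInd : squareInd.IsMultiplicative := by
  refine IsMultiplicative.iff_ne_zero.2 ⟨by simp [squareInd], fun {m n} hm hn h => ?_⟩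
  rw [squareInd_apply (Nat.mul_ne_zero hm hn), squareInd_apply hm, squareInd_apply hn]
  by_cases h1 : IsSquare m <;> by_cases h2 : IsSquare n
  · simp [h1, h2, h1.mul h2]
  · have : ¬ IsSquare (m * n) := fun h3 => h2 (isSquare_of_coprime_mul h.symm (mul_comm m n ▸ h3))
    simp [h2, this]
  · have : ¬ IsSquare (m * n) := fun h3 => h1 (isSquare_of_coprime_mul h h3)
    simp [h1, this]
  · have : ¬ IsSquare (m * n) := fun h3 => h1 (isSquare_of_coprime_mul h h3)
    simp [h1, this]

theorem mul_apply_prime_pow (f g : ArithmeticFunction ℕ) {p : ℕ} (hp : p.Prime) (i : ℕ) :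
    (f * g) (p ^ i) = ∑ j ∈ Finset.range (i + 1), f (p ^ j) * g (p ^ (i - j)) := by
  rw [ArithmeticFunction.mul_apply, Nat.sum_divisorsAntidiagonal (fun a b => f a * g b),
    Nat.sum_divisors_prime_pow hp]
  refine Finset.sum_congr rfl fun j hj => ?_
  rw [Nat.pow_div (by rw [Finset.mem_range] at hj; omega) hp.pos]

theorem isSquare_prime_pow_iff {p : ℕ} (hp : p.Prime) (j : ℕ) : IsSquare (p ^ j) ↔ Even j := by
  constructor
  · rintro ⟨c, hc⟩
    have hcp : c ∣ p ^ j := ⟨c, hc⟩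
    obtain ⟨k, _, rfl⟩ := (Nat.dvd_prime_pow hp).1 hcp
    rw [← pow_add] at hc
    exact ⟨k, Nat.pow_right_injective hp.two_le hc⟩
  · rintro ⟨k, rfl⟩
    exact ⟨p ^ k, by rw [pow_add]⟩

theorem sum_range_sub_add_one (i : ℕ) :
    2 * ∑ j ∈ Finset.range (i + 1), (i - j + 1) = (i + 1) * (i + 2) := by
  induction i with
  | zero => simp
  | succ i ih =>
    rw [Finset.sum_range_succ', mul_add]
    simp only [Nat.add_sub_add_right, ih]
    simp
    ring

theorem sum_range_mul_sub (i : ℕ) :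
    6 * ∑ j ∈ Finset.range (i + 1), (j + 1) * (i - j + 1) = (i + 1) * (i + 2) * (i + 3) := by
  induction i with
  | zero => simp
  | succ i ih =>
    have h := sum_range_sub_add_one i
    rw [Finset.sum_range_succ']
    have e : ∑ j ∈ Finset.range (i + 1), (j + 1 + 1) * (i + 1 - (j + 1) + 1) =
        ∑ j ∈ Finset.range (i + 1), (j + 1) * (i - j + 1)
        + ∑ j ∈ Finset.range (i + 1), (i - j + 1) := by
      rw [← Finset.sum_add_distrib]
      refine Finset.sum_congr rfl fun j _ => ?_
      rw [Nat.add_sub_add_right]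
      ring
    rw [e]
    simp
    nlinarith

/-- With `sum_range_mul_sub` this is the convolution identity at a prime power: both local factors
equal the binomial coefficient `(i + 3 choose 3)`. Removing `j = 0, 1` lowers `i` by two, hence the
two-step induction. -/
theorem sum_range_even_sq (i : ℕ) :
    6 * ∑ j ∈ Finset.range (i + 1), (if Even j then 1 else 0) * (i - j + 1) ^ 2 =
      (i + 1) * (i + 2) * (i + 3) := by
  induction i using Nat.twoStepInduction with
  | zero => rfl
  | one => simp [Finset.sum_range_succ]
  | more i ih _ =>
    rw [Finset.sum_range_succ', Finset.sum_range_succ']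
    have e : ∀ j, i + 2 - (j + 1 + 1) = i - j := fun j => by omega
    simp only [e, Nat.even_add_one, not_not]
    simp
    simp at ih
    nlinarith

/-- The convolution identity behind `∑ d(n)² n^{-s} = ζ(s)⁴ / ζ(2s)`. -/
theorem squareInd_mul_sigma_sq : squareInd * (σ 0).ppow 2 = σ 0 * σ 0 := by
  have hσ : (σ 0).IsMultiplicative := isMultiplicative_sigma
  refine (IsMultiplicative.eq_iff_eq_on_prime_powers _ (isMultiplicative_squareInd.mul hσ.ppow) _
    (hσ.mul hσ)).2 fun p i hp => ?_
  rw [mul_apply_prime_pow _ _ hp, mul_apply_prime_pow _ _ hp]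
  have h1 := sum_range_even_sq i
  have h2 := sum_range_mul_sub i
  simp only [ppow_apply two_pos, sigma_zero_apply_prime_pow hp,
    squareInd_apply (pow_ne_zero _ hp.ne_zero), isSquare_prime_pow_iff hp]
  linarith

theorem T4_eq_sum_squares (x : ℝ) :
    T4 x = ∑ m ∈ Finset.Icc 1 ⌊√x⌋₊, sumSqDivisors (x / (m : ℝ) ^ 2) := by
  have h1 := sum_conv_eq (fun n => (n.divisors.card : ℝ)) (fun n => (n.divisors.card : ℝ)) x
  have h2 := sum_conv_eq (fun n => (squareInd n : ℝ)) (fun n => (n.divisors.card : ℝ) ^ 2) x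
  have h3 : T4 x = ∑ a ∈ Finset.Icc 1 ⌊x⌋₊, (squareInd a : ℝ) * sumSqDivisors (x / a) := by
    simp only [T4, T2, sumSqDivisors]
    rw [← h1, ← h2]
    refine Finset.sum_congr rfl fun n _ => ?_
    have := congrArg (fun f : ArithmeticFunction ℕ => ((f n : ℕ) : ℝ)) squareInd_mul_sigma_sq
    simp only [ArithmeticFunction.mul_apply, ppow_apply two_pos, sigma_zero_apply] at this
    push_cast at this
    exact this.symm
  rw [h3]
  symm
  refine Finset.sum_of_injOn (fun m => m ^ 2) ?_ ?_ ?_ ?_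
  · intro a _ b _ h
    exact Nat.pow_left_injective (by norm_num) h
  · intro m hm
    simp only [Finset.coe_Icc, Set.mem_Icc] at hm ⊢
    have hx : 0 ≤ x := by
      by_contra hx
      rw [Real.sqrt_eq_zero_of_nonpos (by linarith)] at hm
      simp at hm
      omega
    refine ⟨Nat.one_le_pow _ _ hm.1, Nat.le_floor ?_⟩
    have := (Nat.le_floor_iff (Real.sqrt_nonneg x)).1 hm.2
    push_cast
    rw [← Real.sq_sqrt hx]
    gcongr
  · intro n hn hn'
    have hn1 := (Finset.mem_Icc.1 hn).1
    rw [squareInd_apply (by omega), if_neg]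
    · simp
    · rintro ⟨c, rfl⟩
      refine hn' ⟨c, ?_, by simp [sq]⟩
      rw [Finset.mem_Icc] at hn
      have hx : 0 ≤ x := by
        by_contra hx
        rw [Nat.floor_of_nonpos (by linarith)] at hn
        omega
      have hc := (Nat.le_floor_iff hx).1 hn.2
      rw [Finset.coe_Icc, Set.mem_Icc]
      refine ⟨Nat.pos_of_ne_zero (by rintro rfl; simp at hn1), Nat.le_floor ?_⟩
      refine Real.le_sqrt_of_sq_le ?_
      push_cast at hc
      rw [sq]
      exact hc
  · intro m hm
    have hm1 := (Finset.mem_Icc.1 hm).1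
    rw [squareInd_apply (by positivity), if_pos ⟨m, sq m⟩]
    push_cast
    ring

/-- Inversion of `T4_eq_sum_squares`. -/
theorem sumSqDivisors_eq_sum_moebius {x : ℝ} (hx : 1 ≤ x) :
    sumSqDivisors x = ∑ l ∈ Finset.Icc 1 ⌊√x⌋₊, (μ l : ℝ) * T4 (x / (l : ℝ) ^ 2) := by
  -- The pairs `(l, b)` with `lb ≤ √x` are grouped by `n = lb`. The summand depends on `b` only
  -- through `n`, so `∑ μ(l)` over `l ∣ n` leaves `n = 1` alone.
  have h := sum_divisorsAntidiagonal_eq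
    (fun a b => (μ a : ℝ) * sumSqDivisors (x / ((a * b : ℕ) : ℝ) ^ 2)) ⌊√x⌋₊
  have h1 : ∀ l ∈ Finset.Icc 1 ⌊√x⌋₊, (μ l : ℝ) * T4 (x / (l : ℝ) ^ 2) =
      ∑ b ∈ Finset.Icc 1 (⌊√x⌋₊ / l), (μ l : ℝ) * sumSqDivisors (x / ((l * b : ℕ) : ℝ) ^ 2) := by
    intro l hl
    have hs : √(x / (l : ℝ) ^ 2) = √x / l := by
      rw [Real.sqrt_div (by linarith), Real.sqrt_sq (Nat.cast_nonneg l)]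
    rw [T4_eq_sum_squares, hs, Nat.floor_div_natCast, Finset.mul_sum]
    refine Finset.sum_congr rfl fun b _ => ?_
    congr 2
    push_cast
    rw [mul_pow, div_div]
  rw [Finset.sum_congr rfl h1, ← h]
  have h2 : ∀ n ∈ Finset.Icc 1 ⌊√x⌋₊, ∑ p ∈ n.divisorsAntidiagonal,
      (μ p.1 : ℝ) * sumSqDivisors (x / ((p.1 * p.2 : ℕ) : ℝ) ^ 2) =
      if n = 1 then sumSqDivisors x else 0 := by
    intro n _
    have e : ∑ p ∈ n.divisorsAntidiagonal,
        (μ p.1 : ℝ) * sumSqDivisors (x / ((p.1 * p.2 : ℕ) : ℝ) ^ 2) =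
        (∑ p ∈ n.divisorsAntidiagonal, (μ p.1 : ℝ)) * sumSqDivisors (x / (n : ℝ) ^ 2) := by
      rw [Finset.sum_mul]
      refine Finset.sum_congr rfl fun p hp => ?_
      rw [(Nat.mem_divisorsAntidiagonal.1 hp).1]
    have hμ := congrArg (fun f : ArithmeticFunction ℤ => ((f n : ℤ) : ℝ)) moebius_mul_coe_zeta
    simp only [coe_mul_zeta_apply, one_apply] at hμ
    rw [e, Nat.sum_divisorsAntidiagonal (fun a _ => (μ a : ℝ))]
    push_cast at hμ
    rw [hμ]
    split_ifs with h1
    · subst h1; simp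
    · simp
  rw [Finset.sum_congr rfl h2, Finset.sum_ite_eq', if_pos]
  rw [Finset.mem_Icc]
  exact ⟨le_rfl, Nat.one_le_floor_iff _ |>.2 (Real.one_le_sqrt.2 hx)⟩

end Convolution

/-! ### Derivatives of `H` at 1 as Möbius series -/

section MoebiusSeries

open ArithmeticFunction ArithmeticFunction.Moebius LSeries

theorem hasDerivAt_LSeries_logMul {f : ℕ → ℂ} (k : ℕ) {s : ℂ}
    (h : abscissaOfAbsConv f < s.re) :
    HasDerivAt (LSeries (logMul^[k] f)) (-LSeries (logMul^[k + 1] f) s) s := by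
  rw [Function.iterate_succ_apply']
  exact LSeries_hasDerivAt (by rwa [absicssaOfAbsConv_logPowMul])

theorem iterate_logMul_apply (f : ℕ → ℂ) (k n : ℕ) :
    logMul^[k] f n = (Real.log n : ℂ) ^ k * f n := by
  induction k generalizing f with
  | zero => simp
  | succ k ih =>
    rw [Function.iterate_succ_apply, ih, logMul, Complex.natCast_log]
    ring

/-- `∑ log^k n · a(n) / n²` as a value of an `L`-series. -/
theorem hasSum_logMul_two {f : ℕ → ℂ} {a : ℕ → ℝ} (hfa : ∀ n, n ≠ 0 → f n = (a n : ℂ)) (k : ℕ)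
    (h : abscissaOfAbsConv f < (2 : ℂ).re) :
    ∃ c : ℝ, LSeries (logMul^[k] f) 2 = (c : ℂ) ∧
      HasSum (fun n : ℕ => a n * Real.log n ^ k / (n : ℝ) ^ 2) c := by
  have hsum : LSeriesSummable (logMul^[k] f) 2 :=
    LSeriesSummable_of_abscissaOfAbsConv_lt_re (by rwa [absicssaOfAbsConv_logPowMul])
  have hs := hsum.LSeriesHasSum
  rw [LSeriesHasSum] at hs
  have e : term (logMul^[k] f) 2 = fun n : ℕ => ((a n * Real.log n ^ k / (n : ℝ) ^ 2 : ℝ) : ℂ) := by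
    funext n
    rcases eq_or_ne n 0 with rfl | hn
    · simp [term]
    · rw [term_of_ne_zero hn, iterate_logMul_apply, hfa n hn]
      have : (n : ℂ) ^ (2 : ℂ) = (n : ℂ) ^ 2 := by norm_cast
      rw [this]
      push_cast
      ring
  have hre := (Complex.hasSum_re hs)
  rw [e] at hre hs
  simp only [Complex.ofReal_re] at hre
  refine ⟨_, ?_, hre⟩
  exact hs.unique (Complex.hasSum_ofReal.2 hre)

theorem H_eq_LSeries {s : ℂ} (hs : 1 / 2 < s.re) : H s = LSeries (fun n => (μ n : ℂ)) (2 * s) := by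
  have h2 : 1 < (2 * s).re := by simp; linarith
  have h := LSeries_zeta_mul_Lseries_moebius h2
  rw [LSeries_zeta_eq_riemannZeta h2] at h
  rw [H, one_div]
  exact (eq_inv_of_mul_eq_one_right h).symm

theorem isOpen_re_gt (c : ℝ) : IsOpen {s : ℂ | c < s.re} :=
  isOpen_lt continuous_const Complex.continuous_re

theorem abscissa_moebius_lt {s : ℂ} (hs : 1 < s.re) :
    abscissaOfAbsConv (fun n => (μ n : ℂ)) < s.re := by
  rw [abscissaOfAbsConv_moebius]
  exact_mod_cast hs

theorem iteratedDeriv_H (k : ℕ) : ∀ {s : ℂ}, 1 / 2 < s.re →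
    iteratedDeriv k H s = (-2) ^ k * LSeries (logMul^[k] fun n => (μ n : ℂ)) (2 * s) := by
  induction k with
  | zero => intro s hs; simpa using H_eq_LSeries hs
  | succ k ih =>
    intro s hs
    rw [iteratedDeriv_succ]
    have hev : iteratedDeriv k H =ᶠ[nhds s]
        fun s => (-2) ^ k * LSeries (logMul^[k] fun n => (μ n : ℂ)) (2 * s) := by
      filter_upwards [(isOpen_re_gt (1 / 2)).mem_nhds hs] with z hz using ih hz
    rw [hev.deriv_eq]
    have h2 : 1 < (2 * s).re := by simp; linarith
    have hd := (hasDerivAt_LSeries_logMul k (abscissa_moebius_lt h2)).comp s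
      ((hasDerivAt_id s).const_mul 2)
    have := hd.const_mul ((-2) ^ k)
    simp only [mul_one] at this
    refine this.deriv.trans ?_
    rw [pow_succ]
    ring

/-- `∑ μ(n) log^k n / n²`. -/
noncomputable def moebiusLog (k : ℕ) : ℝ := ∑' n : ℕ, (μ n : ℝ) * Real.log n ^ k / (n : ℝ) ^ 2

theorem moebiusLog_spec (k : ℕ) :
    LSeries (logMul^[k] fun n => (μ n : ℂ)) 2 = (moebiusLog k : ℂ) ∧
      HasSum (fun n : ℕ => (μ n : ℝ) * Real.log n ^ k / (n : ℝ) ^ 2) (moebiusLog k) := by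
  obtain ⟨c, h1, h2⟩ := hasSum_logMul_two (f := fun n => (μ n : ℂ)) (a := fun n => (μ n : ℝ))
    (fun n _ => by push_cast; rfl) k (abscissa_moebius_lt (by simp))
  have : moebiusLog k = c := h2.tsum_eq
  rw [this]
  exact ⟨h1, h2⟩

theorem Hder_eq (k : ℕ) : Hder k = (-2) ^ k * moebiusLog k := by
  rw [Hder, iteratedDeriv_H k (by simp; norm_num), mul_one, (moebiusLog_spec k).1]
  norm_cast

theorem abscissa_one_lt {s : ℂ} (hs : 1 < s.re) : abscissaOfAbsConv (1 : ℕ → ℂ) < s.re := by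
  rw [abscissaOfAbsConv_one]
  exact_mod_cast hs

theorem zetaLog_spec (k : ℕ) :
    LSeries (logMul^[k] (1 : ℕ → ℂ)) 2 = (zetaLog k : ℂ) := by
  obtain ⟨c, h1, h2⟩ := hasSum_logMul_two (f := (1 : ℕ → ℂ)) (a := fun _ => 1)
    (fun n _ => by simp) k (abscissa_one_lt (by simp))
  simp only [one_mul] at h2
  have : zetaLog k = c := h2.tsum_eq
  rw [this]
  exact h1

theorem zetaLog_zero : zetaLog 0 = Real.pi ^ 2 / 6 := by
  have h := zetaLog_spec 0
  simp only [Function.iterate_zero, id] at h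
  rw [LSeries_one_eq_riemannZeta (by simp), riemannZeta_two] at h
  exact_mod_cast h.symm

theorem eq_zero_of_hasDerivAt_of_const {f f' : ℂ → ℂ} {c : ℂ} (hc : ∀ s : ℂ, 1 < s.re → f s = c)
    (hd : ∀ s : ℂ, 1 < s.re → HasDerivAt f (f' s) s) : ∀ s : ℂ, 1 < s.re → f' s = 0 := by
  intro s hs
  have hev : f =ᶠ[nhds s] fun _ => c := by
    filter_upwards [(isOpen_re_gt 1).mem_nhds hs] with z hz using hc z hz
  exact (hd s hs).unique ((hasDerivAt_const s c).congr_of_eventuallyEq hev)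

/-- Leibniz's rule for `ζ(s) ∑ μ(n) n^(-s) = 1`, differentiated up to three times and evaluated at
`s = 2`. Each derivative brings a factor `-log n`, so within one identity the signs agree and drop
out. The system is triangular and is solved below using `moebiusLog 0` as the inverse of `zetaLog
0`. -/
theorem zetaLog_mul_moebiusLog :
    zetaLog 0 * moebiusLog 0 = 1 ∧
    zetaLog 1 * moebiusLog 0 + zetaLog 0 * moebiusLog 1 = 0 ∧
    zetaLog 2 * moebiusLog 0 + 2 * (zetaLog 1 * moebiusLog 1) + zetaLog 0 * moebiusLog 2 = 0 ∧
    zetaLog 3 * moebiusLog 0 + 3 * (zetaLog 2 * moebiusLog 1) + 3 * (zetaLog 1 * moebiusLog 2)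
      + zetaLog 0 * moebiusLog 3 = 0 := by
  set Z : ℕ → ℂ → ℂ := fun k => LSeries (logMul^[k] (1 : ℕ → ℂ)) with hZ
  set M : ℕ → ℂ → ℂ := fun k => LSeries (logMul^[k] fun n => (μ n : ℂ)) with hM
  have dZ : ∀ k (s : ℂ), 1 < s.re → HasDerivAt (Z k) (-Z (k + 1) s) s :=
    fun k s hs => hasDerivAt_LSeries_logMul k (abscissa_one_lt hs)
  have dM : ∀ k (s : ℂ), 1 < s.re → HasDerivAt (M k) (-M (k + 1) s) s :=
    fun k s hs => hasDerivAt_LSeries_logMul k (abscissa_moebius_lt hs)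
  have h0 : ∀ s : ℂ, 1 < s.re → (Z 0 * M 0) s = 1 := fun s hs => LSeries_one_mul_Lseries_moebius hs
  have h1 := eq_zero_of_hasDerivAt_of_const h0 (fun s hs => (dZ 0 s hs).mul (dM 0 s hs))
  have h2 := eq_zero_of_hasDerivAt_of_const h1 (fun s hs =>
    ((dZ 1 s hs).neg.mul (dM 0 s hs)).add ((dZ 0 s hs).mul (dM 1 s hs).neg))
  have h3 := eq_zero_of_hasDerivAt_of_const h2 (fun s hs =>
    (((dZ 2 s hs).neg.neg.mul (dM 0 s hs)).add ((dZ 1 s hs).neg.mul (dM 1 s hs).neg)).add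
    (((dZ 1 s hs).neg.mul (dM 1 s hs).neg).add ((dZ 0 s hs).mul (dM 2 s hs).neg.neg)))
  have two : 1 < (2 : ℂ).re := by simp
  have eZ : ∀ k, Z k 2 = (zetaLog k : ℂ) := zetaLog_spec
  have eM : ∀ k, M k 2 = (moebiusLog k : ℂ) := fun k => (moebiusLog_spec k).1
  have g0 := h0 2 two
  have g1 := h1 2 two
  have g2 := h2 2 two
  have g3 := h3 2 two
  simp only [Pi.mul_apply, Pi.neg_apply, zero_add, Nat.reduceAdd, eZ, eM] at g0 g1 g2 g3
  norm_cast at g0 g1 g2 g3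
  refine ⟨g0, by linarith, by linarith, by linarith⟩

theorem moebiusLog_zero : moebiusLog 0 = 6 / Real.pi ^ 2 := by
  have h := zetaLog_mul_moebiusLog.1
  rw [zetaLog_zero] at h
  have := Real.pi_ne_zero
  field_simp at h ⊢
  linarith

theorem moebiusLog_one : moebiusLog 1 = -(moebiusLog 0 * moebiusLog 0 * zetaLog 1) := by
  obtain ⟨h0, h1, h2, h3⟩ := zetaLog_mul_moebiusLog
  linear_combination moebiusLog 0 * h1 - moebiusLog 1 * h0

theorem moebiusLog_two : moebiusLog 2 =
    -(moebiusLog 0 * (2 * (zetaLog 1 * moebiusLog 1) + zetaLog 2 * moebiusLog 0)) := by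
  obtain ⟨h0, h1, h2, h3⟩ := zetaLog_mul_moebiusLog
  linear_combination moebiusLog 0 * h2 - moebiusLog 2 * h0

theorem moebiusLog_three : moebiusLog 3 =
    -(moebiusLog 0 * (zetaLog 3 * moebiusLog 0 + 3 * (zetaLog 2 * moebiusLog 1)
      + 3 * (zetaLog 1 * moebiusLog 2))) := by
  obtain ⟨h0, h1, h2, h3⟩ := zetaLog_mul_moebiusLog
  linear_combination moebiusLog 0 * h3 - moebiusLog 3 * h0

theorem hasSum_Hder (k : ℕ) :
    HasSum (fun n : ℕ => (μ n : ℝ) / (n : ℝ) ^ 2 * (-2 * Real.log n) ^ k) (Hder k) := by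
  rw [Hder_eq]
  refine ((moebiusLog_spec k).2.mul_left ((-2) ^ k)).congr_fun ?_
  intro n
  rw [mul_pow]
  ring

theorem D1_eq : D1 = 1 / Real.pi ^ 2 := by
  rw [D1, C1, Hder_eq, moebiusLog_zero]
  ring

end MoebiusSeries

/-! ### Numerical bounds for `D1`, ..., `D4` -/

section NumericalCoefficients

/-- Interval arithmetic in midpoint-radius form: products become single unknowns with a known
radius, so all later numerical steps are linear. -/
theorem abs_mul_sub_le {x y a b e f g : ℝ} (hx : |x - a| ≤ e) (hy : |y - b| ≤ f)
    (h : |a| * f + |b| * e + e * f ≤ g) : |x * y - a * b| ≤ g := by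
  have : x * y - a * b = a * (y - b) + (x - a) * b + (x - a) * (y - b) := by ring
  rw [this]
  refine ((abs_add_le _ _).trans (add_le_add_left (abs_add_le _ _) _)).trans ?_
  rw [abs_mul, abs_mul, abs_mul]
  have h1 := mul_le_mul_of_nonneg_left hy (abs_nonneg a)
  have h2 := mul_le_mul_of_nonneg_right hx (abs_nonneg b)
  have h3 := mul_le_mul hx hy (abs_nonneg _) ((abs_nonneg _).trans hx)
  linarith

theorem abs_moebiusLog_zero_sub_le : |moebiusLog 0 - 0.607927| ≤ 4e-7 := by
  rw [moebiusLog_zero]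
  have h1 := Real.pi_gt_d6
  have h2 := Real.pi_lt_d6
  have h3 : 0 < Real.pi ^ 2 := by positivity
  rw [abs_le, sub_le_iff_le_add, le_sub_iff_add_le, div_le_iff₀ h3, le_div_iff₀ h3]
  constructor <;> nlinarith

theorem abs_gamma_sub_le : |Real.eulerMascheroniConstant - 0.5772155| ≤ 35e-7 := by
  obtain ⟨h1, h2⟩ := eulerMascheroni_bounds
  rw [abs_le]; constructor <;> linarith

theorem abs_zetaLog_one_sub_le : |zetaLog 1 - 0.937548| ≤ 4e-6 := by
  obtain ⟨h1, h2⟩ := zetaLog_one_bounds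
  rw [abs_le]; constructor <;> linarith

theorem abs_zetaLog_two_sub_le : |zetaLog 2 - 1.9892805| ≤ 65e-7 := by
  obtain ⟨h1, h2⟩ := zetaLog_two_bounds
  rw [abs_le]; constructor <;> linarith

theorem abs_zetaLog_three_sub_le : |zetaLog 3 - 6.0001465| ≤ 75e-7 := by
  obtain ⟨h1, h2⟩ := zetaLog_three_bounds
  rw [abs_le]; constructor <;> linarith

theorem abs_moebiusLog_one_sub_le : |moebiusLog 1 - (-0.3464947)| ≤ 3e-6 := by
  have h0 := abs_moebiusLog_zero_sub_le
  have h1 := abs_mul_sub_le h0 h0 (g := 5e-7) (by norm_num [abs_of_pos])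
  have h2 := abs_mul_sub_le h1 abs_zetaLog_one_sub_le (g := 2e-6) (by norm_num [abs_of_pos])
  rw [moebiusLog_one]
  rw [abs_le] at h2 ⊢
  norm_num at h2 ⊢
  constructor <;> linarith

theorem abs_moebiusLog_two_sub_le : |moebiusLog 2 - (-0.3402119)| ≤ 15e-6 := by
  have h0 := abs_moebiusLog_zero_sub_le
  have h1 := abs_mul_sub_le abs_zetaLog_one_sub_le abs_moebiusLog_one_sub_le (g := 5e-6)
    (by norm_num [abs_of_pos])
  have h2 := abs_mul_sub_le abs_zetaLog_two_sub_le h0 (g := 5e-6) (by norm_num [abs_of_pos])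
  have h3 : |(2 * (zetaLog 1 * moebiusLog 1) + zetaLog 2 * moebiusLog 0) - 0.5596262| ≤ 2e-5 := by
    rw [abs_le] at h1 h2 ⊢
    norm_num at h1 h2 ⊢
    constructor <;> linarith
  have h4 := abs_mul_sub_le h0 h3 (g := 13e-6) (by norm_num [abs_of_pos])
  rw [moebiusLog_two]
  rw [abs_le] at h4 ⊢
  norm_num at h4 ⊢
  constructor <;> linarith

theorem abs_moebiusLog_three_sub_le : |moebiusLog 3 - (-0.3786967)| ≤ 54e-6 := by
  have h0 := abs_moebiusLog_zero_sub_le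
  have h1 := abs_mul_sub_le abs_zetaLog_three_sub_le h0 (g := 8e-6) (by norm_num [abs_of_pos])
  have h2 := abs_mul_sub_le abs_zetaLog_two_sub_le abs_moebiusLog_one_sub_le (g := 9e-6)
    (by norm_num [abs_of_pos])
  have h3 := abs_mul_sub_le abs_zetaLog_one_sub_le abs_moebiusLog_two_sub_le (g := 16e-6)
    (by norm_num [abs_of_pos])
  have h4 : |(zetaLog 3 * moebiusLog 0 + 3 * (zetaLog 2 * moebiusLog 1)
      + 3 * (zetaLog 1 * moebiusLog 2)) - 0.622931| ≤ 85e-6 := by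
    rw [abs_le] at h1 h2 h3 ⊢
    norm_num at h1 h2 h3 ⊢
    constructor <;> linarith
  have h5 := abs_mul_sub_le h0 h4 (g := 53e-6) (by norm_num [abs_of_pos])
  rw [moebiusLog_three]
  rw [abs_le] at h5 ⊢
  norm_num at h5 ⊢
  constructor <;> linarith

theorem abs_gamma_sq_sub_le : |Real.eulerMascheroniConstant ^ 2 - 0.3331777| ≤ 5e-6 := by
  have h := abs_mul_sub_le abs_gamma_sub_le abs_gamma_sub_le (g := 45e-7) (by norm_num [abs_of_pos])
  rw [abs_le] at h ⊢
  rw [sq]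
  norm_num at h ⊢
  constructor <;> linarith

theorem abs_C2_sub_le : |C2 - 0.654431| ≤ 7e-6 := by
  have h := abs_gamma_sub_le
  rw [C2]
  rw [abs_le] at h ⊢
  norm_num at h ⊢
  constructor <;> linarith

theorem abs_C3_sub_le : |C3 - 0.981468| ≤ 8e-5 := by
  have h := abs_gamma_sub_le
  have h2 := abs_gamma_sq_sub_le
  obtain ⟨s1, s2⟩ := stieltjes_one_bounds
  rw [C3]
  rw [abs_le] at h h2 ⊢
  norm_num at h h2 s1 s2 ⊢
  constructor <;> linarith

theorem abs_C4_sub_le : |C4 - 0.2727785| ≤ 185e-6 := by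
  have h := abs_gamma_sub_le
  have h2 := abs_gamma_sq_sub_le
  have h3 := abs_mul_sub_le h2 h (g := 45e-7) (by norm_num [abs_of_pos])
  obtain ⟨s1, s2⟩ := stieltjes_one_bounds
  obtain ⟨r1, r2⟩ := stieltjes_two_bounds
  have s : |stieltjes 1 - (-0.072816)| ≤ 8e-6 := by rw [abs_le]; constructor <;> linarith
  have h4 := abs_mul_sub_le h s (g := 5e-6) (by norm_num [abs_of_pos])
  rw [C4, show Real.eulerMascheroniConstant ^ 3 =
    Real.eulerMascheroniConstant ^ 2 * Real.eulerMascheroniConstant by ring]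
  rw [abs_le] at h h2 h3 h4 ⊢
  norm_num at h h2 h3 h4 s1 s2 r1 r2 ⊢
  constructor <;> linarith

theorem D2_bounds : 0.7443 < D2 ∧ D2 < 0.7444 := by
  have h1 := abs_mul_sub_le abs_C2_sub_le abs_moebiusLog_zero_sub_le (g := 1e-5)
    (by norm_num [abs_of_pos])
  have h2 := abs_moebiusLog_one_sub_le
  rw [D2, C1, Hder_eq, Hder_eq]
  rw [abs_le] at h1 h2
  norm_num at h1 h2 ⊢
  constructor <;> linarith

theorem D3_bounds : 0.8231 < D3 ∧ D3 < 0.8234 := by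
  have h1 := abs_mul_sub_le abs_C3_sub_le abs_moebiusLog_zero_sub_le (g := 5e-5)
    (by norm_num [abs_of_pos])
  have h2 := abs_mul_sub_le abs_C2_sub_le abs_moebiusLog_one_sub_le (g := 5e-6)
    (by norm_num [abs_of_pos])
  have h3 := abs_moebiusLog_two_sub_le
  rw [D3, C1, Hder_eq, Hder_eq, Hder_eq]
  rw [abs_le] at h1 h2 h3
  norm_num at h1 h2 h3 ⊢
  constructor <;> linarith

theorem D4_bounds : 0.46 < D4 ∧ D4 < 0.461 := by
  have h1 := abs_mul_sub_le abs_C4_sub_le abs_moebiusLog_zero_sub_le (g := 114e-6)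
    (by norm_num [abs_of_pos])
  have h2 := abs_mul_sub_le abs_C3_sub_le abs_moebiusLog_one_sub_le (g := 31e-6)
    (by norm_num [abs_of_pos])
  have h3 := abs_mul_sub_le abs_C2_sub_le abs_moebiusLog_two_sub_le (g := 13e-6)
    (by norm_num [abs_of_pos])
  have h4 := abs_moebiusLog_three_sub_le
  rw [D4, C1, Hder_eq, Hder_eq, Hder_eq, Hder_eq]
  rw [abs_le] at h1 h2 h3 h4
  norm_num at h1 h2 h3 h4 ⊢
  constructor <;> linarith

theorem D1_bounds : 0.10132 < D1 ∧ D1 < 0.10133 := by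
  have h := abs_moebiusLog_zero_sub_le
  rw [D1, C1, Hder_eq]
  rw [abs_le] at h
  norm_num at h ⊢
  constructor <;> linarith

end NumericalCoefficients

/-! ### The error bound for `x ≥ 1600` -/

section LargeArguments

open ArithmeticFunction.Moebius

theorem T4_eq_zero {y : ℝ} (hy : y < 1) : T4 y = 0 := by
  rw [T4, Nat.floor_eq_zero.2 hy]
  simp

/-- Expand the cubic `P4(L - 2 log l)` in powers of `-2 log l`: each power, weighted by `μ(l)/l²`,
sums to a derivative of `H` at `1`. For `L = log x` the argument is `log(x/l²)`. -/
theorem hasSum_main_term (x L : ℝ) :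
    HasSum (fun l : ℕ => (μ l : ℝ) * (x / (l : ℝ) ^ 2 * P4 (L - 2 * Real.log l)))
      (D1 * x * L ^ 3 + D2 * x * L ^ 2 + D3 * x * L + D4 * x) := by
  have h0 := (hasSum_Hder 0).mul_left (x * (C1 * L ^ 3 + C2 * L ^ 2 + C3 * L + C4))
  have h1 := (hasSum_Hder 1).mul_left (x * (3 * C1 * L ^ 2 + 2 * C2 * L + C3))
  have h2 := (hasSum_Hder 2).mul_left (x * (3 * C1 * L + C2))
  have h3 := (hasSum_Hder 3).mul_left (x * C1)
  have e : D1 * x * L ^ 3 + D2 * x * L ^ 2 + D3 * x * L + D4 * x =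
      x * (C1 * L ^ 3 + C2 * L ^ 2 + C3 * L + C4) * Hder 0
      + x * (3 * C1 * L ^ 2 + 2 * C2 * L + C3) * Hder 1
      + x * (3 * C1 * L + C2) * Hder 2 + x * C1 * Hder 3 := by
    simp only [D1, D2, D3, D4]
    ring
  rw [e]
  refine (((h0.add h1).add h2).add h3).congr_fun fun l => ?_
  simp only [P4]
  ring

/-- For `y < 1` the main term alone is small. -/
theorem abs_P4_neg_le {v : ℝ} (hv : 0 ≤ v) : |P4 (-(4 * v))| ≤ 17 * Real.exp v := by
  -- The Taylor polynomial of degree 5 suffices; `k1` serves the lower bound on `P4`, where `-32/3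
  -- v³` dominates, and `k2` the upper.
  have h := Real.sum_le_exp_of_nonneg hv 6
  simp only [Finset.sum_range_succ, Finset.sum_range_zero, Nat.factorial] at h
  norm_num at h
  obtain ⟨a1, a2⟩ := abs_le.1 abs_C2_sub_le
  obtain ⟨b1, b2⟩ := abs_le.1 abs_C3_sub_le
  obtain ⟨c1, c2⟩ := abs_le.1 abs_C4_sub_le
  have v2 : 0 ≤ v ^ 2 := by positivity
  have v3 : 0 ≤ v ^ 3 := by positivity
  have v4 : 0 ≤ v ^ 4 := by positivity
  have v5 : 0 ≤ v ^ 5 := by positivity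
  have e : P4 (-(4 * v)) = C4 - 4 * (C3 * v) + 16 * (C2 * v ^ 2) - 32 / 3 * v ^ 3 := by
    rw [P4, C1]; ring
  have m1 : C3 * v ≤ 0.99 * v := by gcongr; linarith
  have m2 : 0.98 * v ≤ C3 * v := by gcongr; linarith
  have m3 : C2 * v ^ 2 ≤ 0.66 * v ^ 2 := by gcongr; linarith
  have m4 : 0.65 * v ^ 2 ≤ C2 * v ^ 2 := by gcongr; linarith
  have k1 : 0 ≤ v ^ 2 * (18 - 7.9 * v + 0.7 * v ^ 2 + 0.14 * v ^ 3) := by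
    refine mul_nonneg v2 ?_
    nlinarith [mul_nonneg hv (sq_nonneg (v - 3)), sq_nonneg (v - 3)]
  have k2 : 0 ≤ 10 - 8 * v ^ 2 + 10 * v ^ 3 + 10 * v:= by
    nlinarith [mul_nonneg hv (sq_nonneg (v - 1))]
  rw [e, abs_le]
  constructor
  · nlinarith
  · nlinarith

/-- Midpoint rule for the convex function `t^(-3/2)` on `[n - 1/2, n + 1/2]`; the right side
telescopes in `n`. -/
theorem one_div_mul_sqrt_le {n : ℝ} (hn : 1 ≤ n) :
    1 / (n * √n) ≤ 2 / √(n - 1 / 2) - 2 / √(n + 1 / 2) := by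
  set a := √(n - 1 / 2) with ha
  set b := √(n + 1 / 2) with hb
  have a0 : 0 < a := Real.sqrt_pos.2 (by linarith)
  have b0 : 0 < b := Real.sqrt_pos.2 (by linarith)
  have c0 : 0 < √n := Real.sqrt_pos.2 (by linarith)
  have a2 : a ^ 2 = n - 1 / 2 := Real.sq_sqrt (by linarith)
  have b2 : b ^ 2 = n + 1 / 2 := Real.sq_sqrt (by linarith)
  have c2 : √n ^ 2 = n := Real.sq_sqrt (by linarith)
  have h1 : a * b ≤ n := by nlinarith [sq_nonneg (a - b)]
  have h2 : a + b ≤ 2 * √n := by nlinarith [sq_nonneg (a - b)]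
  have e : 2 / a - 2 / b = 2 / (a * b * (a + b)) := by
    field_simp
    nlinarith
  rw [e, div_le_div_iff₀ (by positivity) (by positivity)]
  have := mul_le_mul h1 h2 (by positivity) (by linarith)
  linarith

theorem one_div_mul_sqrt_le_of_sq_le {n r c : ℝ} (hr : 0 < r) (h : r ^ 2 ≤ n)
    (hc : 1 ≤ c * (n * r)) : 1 / (n * √n) ≤ c := by
  have h1 : r ≤ √n := Real.le_sqrt_of_sq_le h
  have hn : 0 < n := lt_of_lt_of_le (by positivity) h
  have hc0 : 0 < c := by
    by_contra h0
    have := mul_nonneg hn.le hr.le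
    nlinarith
  rw [div_le_iff₀ (mul_pos hn (hr.trans_le h1))]
  exact hc.trans (by gcongr)

theorem abs_moebius_le (n : ℕ) : |(μ n : ℝ)| ≤ 1 := by
  exact_mod_cast ArithmeticFunction.abs_moebius_le_one (n := n)

theorem abs_moebius_eq_zero {n : ℕ} (d : ℕ) (hd : d * d ∣ n) (h1 : d ≠ 1) : |(μ n : ℝ)| = 0 := by
  have : ¬ Squarefree n := fun h => h1 (Nat.isUnit_iff.1 (h d hd))
  simp [ArithmeticFunction.moebius_eq_zero_of_not_squarefree this]

/-- Up to `12` only squarefree `l` count, for a total of at most `1.81661`; beyond that `|μ| ≤ 1`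
and telescoping suffice. The subtracted term makes the induction close. -/
theorem sum_abs_moebius_div_mul_sqrt_le_sub {N : ℕ} (hN : 12 ≤ N) :
    ∑ l ∈ Finset.Icc 1 N, |(μ l : ℝ)| / (l * √l) ≤ 2.383 - 2 / √((N : ℝ) + 1 / 2) := by
  have hle : ∀ (l : ℕ), |(μ l : ℝ)| / (l * √l) ≤ 1 / (l * √l) := fun l => by
    gcongr; exact abs_moebius_le l
  induction N, hN using Nat.le_induction with
  | base =>
    have b : ∀ (l : ℕ) (r c : ℝ), 0 < r → r ^ 2 ≤ l → 1 ≤ c * (l * r) →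
        |(μ l : ℝ)| / (l * √l) ≤ c := fun l r c h1 h2 h3 =>
      (hle l).trans (one_div_mul_sqrt_le_of_sq_le h1 h2 h3)
    have z : ∀ (l d : ℕ), d * d ∣ l → d ≠ 1 → |(μ l : ℝ)| / (l * √l) = 0 := fun l d h1 h2 => by
      rw [abs_moebius_eq_zero d h1 h2, zero_div]
    have h1 := b 1 1 1 (by norm_num) (by norm_num) (by norm_num)
    have h2 := b 2 1.4142 0.35357 (by norm_num) (by norm_num) (by norm_num)
    have h3 := b 3 1.732 0.19247 (by norm_num) (by norm_num) (by norm_num)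
    have h4 := z 4 2 (by norm_num) (by norm_num)
    have h5 := b 5 2.236 0.08946 (by norm_num) (by norm_num) (by norm_num)
    have h6 := b 6 2.449 0.06806 (by norm_num) (by norm_num) (by norm_num)
    have h7 := b 7 2.6457 0.054 (by norm_num) (by norm_num) (by norm_num)
    have h8 := z 8 2 (by norm_num) (by norm_num)
    have h9 := z 9 3 (by norm_num) (by norm_num)
    have h10 := b 10 3.162 0.03163 (by norm_num) (by norm_num) (by norm_num)
    have h11 := b 11 3.316 0.02742 (by norm_num) (by norm_num) (by norm_num)
    have h12 := z 12 2 (by norm_num) (by norm_num)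
    have ht : 2 / √(((12 : ℕ) : ℝ) + 1 / 2) ≤ 0.566 := by
      have : (3.535 : ℝ) ≤ √(((12 : ℕ) : ℝ) + 1 / 2) := Real.le_sqrt_of_sq_le (by norm_num)
      rw [div_le_iff₀ (by linarith)]
      linarith
    have hI : Finset.Icc 1 12 = {1, 2, 3, 4, 5, 6, 7, 8, 9, 10, 11, 12} := by decide
    rw [hI]
    repeat rw [Finset.sum_insert (by decide)]
    rw [Finset.sum_singleton, h4, h8, h9, h12]
    norm_num at h1 h2 h3 h5 h6 h7 h10 h11 ht ⊢
    linarith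
  | succ N hN ih =>
    rw [Finset.sum_Icc_succ_top (by omega)]
    have h := one_div_mul_sqrt_le (n := ((N + 1 : ℕ) : ℝ)) (by push_cast; linarith [N.cast_nonneg (α := ℝ)])
    have e : ((N + 1 : ℕ) : ℝ) - 1 / 2 = (N : ℝ) + 1 / 2 := by push_cast; ring
    rw [e] at h
    linarith [hle (N + 1)]

theorem sum_abs_moebius_div_mul_sqrt_le (N : ℕ) :
    ∑ l ∈ Finset.Icc 1 N, |(μ l : ℝ)| / (l * √l) ≤ 2.383 := by
  have h := sum_abs_moebius_div_mul_sqrt_le_sub (le_max_right N 12)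
  have h2 : ∑ l ∈ Finset.Icc 1 N, |(μ l : ℝ)| / (l * √l) ≤
      ∑ l ∈ Finset.Icc 1 (max N 12), |(μ l : ℝ)| / (l * √l) :=
    Finset.sum_le_sum_of_subset_of_nonneg (Finset.Icc_subset_Icc_right (le_max_left N 12))
      fun _ _ _ => by positivity
  have h3 : 0 ≤ 2 / √((max N 12 : ℕ) + 1 / 2 : ℝ) := by positivity
  linarith

theorem sum_one_div_le (u : ℝ) (hu : 1 ≤ u) :
    ∑ l ∈ Finset.Icc 1 ⌊u⌋₊, 1 / (l : ℝ) ≤ 1 + Real.log u := by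
  have h := harmonic_floor_le_one_add_log u hu
  rw [harmonic_eq_sum_Icc] at h
  push_cast at h
  simpa only [one_div] using h

/-- Bound for a single term of `∑ μ(l) (T4(x/l²) - (x/l²) P4(log(x/l²)))`, `x = q⁴`. -/
theorem abs_T4_sub_main_le {q : ℝ} (hq : 1 ≤ q) (hL : 7.37 ≤ 4 * Real.log q) {l : ℕ} (hl : 1 ≤ l) :
    |T4 (q ^ 4 / (l : ℝ) ^ 2) - q ^ 4 / (l : ℝ) ^ 2 * P4 (4 * Real.log q - 2 * Real.log l)| ≤
      4 * q ^ 3 * (4 * Real.log q - 3.077 + if l = 1 then 1.386 else 0) * (1 / (l * √l)) +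
      if l ≤ ⌊q ^ 2⌋₊ then q ^ 2 * (4 * Real.log q + 18.12) * (1 / (l : ℝ)) else 0 := by
  have hq0 : 0 < q := by linarith
  have hl1 : (1 : ℝ) ≤ l := by exact_mod_cast hl
  have hl0 : (0 : ℝ) < l := by linarith
  set r := √(l : ℝ) with hr
  have hr0 : 0 < r := Real.sqrt_pos.2 hl0
  have hr2 : r ^ 2 = l := Real.sq_sqrt hl0.le
  set w := q / r with hw
  have hw0 : 0 < w := by positivity
  have hw4 : w ^ 4 = q ^ 4 / (l : ℝ) ^ 2 := by rw [hw, ← hr2]; field_simp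
  have hw3 : w ^ 3 = q ^ 3 * (1 / (l * r)) := by rw [hw, ← hr2]; field_simp
  have hw2 : w ^ 2 = q ^ 2 * (1 / (l : ℝ)) := by rw [hw, ← hr2]; field_simp
  have hlr : Real.log r = Real.log l / 2 := Real.log_sqrt hl0.le
  have hlw : 4 * Real.log w = 4 * Real.log q - 2 * Real.log l := by
    rw [hw, Real.log_div hq0.ne' hr0.ne', hlr]; ring
  rw [← hw4, ← hlw]
  -- For `l ≥ 2`, `log(x/l²) ≤ log x - 1.386`, because `2 log 2 > 1.386`. This improves `1.691` to
  -- `3.077` for every `l` but `1`.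
  have hlog : (if l = 1 then (0 : ℝ) else 1.386) ≤ 2 * Real.log l := by
    split_ifs with h
    · have := Real.log_nonneg hl1
      linarith
    · have h2 : (2 : ℝ) ≤ l := by exact_mod_cast (show 2 ≤ l by omega)
      have := Real.log_le_log (by norm_num) h2
      linarith [Real.log_two_gt_d9]
  by_cases hlq : l ≤ ⌊q ^ 2⌋₊
  · rw [if_pos hlq]
    have hlq' : (l : ℝ) ≤ q ^ 2 := (Nat.le_floor_iff (by positivity)).1 hlq
    have hw1 : 1 ≤ w := by
      rw [hw, le_div_iff₀ hr0, one_mul]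
      exact abs_le_of_sq_le_sq' (by rw [hr2]; exact hlq') hq0.le |>.2
    have h := abs_T4_sub_le hw1
    have hlogl := Real.log_nonneg hl1
    have e1 : 4 * w ^ 3 * (4 * Real.log w - 1.691) ≤
        4 * q ^ 3 * (4 * Real.log q - 3.077 + if l = 1 then 1.386 else 0) * (1 / (l * r)) := by
      have : 4 * q ^ 3 * (4 * Real.log q - 3.077 + if l = 1 then 1.386 else 0) * (1 / (l * r)) =
          4 * w ^ 3 * (4 * Real.log q - 3.077 + if l = 1 then 1.386 else 0) := by rw [hw3]; ring
      rw [this]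
      refine mul_le_mul_of_nonneg_left ?_ (by positivity)
      rw [hlw]
      split_ifs at hlog ⊢ <;> linarith
    -- As `w ≥ 1`, the lower terms fit into `w²`: `18.12 = 16.6 + 1 + 0.52`.
    have e2 : w ^ 2 * (4 * Real.log w + 16.6) + w + 0.52 ≤
        q ^ 2 * (4 * Real.log q + 18.12) * (1 / (l : ℝ)) := by
      have : q ^ 2 * (4 * Real.log q + 18.12) * (1 / (l : ℝ)) =
          w ^ 2 * (4 * Real.log q + 16.6) + w ^ 2 + 0.52 * w ^ 2 := by rw [hw2]; ring
      rw [this]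
      have g1 : w ^ 2 * (4 * Real.log w + 16.6) ≤ w ^ 2 * (4 * Real.log q + 16.6) := by
        gcongr ?_ * ?_
        linarith
      nlinarith
    linarith
  · rw [if_neg hlq, add_zero]
    have hlq' : q ^ 2 < l := Nat.lt_of_floor_lt (not_le.1 hlq)
    have hw1 : w < 1 := by
      rw [hw, div_lt_one hr0]
      exact lt_of_pow_lt_pow_left₀ 2 hr0.le (by rw [hr2]; exact hlq')
    have hwl : Real.log w < 0 := Real.log_neg hw0 hw1
    rw [T4_eq_zero (pow_lt_one₀ hw0.le hw1 (by norm_num)), zero_sub, abs_neg, abs_mul,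
      abs_of_pos (by positivity)]
    have h := abs_P4_neg_le (v := -Real.log w) (by linarith)
    rw [Real.exp_neg, Real.exp_log hw0, show -(4 * -Real.log w) = 4 * Real.log w by ring] at h
    have h1 : w ^ 4 * |P4 (4 * Real.log w)| ≤ w ^ 4 * (17 * w⁻¹) := by gcongr
    have h2 : w ^ 4 * (17 * w⁻¹) = 17 * w ^ 3 := by field_simp
    have h3 : 4 * q ^ 3 * (4 * Real.log q - 3.077 + if l = 1 then 1.386 else 0) * (1 / (l * r)) =
        4 * w ^ 3 * (4 * Real.log q - 3.077 + if l = 1 then 1.386 else 0) := by rw [hw3]; ring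
    rw [h3]
    -- Here `T4` vanishes and the main term is at most `17 w³ = 4 w³ · 4.25`. The same bound as for
    -- small `l` covers it, since `7.37 - 3.077 > 4.25`.
    have h4 : 4 * w ^ 3 * 4.25 ≤
        4 * w ^ 3 * (4 * Real.log q - 3.077 + if l = 1 then 1.386 else 0) := by
      refine mul_le_mul_of_nonneg_left ?_ (by positivity)
      split_ifs <;> linarith
    linarith

theorem sum_abs_T4_sub_main_le {q : ℝ} (hq : 1 ≤ q) (hL : 7.37 ≤ 4 * Real.log q) (N : ℕ) :
    ∑ l ∈ Finset.Icc 1 N, |(μ l : ℝ)| *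
      |T4 (q ^ 4 / (l : ℝ) ^ 2) - q ^ 4 / (l : ℝ) ^ 2 * P4 (4 * Real.log q - 2 * Real.log l)| ≤
      4 * q ^ 3 * ((4 * Real.log q - 3.077) * 2.383 + 1.386) +
      q ^ 2 * (4 * Real.log q + 18.12) * (1 + 2 * Real.log q) := by
  have hq0 : 0 < q := by linarith
  have h1 : ∀ l ∈ Finset.Icc 1 N, |(μ l : ℝ)| *
      |T4 (q ^ 4 / (l : ℝ) ^ 2) - q ^ 4 / (l : ℝ) ^ 2 * P4 (4 * Real.log q - 2 * Real.log l)| ≤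
      4 * q ^ 3 * (4 * Real.log q - 3.077) * (|(μ l : ℝ)| / (l * √l))
      + 4 * q ^ 3 * 1.386 * (if l = 1 then 1 else 0)
      + (if l ≤ ⌊q ^ 2⌋₊ then q ^ 2 * (4 * Real.log q + 18.12) * (1 / (l : ℝ)) else 0) := by
    intro l hl
    have hl1 := (Finset.mem_Icc.1 hl).1
    have h := mul_le_mul_of_nonneg_left (abs_T4_sub_main_le hq hL hl1) (abs_nonneg (μ l : ℝ))
    refine h.trans ?_
    rw [mul_add]
    refine add_le_add (le_of_eq ?_) ?_
    · rcases eq_or_ne l 1 with rfl | hne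
      · simp
        ring
      · rw [if_neg hne, if_neg hne]
        ring
    · refine mul_le_of_le_one_left ?_ (abs_moebius_le l)
      split_ifs <;> positivity
  refine (Finset.sum_le_sum h1).trans ?_
  rw [Finset.sum_add_distrib, Finset.sum_add_distrib, ← Finset.mul_sum, ← Finset.mul_sum]
  have e1 := mul_le_mul_of_nonneg_left (sum_abs_moebius_div_mul_sqrt_le N)
    (show 0 ≤ 4 * q ^ 3 * (4 * Real.log q - 3.077) from mul_nonneg (by positivity) (by linarith))
  have e2 : ∑ l ∈ Finset.Icc 1 N, (if l = 1 then (1 : ℝ) else 0) ≤ 1 := by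
    rw [Finset.sum_ite_eq']
    split_ifs <;> norm_num
  have e3 := mul_le_mul_of_nonneg_left e2 (show 0 ≤ 4 * q ^ 3 * 1.386 by positivity)
  have e4 : ∑ l ∈ Finset.Icc 1 N,
      (if l ≤ ⌊q ^ 2⌋₊ then q ^ 2 * (4 * Real.log q + 18.12) * (1 / (l : ℝ)) else 0) ≤
      q ^ 2 * (4 * Real.log q + 18.12) * (1 + 2 * Real.log q) := by
    have hs := sum_one_div_le (q ^ 2) (one_le_pow₀ hq)
    rw [Real.log_pow] at hs
    push_cast at hs
    rw [← Finset.sum_filter, ← Finset.mul_sum]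
    refine mul_le_mul_of_nonneg_left (le_trans ?_ hs) (by positivity)
    refine Finset.sum_le_sum_of_subset_of_nonneg ?_ fun _ _ _ => by positivity
    intro l hl
    rw [Finset.mem_filter, Finset.mem_Icc] at hl
    exact Finset.mem_Icc.2 ⟨hl.1.1, hl.2⟩
  linarith

theorem abs_sumSqDivisors_sub_le_of_large {q : ℝ} (hq : 1 ≤ q) (hL : 7.37 ≤ 4 * Real.log q) :
    |sumSqDivisors (q ^ 4) - (D1 * q ^ 4 * (4 * Real.log q) ^ 3 + D2 * q ^ 4 * (4 * Real.log q) ^ 2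
      + D3 * q ^ 4 * (4 * Real.log q) + D4 * q ^ 4)| ≤
      4 * q ^ 3 * ((4 * Real.log q - 3.077) * 2.383 + 1.386) +
      q ^ 2 * (4 * Real.log q + 18.12) * (1 + 2 * Real.log q) := by
  have hs : √(q ^ 4) = q ^ 2 := by
    rw [show q ^ 4 = (q ^ 2) ^ 2 by ring, Real.sqrt_sq (by positivity)]
  have hS := sumSqDivisors_eq_sum_moebius (one_le_pow₀ hq (n := 4))
  rw [hs] at hS
  have hM := (hasSum_main_term (q ^ 4) (4 * Real.log q)).tendsto_sum_nat
  have hM' := ((tendsto_add_atTop_iff_nat 1).2 hM).const_sub (sumSqDivisors (q ^ 4))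
  refine le_of_tendsto hM'.abs ?_
  -- The Möbius sum may run up to any `N ≥ q²`, since `T4(q⁴/l²) = 0` beyond `q²`. It is then
  -- compared termwise with a partial sum of the main series, uniformly in `N`.
  filter_upwards [eventually_ge_atTop ⌊q ^ 2⌋₊] with N hN
  have hS' : sumSqDivisors (q ^ 4) =
      ∑ l ∈ Finset.Icc 1 N, (μ l : ℝ) * T4 (q ^ 4 / (l : ℝ) ^ 2) := by
    rw [hS]
    refine Finset.sum_subset (Finset.Icc_subset_Icc_right hN) fun l hl hl' => ?_
    rw [Finset.mem_Icc] at hl hl'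
    have hlq : q ^ 2 < l := Nat.lt_of_floor_lt (by omega)
    rw [T4_eq_zero, mul_zero]
    have : (0 : ℝ) < l := by linarith [sq_nonneg q]
    rw [div_lt_one (by positivity), show q ^ 4 = (q ^ 2) ^ 2 by ring]
    gcongr
  rw [hS', Finset.range_eq_Ico, Finset.sum_eq_sum_Ico_succ_bot (by omega)]
  simp only [ArithmeticFunction.map_zero, Int.cast_zero, zero_mul, zero_add]
  rw [show Finset.Ico 1 (N + 1) = Finset.Icc 1 N from rfl, ← Finset.sum_sub_distrib]
  refine (Finset.abs_sum_le_sum_abs _ _).trans ?_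
  refine le_trans (le_of_eq (Finset.sum_congr rfl fun l _ => ?_)) (sum_abs_T4_sub_main_le hq hL N)
  rw [← abs_mul, mul_sub]

theorem large_bound_le {q : ℝ} (hq : 1 ≤ q) (hL : 7.37 ≤ 4 * Real.log q) :
    4 * q ^ 3 * ((4 * Real.log q - 3.077) * 2.383 + 1.386) +
      q ^ 2 * (4 * Real.log q + 18.12) * (1 + 2 * Real.log q) ≤
    9.73 * q ^ 3 * (4 * Real.log q) := by
  have hq0 : 0 < q := by linarith
  set z := Real.log q with hz
  have hz1 : 1.8425 ≤ z := by linarith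
  have h := Real.sum_le_exp_of_nonneg (show 0 ≤ z by linarith) 4
  simp only [Finset.sum_range_succ, Finset.sum_range_zero, Nat.factorial] at h
  norm_num at h
  rw [hz, Real.exp_log hq0, ← hz] at h
  have key : (4 * z + 18.12) * (1 + 2 * z) ≤ q * (9.73 * (4 * z) -
      4 * ((4 * z - 3.077) * 2.383 + 1.386)) := by
    -- The bracket equals about `0.198 · 4z + 23.79`. Its constant part, multiplied by `q = exp z`,
    -- outweighs the quadratic in `z` on the left; a cubic Taylor bound for `exp z` is enough from
    -- `z = 1.8425` on.
    have h1 : 23 * q ≤ q * (9.73 * (4 * z) - 4 * ((4 * z - 3.077) * 2.383 + 1.386)) := by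
      nlinarith
    nlinarith [sq_nonneg z, mul_nonneg (sub_nonneg.2 hz1) (sub_nonneg.2 hz1),
      mul_nonneg (mul_nonneg (sub_nonneg.2 hz1) (sub_nonneg.2 hz1)) (sub_nonneg.2 hz1)]
  have := mul_le_mul_of_nonneg_left key (sq_nonneg q)
  linarith

end LargeArguments

/-! ### Kernel-checked verification for `x < 1600` -/

section SmallArguments

/-- `∑_{1 ≤ a ≤ k, a ∣ n} (2 or 1)`, the weight being `2` if `a² < n` and `1` if `a² = n`. -/
def divCount (n : ℕ) : ℕ → ℕ :=
  Nat.rec 0 fun a c => c + bif (n % (a + 1)).beq 0 then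
    (bif ((a + 1) * (a + 1)).blt n then 2 else bif ((a + 1) * (a + 1)).beq n then 1 else 0) else 0

theorem divCount_eq_sum (n k : ℕ) : divCount n k =
    ∑ a ∈ (Finset.Icc 1 k).filter (· ∣ n), if a * a < n then 2 else if a * a = n then 1 else 0 := by
  induction k with
  | zero => rfl
  | succ k ih =>
    rw [Finset.sum_filter, Finset.sum_Icc_succ_top (by omega), ← Finset.sum_filter, ← ih]
    change divCount n k + _ = _
    congr 1
    simp only [Nat.blt_eq, Bool.cond_eq_ite, Nat.beq_eq, Nat.dvd_iff_mod_eq_zero]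

/-- The involution `a ↦ n/a` pairs divisors below and above `√n`, so trial division up to `√n`
suffices. The bound `40` used later works for all `n < 41² = 1681`. -/
theorem card_divisors_eq_divCount {n k : ℕ} (hn : n ≠ 0) (hk : n < (k + 1) * (k + 1)) :
    n.divisors.card = divCount n k := by
  have hbij : (n.divisors.filter fun a => n < a * a).card =
      (n.divisors.filter fun a => a * a < n).card := by
    refine Finset.card_bij' (fun a _ => n / a) (fun a _ => n / a) ?_ ?_ ?_ ?_
    all_goals
      intro a ha
      simp only [Finset.mem_filter, Nat.mem_divisors] at ha ⊢
      obtain ⟨⟨⟨b, rfl⟩, h0⟩, h⟩ := ha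
      have ha0 : 0 < a := Nat.pos_of_ne_zero (left_ne_zero_of_mul h0)
      have hb0 : 0 < b := Nat.pos_of_ne_zero (right_ne_zero_of_mul h0)
      rw [Nat.mul_div_cancel_left _ ha0]
    · exact ⟨⟨dvd_mul_left _ _, h0⟩, by nlinarith⟩
    · exact ⟨⟨dvd_mul_left _ _, h0⟩, by nlinarith⟩
    · exact Nat.mul_div_cancel _ hb0
    · exact Nat.mul_div_cancel _ hb0
  have h1 : ∀ a ∈ n.divisors, 1 = (if a * a < n then 1 else 0) + (if a * a = n then 1 else 0) +
      (if n < a * a then 1 else 0) := fun a _ => by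
    rcases lt_trichotomy (a * a) n with h | h | h
    · simp [h, h.ne, h.not_gt]
    · simp [h]
    · simp [h, h.ne', h.not_gt]
  rw [divCount_eq_sum, Finset.card_eq_sum_ones, Finset.sum_congr rfl h1, Finset.sum_add_distrib,
    Finset.sum_add_distrib, Finset.sum_boole, Finset.sum_boole, Finset.sum_boole, hbij,
    ← Finset.sum_boole, ← Finset.sum_boole, ← Finset.sum_add_distrib, ← Finset.sum_add_distrib]
  symm
  refine Finset.sum_subset_zero_on_sdiff (fun a ha => ?_) (fun a ha => ?_) (fun a ha => ?_)
  · simp only [Finset.mem_filter, Nat.mem_divisors] at ha ⊢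
    exact ⟨ha.2, hn⟩
  · simp only [Finset.mem_sdiff, Finset.mem_filter, Nat.mem_divisors, Finset.mem_Icc, not_and] at ha
    have ha0 : 0 < a := Nat.pos_of_dvd_of_pos ha.1.1 (Nat.pos_of_ne_zero hn)
    have hka : k < a := by
      by_contra h
      exact ha.2 ⟨ha0, by omega⟩ ha.1.1
    have : n < a * a := lt_of_lt_of_le hk (Nat.mul_le_mul hka hka)
    simp [this.not_gt, this.ne']
  · rcases lt_trichotomy (a * a) n with h | h | h
    · simp [h, h.ne]
    · simp [h]
    · simp [h.ne', h.not_gt]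

/-- `f n`, written so that kernel reduction evaluates `n` before unfolding `f`. -/
def force (f : ℕ → Bool) : ℕ → Bool := Nat.rec (f 0) fun k _ => f (k + 1)

theorem force_eq (f : ℕ → Bool) (n : ℕ) : force f n = f n := by cases n <;> rfl

/-- The fixed-point scale for logarithms in the finite verification. -/
def logScale : ℕ := 100000000

/-- The inequalities to be verified at `n`, where `lo ≤ logScale * log n`,
`logScale * log (n + 1) ≤ hi`, `s = ∑_{m ≤ n} d(m)²` and `r ≤ n ^ (3/4)`. -/
def testAt (n lo hi s r : ℕ) : Bool :=
  (n.blt 433 || (4 * s * logScale ^ 3).ble (n * lo ^ 3)) &&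
  ((n.blt 7 || (s * logScale ^ 3).ble (n * lo ^ 3)) &&
  ((10000 * logScale ^ 3 * s).ble (n * (1013 * lo ^ 3 + 7440 * logScale * lo ^ 2 +
      8230 * logScale ^ 2 * lo + 4600 * logScale ^ 3) + 97300 * r * lo * logScale ^ 2) &&
  ((n + 1) * (1014 * hi ^ 3 + 7450 * logScale * hi ^ 2 + 8240 * logScale ^ 2 * hi +
      4610 * logScale ^ 3)).ble (10000 * logScale ^ 3 * s + 97300 * r * lo * logScale ^ 2)))

/-- Runs `testAt` at `fuel` consecutive integers from `n` on. -/
def testFrom : ℕ → ℕ → ℕ → ℕ → ℕ → ℕ → Bool :=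
  Nat.rec (fun _ _ _ _ _ => true) fun _ ih n lo hi s r =>
    force (fun hi' => testAt n lo hi' s r &&
      force (fun lo' => force (fun s' => force (fun r' => force (fun n' => ih n' lo' hi' s' r')
        (n + 1)) (bif ((r + 1) ^ 4).ble ((n + 1) ^ 3) then r + 1 else r))
        (s + divCount (n + 1) 40 ^ 2)) (lo + 2 * logScale / (2 * n + 1)))
      (hi + logScale * (2 * n + 1) / (2 * n * (n + 1)) + 1)

theorem testFrom_succ (fuel n lo hi s r : ℕ) : testFrom (fuel + 1) n lo hi s r =
    (testAt n lo (hi + logScale * (2 * n + 1) / (2 * n * (n + 1)) + 1) s r &&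
      testFrom fuel (n + 1) (lo + 2 * logScale / (2 * n + 1))
        (hi + logScale * (2 * n + 1) / (2 * n * (n + 1)) + 1) (s + divCount (n + 1) 40 ^ 2)
        (bif ((r + 1) ^ 4).ble ((n + 1) ^ 3) then r + 1 else r)) := by
  simp only [testFrom, force_eq]

theorem testFrom_two : testFrom 20 2 69314718 69314719 5 1 = true := by decide +kernel

/-- The restart at `21` discards the logarithm errors accumulated from `2`; the one-step errors are
of order `n⁻³`, hence largest at the start. -/
theorem testFrom_twentyone : testFrom 1579 21 304452210 304452280 280 9 = true := by decide +kernel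

/-- The sum `∑_{m ≤ n} d(m)²` as a natural number. -/
def sumSqNat (n : ℕ) : ℕ := ∑ m ∈ Finset.Icc 1 n, m.divisors.card ^ 2

theorem sumSqNat_succ {n : ℕ} (hn : n < 1600) :
    sumSqNat (n + 1) = sumSqNat n + divCount (n + 1) 40 ^ 2 := by
  rw [sumSqNat, Finset.sum_Icc_succ_top (by omega),
    card_divisors_eq_divCount (n := n + 1) (k := 40) (by omega) (by omega)]
  rfl

theorem logScale_pos : (0 : ℝ) < logScale := by norm_num [logScale]

theorem natCast_div_le_div (a b : ℕ) : ((a / b : ℕ) : ℝ) ≤ (a : ℝ) / b := Nat.cast_div_le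

theorem div_le_natCast_div_add_one (a b : ℕ) : (a : ℝ) / b ≤ ((a / b : ℕ) : ℝ) + 1 := by
  rw [← Nat.floor_div_eq_div (K := ℝ)]
  exact (Nat.lt_floor_add_one _).le

/-- The hypotheses on `lo`, `hi` and `r` are the loop invariant. The midpoint increment of `log`,
rounded down, preserves the bound by `lo`; the trapezoid increment, rounded up by the `+ 1`,
preserves that by `hi`. -/
theorem exists_testAt_of_testFrom (fuel : ℕ) : ∀ n lo hi r : ℕ, 1 ≤ n → n + fuel ≤ 1600 →
    (lo : ℝ) ≤ logScale * Real.log n → (logScale * Real.log n : ℝ) ≤ hi → r ^ 4 ≤ n ^ 3 →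
    testFrom fuel n lo hi (sumSqNat n) r = true → ∀ m, n ≤ m → m < n + fuel →
    ∃ lo hi r : ℕ, (lo : ℝ) ≤ logScale * Real.log m ∧
      (logScale * Real.log ((m : ℝ) + 1) : ℝ) ≤ hi ∧ r ^ 4 ≤ m ^ 3 ∧
      testAt m lo hi (sumSqNat m) r = true := by
  induction fuel with
  | zero => intro n lo hi r _ _ _ _ _ _ m h1 h2; omega
  | succ fuel ih =>
    intro n lo hi r hn hf hlo hhi hr ht m hnm hm
    have hK := logScale_pos
    have hn0 : (1 : ℝ) ≤ n := by exact_mod_cast hn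
    rw [testFrom_succ, Bool.and_eq_true] at ht
    obtain ⟨h1, h2⟩ := ht
    have hhi' : (logScale * Real.log ((n : ℝ) + 1) : ℝ) ≤
        ((hi + logScale * (2 * n + 1) / (2 * n * (n + 1)) + 1 : ℕ) : ℝ) := by
      have g := log_sub_log_le (show (0 : ℝ) < n by linarith) (show (n : ℝ) ≤ n + 1 by linarith)
      have g2 := div_le_natCast_div_add_one (logScale * (2 * n + 1)) (2 * n * (n + 1))
      have e : ((logScale * (2 * n + 1) : ℕ) : ℝ) / ((2 * n * (n + 1) : ℕ) : ℝ) =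
          logScale * (((n : ℝ) + 1 - n) / 2 * (1 / n + 1 / (n + 1))) := by
        push_cast
        field_simp
        ring
      rw [e] at g2
      have g3 := mul_le_mul_of_nonneg_left g hK.le
      rw [Nat.cast_add, Nat.cast_add, Nat.cast_one]
      linarith
    rcases Nat.eq_or_lt_of_le hnm with rfl | hlt
    · exact ⟨lo, _, r, hlo, hhi', hr, h1⟩
    · refine ih (n + 1) (lo + 2 * logScale / (2 * n + 1)) _
        (bif ((r + 1) ^ 4).ble ((n + 1) ^ 3) then r + 1 else r) (by omega) (by omega) ?_ ?_ ?_
        (by rw [sumSqNat_succ (by omega)]; exact h2) m hlt (by omega)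
      · have g := le_log_sub_log (show (0 : ℝ) < n by linarith) (show (n : ℝ) ≤ n + 1 by linarith)
        have g2 := natCast_div_le_div (2 * logScale) (2 * n + 1)
        have e : ((2 * logScale : ℕ) : ℝ) / ((2 * n + 1 : ℕ) : ℝ) =
            logScale * (2 * ((n : ℝ) + 1 - n) / (n + (n + 1))) := by
          push_cast
          field_simp
          ring
        rw [e] at g2
        have g3 := mul_le_mul_of_nonneg_left g hK.le
        rw [Nat.cast_add, Nat.cast_add n 1, Nat.cast_one]
        linarith
      · rw [Nat.cast_add n 1, Nat.cast_one]
        exact hhi'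
      · rw [Bool.cond_eq_ite]
        split_ifs with h
        · exact Nat.le_of_ble_eq_true h
        · exact hr.trans (Nat.pow_le_pow_left (by omega) 3)

theorem sumSqNat_two : sumSqNat 2 = 5 := by decide +kernel

theorem sumSqNat_twentyone : sumSqNat 21 = 280 := by decide +kernel

theorem exists_testAt {m : ℕ} (h2 : 2 ≤ m) (hm : m < 1600) :
    ∃ lo hi r : ℕ, (lo : ℝ) ≤ logScale * Real.log m ∧
      (logScale * Real.log ((m : ℝ) + 1) : ℝ) ≤ hi ∧ r ^ 4 ≤ m ^ 3 ∧
      testAt m lo hi (sumSqNat m) r = true := by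
  rcases lt_or_ge m 21 with h | h
  · have l1 := Real.log_two_gt_d9
    have l2 := Real.log_two_lt_d9
    refine exists_testAt_of_testFrom 20 2 69314718 69314719 1 (by norm_num) (by norm_num) ?_ ?_
      (by norm_num) (by rw [sumSqNat_two]; exact testFrom_two) m h2 (by omega)
    · norm_num [logScale]; linarith
    · norm_num [logScale]; linarith
  · obtain ⟨l1, l2⟩ := log_twentyone_bounds
    refine exists_testAt_of_testFrom 1579 21 304452210 304452280 9 (by norm_num) (by norm_num) ?_ ?_
      (by norm_num) (by rw [sumSqNat_twentyone]; exact testFrom_twentyone) m h (by omega)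
    · norm_num [logScale]; linarith
    · norm_num [logScale]; linarith

/-- The main term of the theorem. -/
noncomputable def mainTerm (x : ℝ) : ℝ :=
  D1 * x * Real.log x ^ 3 + D2 * x * Real.log x ^ 2 + D3 * x * Real.log x + D4 * x

theorem mainTerm_mono {x y : ℝ} (hx : 1 ≤ x) (hxy : x ≤ y) : mainTerm x ≤ mainTerm y := by
  have h1 := D1_bounds.1
  have h2 := D2_bounds.1
  have h3 := D3_bounds.1
  have h4 := D4_bounds.1
  have hl : 0 ≤ Real.log x := Real.log_nonneg hx
  have hll : Real.log x ≤ Real.log y := Real.log_le_log (by linarith) hxy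
  have e1 : 0 ≤ D1 * y := mul_nonneg (by linarith) (by linarith)
  have e2 : 0 ≤ D2 * y := mul_nonneg (by linarith) (by linarith)
  have e3 : 0 ≤ D3 * y := mul_nonneg (by linarith) (by linarith)
  rw [mainTerm, mainTerm]
  gcongr

theorem sumSqDivisors_eq (x : ℝ) : sumSqDivisors x = sumSqNat ⌊x⌋₊ := by
  simp [sumSqDivisors, sumSqNat]

/-- What `testAt` verifies. -/
theorem bounds_of_lt {n : ℕ} (h2 : 2 ≤ n) (hn : n < 1600) :
    (433 ≤ n → (sumSqNat n : ℝ) ≤ 1 / 4 * n * Real.log n ^ 3) ∧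
    (7 ≤ n → (sumSqNat n : ℝ) ≤ n * Real.log n ^ 3) ∧
    (sumSqNat n : ℝ) ≤ mainTerm n + 9.73 * (n : ℝ) ^ (3 / 4 : ℝ) * Real.log n ∧
    mainTerm (n + 1) ≤ sumSqNat n + 9.73 * (n : ℝ) ^ (3 / 4 : ℝ) * Real.log n := by
  obtain ⟨lo, hi, r, hlo, hhi, hr, ht⟩ := exists_testAt h2 hn
  simp only [testAt, Bool.and_eq_true, Bool.or_eq_true, Nat.blt_eq, Nat.ble_eq] at ht
  obtain ⟨t1, t2, t3, t4⟩ := ht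
  set K : ℝ := (logScale : ℝ) with hK
  have hK0 : 0 < K := logScale_pos
  have hn2 : (2 : ℝ) ≤ n := by exact_mod_cast h2
  set a : ℝ := lo / K with ha
  set b : ℝ := hi / K with hb
  have ha0 : 0 ≤ a := by positivity
  have hb0 : 0 ≤ b := by positivity
  have elo : (lo : ℝ) = a * K := by rw [ha]; field_simp
  have ehi : (hi : ℝ) = b * K := by rw [hb]; field_simp
  have hal : a ≤ Real.log n := by
    rw [elo] at hlo; nlinarith
  have hbl : Real.log ((n : ℝ) + 1) ≤ b := by
    rw [ehi] at hhi; nlinarith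
  have hK3 : 0 < K ^ 3 := by positivity
  set S : ℝ := (sumSqNat n : ℝ) with hS
  have ha3 : a ^ 3 ≤ Real.log n ^ 3 := by gcongr
  have hrn : (r : ℝ) ≤ (n : ℝ) ^ (3 / 4 : ℝ) := by
    have h1 : (r : ℝ) ^ 4 ≤ (n : ℝ) ^ 3 := by exact_mod_cast hr
    refine le_of_pow_le_pow_left₀ (n := 4) (by norm_num) (by positivity) ?_
    rw [← Real.rpow_natCast ((n : ℝ) ^ (3 / 4 : ℝ)), ← Real.rpow_mul (by positivity)]
    norm_num
    exact h1
  have hB : 9.73 * (r * a) ≤ 9.73 * (n : ℝ) ^ (3 / 4 : ℝ) * Real.log n := by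
    have := mul_le_mul hrn hal ha0 (by positivity)
    linarith
  -- On `[n, n + 1)` the sum is constant and the main term increases, so it is enough to bound the
  -- sum above by the main term at `n` and below by that at `n + 1`, with the error allowance taken
  -- at `n`. The four-digit coefficients in `testAt` are outward roundings of `D1`, ..., `D4`.
  refine ⟨fun h => ?_, fun h => ?_, ?_, ?_⟩
  · have h1 : (4 * S * K ^ 3 : ℝ) ≤ n * (lo : ℝ) ^ 3 := by
      simp only [hK, hS]
      exact_mod_cast t1.resolve_left (by omega)
    rw [elo] at h1
    have h2 : S * 4 ≤ n * a ^ 3 := by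
      refine le_of_mul_le_mul_right ?_ hK3
      linarith
    have : (n : ℝ) * a ^ 3 ≤ n * Real.log n ^ 3 := by gcongr
    linarith
  · have h1 : (S * K ^ 3 : ℝ) ≤ n * (lo : ℝ) ^ 3 := by
      simp only [hK, hS]
      exact_mod_cast t2.resolve_left (by omega)
    rw [elo] at h1
    have h2 : S ≤ n * a ^ 3 := by
      refine le_of_mul_le_mul_right ?_ hK3
      linarith
    have : (n : ℝ) * a ^ 3 ≤ n * Real.log n ^ 3 := by gcongr
    linarith
  · have h1 : (10000 * K ^ 3 * S : ℝ) ≤ n * (1013 * (lo : ℝ) ^ 3 + 7440 * K * lo ^ 2 +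
      8230 * K ^ 2 * lo + 4600 * K ^ 3) + 97300 * r * lo * K ^ 2 := by
      simp only [hK, hS]
      exact_mod_cast t3
    rw [elo] at h1
    have h2 : S ≤ n * (0.1013 * a ^ 3 + 0.744 * a ^ 2 + 0.823 * a + 0.46) + 9.73 * (r * a) := by
      refine le_of_mul_le_mul_right ?_ hK3
      linarith
    have h3 : n * (0.1013 * a ^ 3 + 0.744 * a ^ 2 + 0.823 * a + 0.46) ≤
        n * (D1 * Real.log n ^ 3 + D2 * Real.log n ^ 2 + D3 * Real.log n + D4) := by
      have := D1_bounds.1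
      have := D2_bounds.1
      have := D3_bounds.1
      have := D4_bounds.1
      gcongr <;> linarith
    rw [mainTerm]
    linarith
  · have h1 : (n + 1) * (1014 * (hi : ℝ) ^ 3 + 7450 * K * hi ^ 2 + 8240 * K ^ 2 * hi +
      4610 * K ^ 3) ≤ 10000 * K ^ 3 * S + 97300 * r * lo * K ^ 2 := by
      simp only [hK, hS]
      exact_mod_cast t4
    rw [elo, ehi] at h1
    have h2 : (n + 1) * (0.1014 * b ^ 3 + 0.745 * b ^ 2 + 0.824 * b + 0.461) ≤
        S + 9.73 * (r * a) := by
      refine le_of_mul_le_mul_right ?_ hK3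
      linarith
    have hl : 0 ≤ Real.log ((n : ℝ) + 1) := Real.log_nonneg (by linarith)
    have h3 : (n + 1) * (D1 * Real.log ((n : ℝ) + 1) ^ 3 + D2 * Real.log ((n : ℝ) + 1) ^ 2 +
        D3 * Real.log ((n : ℝ) + 1) + D4) ≤
        (n + 1) * (0.1014 * b ^ 3 + 0.745 * b ^ 2 + 0.824 * b + 0.461) := by
      have := D1_bounds.2
      have := D2_bounds.2
      have := D3_bounds.2
      have := D4_bounds.2
      gcongr <;> linarith
    rw [mainTerm]
    linarith

end SmallArguments

/-! ### Combining both ranges -/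

section AllArguments

theorem log_1600_ge : 7.37 ≤ Real.log 1600 := by
  have h2 := Real.log_two_gt_d9
  have h5 : Real.log 1.5625 = Real.log 1600 - 10 * Real.log 2 := by
    -- The factorization behind the bound is `1600 = 2¹⁰ · 1.25²`.
    rw [show (1.5625 : ℝ) = 1600 / 2 ^ 10 by norm_num, Real.log_div (by norm_num) (by norm_num),
      Real.log_pow]
    norm_num
  have h := le_log_sub_log (a := 1) (b := 1.25) (by norm_num) (by norm_num)
  have h6 : Real.log 1.5625 = 2 * Real.log 1.25 := by
    rw [show (1.5625 : ℝ) = 1.25 ^ 2 by norm_num, Real.log_pow]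
    norm_num
  rw [Real.log_one] at h
  norm_num at h h2 h5 h6 ⊢
  linarith

theorem exists_pow_four {x : ℝ} (hx : 1600 ≤ x) :
    ∃ q : ℝ, 6.32 ≤ q ∧ x = q ^ 4 ∧ x ^ (3 / 4 : ℝ) = q ^ 3 ∧ Real.log x = 4 * Real.log q ∧
      7.37 ≤ 4 * Real.log q := by
  have hx0 : 0 < x := by linarith
  have hq : x = (x ^ (1 / 4 : ℝ)) ^ 4 := by
    rw [← Real.rpow_natCast, ← Real.rpow_mul hx0.le]
    norm_num
  have hlog : Real.log x = 4 * Real.log (x ^ (1 / 4 : ℝ)) := by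
    rw [Real.log_rpow hx0]; ring
  refine ⟨x ^ (1 / 4 : ℝ), ?_, hq, ?_, hlog, ?_⟩
  · refine le_of_pow_le_pow_left₀ (n := 4) (by norm_num) (by positivity) ?_
    rw [← hq]
    norm_num
    linarith
  · rw [← Real.rpow_natCast, ← Real.rpow_mul hx0.le]
    norm_num
  · rw [← hlog]
    exact log_1600_ge.trans (Real.log_le_log (by norm_num) hx)

theorem abs_sumSqDivisors_sub_mainTerm_le {x : ℝ} (hx : 2 ≤ x) :
    |sumSqDivisors x - mainTerm x| ≤ 9.73 * x ^ (3 / 4 : ℝ) * Real.log x := by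
  rcases lt_or_ge x 1600 with h | h
  · have hx0 : 0 ≤ x := by linarith
    have h2 : 2 ≤ ⌊x⌋₊ := Nat.le_floor (by exact_mod_cast hx)
    have hn : ⌊x⌋₊ < 1600 := (Nat.floor_lt hx0).2 (by exact_mod_cast h)
    obtain ⟨-, -, b1, b2⟩ := bounds_of_lt h2 hn
    have hnx := Nat.floor_le hx0
    have hxn := (Nat.lt_floor_add_one x).le
    have hn2 : (2 : ℝ) ≤ (⌊x⌋₊ : ℝ) := by exact_mod_cast h2
    have m1 := mainTerm_mono (by linarith) hnx
    have m2 := mainTerm_mono (by linarith) hxn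
    have hl : 0 ≤ Real.log ⌊x⌋₊ := Real.log_nonneg (by linarith)
    have hB : 9.73 * (⌊x⌋₊ : ℝ) ^ (3 / 4 : ℝ) * Real.log ⌊x⌋₊ ≤
        9.73 * x ^ (3 / 4 : ℝ) * Real.log x := by
      have : Real.log ⌊x⌋₊ ≤ Real.log x := Real.log_le_log (by linarith) hnx
      gcongr
    rw [sumSqDivisors_eq, abs_le]
    constructor <;> linarith
  · obtain ⟨q, hq, hx4, hx3, hlog, hL⟩ := exists_pow_four h
    have hq1 : 1 ≤ q := by linarith
    have h1 := (abs_sumSqDivisors_sub_le_of_large hq1 hL).trans (large_bound_le hq1 hL)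
    rw [mainTerm, hx3, hlog, hx4]
    exact h1

theorem sumSqDivisors_le_of_large {x : ℝ} (hx : 1600 ≤ x) :
    sumSqDivisors x ≤ 1 / 4 * x * Real.log x ^ 3 := by
  have h := (abs_le.1 (abs_sumSqDivisors_sub_mainTerm_le (x := x) (by linarith))).2
  obtain ⟨q, hq, hx4, hx3, hlog, hL⟩ := exists_pow_four hx
  rw [mainTerm] at h
  rw [hx3, hlog] at h
  rw [hlog]
  set L := 4 * Real.log q
  have hx0 : 0 < x := by linarith
  -- The error `9.73 q³ L` becomes at most `1.54 x L`, as `9.73/6.32 < 1.54`. The gap between `D1 <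
  -- 0.10133` and `1/4` then dominates all lower powers of `L` once `L ≥ 7.37`.
  have h3 : q ^ 3 ≤ x * (1 / 6.32) := by
    rw [hx4]
    have : 0 ≤ q ^ 3 * (q - 6.32) := mul_nonneg (by positivity) (by linarith)
    linarith
  have hL0 : 0 ≤ L := by linarith
  have e : 9.73 * q ^ 3 * L ≤ x * (1.54 * L) := by
    have := mul_le_mul_of_nonneg_right h3 hL0
    have := mul_nonneg hx0.le hL0
    linarith
  have d1 := D1_bounds.2
  have d2 := D2_bounds.2
  have d3 := D3_bounds.2
  have d4 := D4_bounds.2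
  have key : D1 * L ^ 3 + D2 * L ^ 2 + D3 * L + D4 + 1.54 * L ≤ 1 / 4 * L ^ 3 := by
    have : D1 * L ^ 3 + D2 * L ^ 2 + D3 * L + D4 ≤
        0.10133 * L ^ 3 + 0.7444 * L ^ 2 + 0.8234 * L + 0.461 := by gcongr
    have g1 : 7.37 * L ^ 2 ≤ L ^ 3 := by nlinarith [sq_nonneg L]
    nlinarith
  have := mul_le_mul_of_nonneg_left key hx0.le
  linarith

theorem sumSqDivisors_le_of_floor {c : ℝ} (hc : 0 ≤ c) {x : ℝ} (hx : 1 ≤ x)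
    (h : (sumSqNat ⌊x⌋₊ : ℝ) ≤ c * ⌊x⌋₊ * Real.log ⌊x⌋₊ ^ 3) :
    sumSqDivisors x ≤ c * x * Real.log x ^ 3 := by
  rw [sumSqDivisors_eq]
  refine h.trans ?_
  have h1 : (1 : ℝ) ≤ (⌊x⌋₊ : ℝ) := by exact_mod_cast Nat.le_floor (by exact_mod_cast hx)
  have hnx := Nat.floor_le (show 0 ≤ x by linarith)
  have hl := Real.log_nonneg h1
  have : Real.log ⌊x⌋₊ ≤ Real.log x := Real.log_le_log (by linarith) hnx
  gcongr

end AllArguments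

end DivisorSquare

theorem theorem2 :
    (∀ x : ℝ, 2 ≤ x →
      |DivisorSquare.sumSqDivisors x -
          (DivisorSquare.D1 * x * Real.log x ^ 3 + DivisorSquare.D2 * x * Real.log x ^ 2
            + DivisorSquare.D3 * x * Real.log x + DivisorSquare.D4 * x)|
        ≤ 9.73 * x ^ (3 / 4 : ℝ) * Real.log x + 0.73 * x ^ (1 / 2 : ℝ)) ∧
    DivisorSquare.D1 = 1 / Real.pi ^ 2 ∧
    (0.744 < DivisorSquare.D2 ∧ DivisorSquare.D2 < 0.745) ∧
    (0.823 < DivisorSquare.D3 ∧ DivisorSquare.D3 < 0.824) ∧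
    (0.460 < DivisorSquare.D4 ∧ DivisorSquare.D4 < 0.461) ∧
    (∀ x : ℝ, 433 ≤ x → DivisorSquare.sumSqDivisors x ≤ 1 / 4 * x * Real.log x ^ 3) ∧
    (∀ x : ℝ, 7 ≤ x → DivisorSquare.sumSqDivisors x ≤ 1 * x * Real.log x ^ 3) := by
  refine ⟨fun x hx => ?_, DivisorSquare.D1_eq, ⟨?_, ?_⟩, ⟨?_, ?_⟩, ⟨?_, ?_⟩, fun x hx => ?_, fun x hx => ?_⟩
  · have h := DivisorSquare.abs_sumSqDivisors_sub_mainTerm_le hx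
    -- The second error term is pure slack: the bound already holds without it.
    have h2 : 0 ≤ 0.73 * x ^ (1 / 2 : ℝ) := by positivity
    rw [DivisorSquare.mainTerm] at h
    linarith
  · linarith [DivisorSquare.D2_bounds.1]
  · linarith [DivisorSquare.D2_bounds.2]
  · linarith [DivisorSquare.D3_bounds.1]
  · linarith [DivisorSquare.D3_bounds.2]
  · linarith [DivisorSquare.D4_bounds.1]
  · linarith [DivisorSquare.D4_bounds.2]
  · rcases lt_or_ge x 1600 with h | h
    · have hn : ⌊x⌋₊ < 1600 := (Nat.floor_lt (by linarith)).2 (by exact_mod_cast h)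
      have h433 : 433 ≤ ⌊x⌋₊ := Nat.le_floor (by exact_mod_cast hx)
      exact DivisorSquare.sumSqDivisors_le_of_floor (by norm_num) (by linarith)
        ((DivisorSquare.bounds_of_lt (by omega) hn).1 h433)
    · exact DivisorSquare.sumSqDivisors_le_of_large h
  · rcases lt_or_ge x 1600 with h | h
    · have hn : ⌊x⌋₊ < 1600 := (Nat.floor_lt (by linarith)).2 (by exact_mod_cast h)
      have h7 : 7 ≤ ⌊x⌋₊ := Nat.le_floor (by exact_mod_cast hx)
      refine DivisorSquare.sumSqDivisors_le_of_floor (by norm_num) (by linarith) ?_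
      rw [one_mul]
      exact (DivisorSquare.bounds_of_lt (by omega) hn).2.1 h7
    · refine (DivisorSquare.sumSqDivisors_le_of_large h).trans ?_
      have hl : 0 ≤ Real.log x := Real.log_nonneg (by linarith)
      gcongr
      norm_num
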